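/- Fix $\beta>0$ and integers $m\ge n\ge 1$. Let $\mathcal J$ be drawn from the Laguerre $\beta$-ensemble $\mathrm{L}\beta\mathrm{E}_{(m,n)}$, that is, let $\mathcal J=B^{*}B$, where $B$ is the random $n\times n$ upper bidiagonal matrix with diagonal entries $x_1,\dots,x_n$ and superdiagonal entries $y_1,\dots,y_{n-1}$ (all other entries are $0$), all these entries being independent, with $x_j\sim\chi_{\beta(m-j+1)}$ for $1\le j\le n$ and $y_j\sim\chi_{\beta(n-j)}$ for $1\le j\le n-1$; here $\chi_k$ is the chi distribution with $k>0$ degrees of freedom, with density $\frac{2^{1-k/2}}{\Gamma(k/2)}t^{k-1}e^{-t^2/2}$ on $t>0$. Let $l>0$ be a random variable independent of $\mathcal J$ with absolutely continuous distribution $d\nu(l)=F(l)\,dl$. Let $e_1$ be the first standard basis vector of $\mathbb C^n$, let $z_1,\dots,z_n$ be the eigenvalues (with multiplicity) of $\mathcal J_{l,\times}=(I_n+i\,l\,e_1e_1^{*})\mathcal J$, and let $\mathbb C_+=\{z\in\mathbb C:\operatorname{Im}z>0\}$. Then, almost surely, the eigenvalues lie in $$S=\Big\{(z_j)_{j=1}^n\in(\mathbb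 C_+)^n:\ \sum_{j=1}^n\operatorname{Arg}z_j<\tfrac{\pi}{2},\ \ \tan\Big(\sum_{j=1}^n\operatorname{Arg}z_j\Big)\in\operatorname{supp}\nu\Big\},$$ and their joint distribution (as unordered points, i.e. with labels assigned uniformly at random) is given on $S$ by $$\frac1{C_{\beta,n,m}}\,e^{-\sum_{j=1}^n\operatorname{Re}z_j/2}\,\Big|\operatorname{Re}\Big(\prod_{j=1}^n z_j\Big)\Big|^{a\beta/2-\beta/2}\prod_{j,k=1}^n|z_j-\bar z_k|^{\beta/2-1}\prod_{1\le j<k\le n}|z_j-z_k|^2\;\frac{F(l)}{l^{\beta n/2-1}}\;d^2z_1\cdots d^2z_n,$$ where $l=\tan\big(\sum_{j=1}^n\operatorname{Arg}z_j\big)$, $a=m-n+1-2/\beta$, $C_{\beta,n,m}=s_{\beta,n,m}\,2^{n(\beta/2-1)}$, and $$s_{\beta,n,m}=\frac{2^{n(a\beta/2+1+(n-1)\beta/2)}\,\Gamma(\beta/2)^n}{\Gamma(\beta n/2)}\prod_{j=1}^n\frac{\Gamma(1+\beta j/2)\,\Gamma(1+\beta a/2+\beta(j-1)/2)}{\Gamma(1+\beta/2)}.$$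 -/

import Mathlib

open MeasureTheory ProbabilityTheory Polynomial

noncomputable section

namespace LaguerrePerturbation

/-- Real square matrices carry the product (entrywise Borel) σ-algebra. -/
instance matrixMeasurableSpace (n : ℕ) : MeasurableSpace (Matrix (Fin n) (Fin n) ℝ) :=
  inferInstanceAs (MeasurableSpace (Fin n → Fin n → ℝ))

/-- The chi distribution with `k > 0` (not necessarily integer) degrees of freedom:
density `2 ^ (1 - k/2) / Γ(k/2) * t ^ (k - 1) * exp (-t²/2)` on `t > 0`. -/
def chiLaw (k : ℝ) : Measure ℝ :=
  (volume.restrict (Set.Ioi 0)).withDensity fun t =>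
    ENNReal.ofReal (2 ^ (1 - k / 2) / Real.Gamma (k / 2) * t ^ (k - 1) * Real.exp (-t ^ 2 / 2))

/-- The upper bidiagonal matrix with diagonal `x` and superdiagonal `y`. -/
def bidiagonal {n : ℕ} (x : Fin n → ℝ) (y : Fin (n - 1) → ℝ) : Matrix (Fin n) (Fin n) ℝ :=
  Matrix.of fun i j =>
    if i = j then x i
    else if h : (i : ℕ) + 1 = (j : ℕ) then y ⟨i, by omega⟩
    else 0

/-- The joint law of the bidiagonal coefficients: all independent, the `j`-th diagonal one
(counted from `1`) is chi with `β (m - j + 1)` degrees of freedom, and the `j`-th superdiagonal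
one is chi with `β (n - j)` degrees of freedom. The indices `j` below are counted from `0`. -/
def coefficientLaw (β : ℝ) (m n : ℕ) : Measure ((Fin n → ℝ) × (Fin (n - 1) → ℝ)) :=
  (Measure.pi fun j : Fin n => chiLaw (β * ((m : ℝ) - (j : ℕ)))).prod
    (Measure.pi fun j : Fin (n - 1) => chiLaw (β * ((n : ℝ) - ((j : ℕ) + 1))))

/-- The Laguerre `β`-ensemble `LβE_(m,n)` for `m ≥ n`: the law of the random Jacobi matrix
`Bᵀ B`, where `B` is bidiagonal with independent chi-distributed coefficients. -/
def laguerreLaw (β : ℝ) (m n : ℕ) : Measure (Matrix (Fin n) (Fin n) ℝ) :=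
  (coefficientLaw β m n).map fun p => (bidiagonal p.1 p.2).transpose * bidiagonal p.1 p.2

/-- The first standard basis vector `e₁` of `ℂⁿ`. -/
def e₁ (n : ℕ) [NeZero n] : Fin n → ℂ := Pi.single 0 1

/-- The multiplicative perturbation `(I + i l e₁ e₁*) J`. -/
def perturbed {n : ℕ} [NeZero n] (l : ℝ) (J : Matrix (Fin n) (Fin n) ℝ) :
    Matrix (Fin n) (Fin n) ℂ :=
  (1 + (Complex.I * (l : ℂ)) • Matrix.vecMulVec (e₁ n) (star (e₁ n))) * J.map Complex.ofReal

/-- `z` lists the eigenvalues of `A`, each repeated according to its algebraic multiplicity. -/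
def ListsEigenvalues {n : ℕ} (A : Matrix (Fin n) (Fin n) ℂ) (z : Fin n → ℂ) : Prop :=
  A.charpoly.roots = Finset.univ.val.map z

/-- The joint law of the `n` points `z₁, …, zₙ` with a labelling chosen uniformly at random: the
average over all permutations `σ` of the laws of `(z_{σ(1)}, …, z_{σ(n)})`. It depends only on the
random multiset of points. -/
def unorderedLaw {Ω : Type*} [MeasurableSpace Ω] (P : Measure Ω) {n : ℕ} (z : Ω → Fin n → ℂ) :
    Measure (Fin n → ℂ) :=
  (n.factorial : ENNReal)⁻¹ • ∑ σ : Equiv.Perm (Fin n), P.map fun ω j => z ω (σ j)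

/-- The absolutely continuous measure `dν(t) = F(t) dt` on the real line. -/
def densityMeasure (F : ℝ → ℝ) : Measure ℝ :=
  volume.withDensity fun t => ENNReal.ofReal (F t)

/-- The parameter `a = m - n + 1 - 2/β`, for `m ≥ n`. -/
def aParam (β : ℝ) (m n : ℕ) : ℝ := (m : ℝ) - n + 1 - 2 / β

/-- The constant `s_{β,n,m}` (the factor with index `j` below is the one usually indexed by
`j + 1`, with `1 ≤ j + 1 ≤ n`). -/
def sConst (β : ℝ) (m n : ℕ) : ℝ :=
  2 ^ (n * (aParam β m n * β / 2 + 1 + ((n : ℝ) - 1) * β / 2)) * Real.Gamma (β / 2) ^ n /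
      Real.Gamma (β * n / 2) *
    ∏ j : Fin n,
      Real.Gamma (1 + β * ((j : ℕ) + 1) / 2) *
          Real.Gamma (1 + β * aParam β m n / 2 + β * (j : ℕ) / 2) /
        Real.Gamma (1 + β / 2)

/-- The normalization `C_{β,n,m} = s_{β,n,m} 2 ^ (n (β/2 - 1))`. -/
def cConst (β : ℝ) (m n : ℕ) : ℝ := sConst β m n * 2 ^ (n * (β / 2 - 1))

/-- The set of configurations in the open upper half-plane whose arguments add up to an acute
angle with tangent in the support of `ν`. -/
def configurations (n : ℕ) (ν : Measure ℝ) : Set (Fin n → ℂ) :=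
  {z | (∀ j, 0 < (z j).im) ∧ ∑ j, (z j).arg < Real.pi / 2 ∧
    Real.tan (∑ j, (z j).arg) ∈ ν.support}

/-- The claimed joint density, where `l = tan (∑ j, arg (z j))`. -/
def jointDensity (β : ℝ) (m n : ℕ) (F : ℝ → ℝ) (z : Fin n → ℂ) : ℝ :=
  let l := Real.tan (∑ j, (z j).arg)
  (cConst β m n)⁻¹ * Real.exp (-(∑ j, (z j).re) / 2) *
    |(∏ j, z j).re| ^ (aParam β m n * β / 2 - β / 2) *
    (∏ j, ∏ k, ‖z j - starRingEnd ℂ (z k)‖ ^ (β / 2 - 1)) *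
    (∏ j, ∏ k ∈ Finset.Ioi j, ‖z j - z k‖ ^ 2) *
    (F l / l ^ (β * n / 2 - 1))

end LaguerrePerturbation

end

/-! Write n = d + 1. Let P be the characteristic polynomial of J = BᵀB, let Q be that of J with its
first row and column deleted, and put M = XQ - P. The determinant is linear in the first row, so (I
+ i l e₁e₁*)J has characteristic polynomial f = P - i l M (`charpoly_perturbed`). The eigenvalues
therefore depend only on (l, P, Q). The law is computed by a change of variables from l and the
squared entries u, v of B to the roots of f, in three stages.

From (u, v) to (P, Q): removing the first row of B gives Q = p - v₀q and P = XQ - u₀p, where (p, q)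
is the pair of the smaller matrix. Running this Stieltjes continued fraction backwards shows that
positive parameters correspond exactly to pairs in which P has simple positive roots and Q/P has
positive residues (`mem_stieltjesRegion_iff`). Each step is a reflection and a scaling of
coefficient vectors, so the Jacobian is a monomial (`setLIntegral_stieltjesRegion`).

From (l, P, Q) to the coefficients of f: the real parts give P. The constant term is P(0)(1 + i l),
which gives l, and the other imaginary parts then give Q. The Jacobian is |P(0)| l^d
(`setLIntegral_coeffsRegion`).

From coefficients to roots: the Jacobian is the squared Vandermonde modulus, and almost every
polynomial is counted n! times (`lintegral_vandermondeSq_mul`). A Hermite–Biehler argument shows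
that the roots obtained are exactly the points of the upper half-plane with total argument below
π/2: f has real part P on the real axis, and the argument of ∏(z_j - x) controls the sign of P to
the left of 0.

The chi-square density must then be written in terms of the roots. One has ∑u + ∑v = tr J = ∑ Re
z_j, ∏u = |P(0)| = |Re ∏z_j|, and l is the tangent of the total argument. Since the conjugate
polynomial differs from f by 2 i l M, the product of all |z_j - conj z_k| is (2l)^n times a
resultant of f and M, which the recursion evaluates as a monomial in u, v (`prod_norm_sub_conj`).
The exponents and constants then match (`squaredDensity_mul`).

Finally, almost surely the real parts of the roots are distinct, so the law of f determines the law
of the randomly labelled roots (`symmetrization_congr`). The equality of laws is thus proved for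
characteristic polynomials (`map_charCoeffs_eq`) and transferred to the points. -/

namespace LaguerrePerturbation

/-! ### Rational functions with simple real poles and positive residues -/

/-- `B / A` is a sum of simple fractions `r / (X - x)` with positive numerators. -/
def IsPositivePair (A B : ℝ[X]) : Prop :=
  ∃ (s : Finset ℝ) (r : ℝ → ℝ), s.Nonempty ∧ (∀ x ∈ s, 0 < r x) ∧ A = Lagrange.nodal s id ∧
    B = ∑ x ∈ s, C (r x) * Lagrange.nodal (s.erase x) id

/-- Conjugation symmetry also excludes zeros in the lower half-plane, so all complex roots are real.
This is how every real-rootedness claim below is proved. -/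
theorem splits_of_aeval_ne_zero {f : ℝ[X]} (h : ∀ z : ℂ, 0 < z.im → aeval z f ≠ 0) :
    f.Splits := by
  refine Splits.of_splits_map_of_injective (i := algebraMap ℝ ℂ) (algebraMap ℝ ℂ).injective
    (IsAlgClosed.splits _) ?_
  intro z hz
  have hz0 : aeval z f = 0 := by
    have := (mem_roots'.1 hz).2
    rwa [IsRoot.def, eval_map_algebraMap] at this
  rcases lt_trichotomy z.im 0 with him | him | him
  · refine absurd ?_ (h (starRingEnd ℂ z) (by simpa using him))
    rw [aeval_conj, hz0, map_zero]
  · exact ⟨z.re, by apply Complex.ext <;> simp [him]⟩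
  · exact absurd hz0 (h z him)

/-- The residue of B/A at a simple root is B/A', which has the sign of B·A'. The sign condition also
forces A' ≠ 0, so it gives simplicity for free. -/
theorem IsPositivePair.of_eval {A B : ℝ[X]} (hA : A.Monic) (hs : A.Splits)
    (hd : A.natDegree ≠ 0) (hB : B.degree < A.degree)
    (h : ∀ x, A.eval x = 0 → 0 < B.eval x * (derivative A).eval x) : IsPositivePair A B := by
  classical
  have hA0 := hA.ne_zero
  have hnd : A.roots.Nodup := by
    rw [Multiset.nodup_iff_count_le_one]
    intro x
    by_contra! hx
    rw [count_roots, one_lt_rootMultiplicity_iff_isRoot hA0] at hx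
    have := h x hx.1
    rw [hx.2.eq_zero] at this
    simp at this
  have hnod : A = Lagrange.nodal A.roots.toFinset id := by
    conv_lhs => rw [hs.eq_prod_roots_of_monic hA]
    rw [Lagrange.nodal_eq, Finset.prod, Multiset.toFinset_val, hnd.dedup]
    rfl
  have hcard : A.roots.toFinset.card = A.natDegree := by
    rw [Multiset.toFinset_card_of_nodup hnd, hs.natDegree_eq_card_roots]
  have hmem : ∀ x ∈ A.roots.toFinset, A.eval x = 0 := fun x hx => by
    simpa [hA0] using hx
  have hr : ∀ x ∈ A.roots.toFinset, 0 < B.eval x / (derivative A).eval x := by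
    intro x hx
    have := h x (hmem x hx)
    rcases lt_trichotomy ((derivative A).eval x) 0 with h1 | h1 | h1
    · exact div_pos_of_neg_of_neg (by nlinarith) h1
    · simp [h1] at this
    · exact div_pos (by nlinarith) h1
  refine ⟨A.roots.toFinset, fun x => B.eval x / (derivative A).eval x,
    Finset.card_pos.1 (by omega), hr, hnod, ?_⟩
  -- Lagrange interpolation: both sides have degree below the number of nodes and agree at each of
  -- them.
  · refine eq_of_degrees_lt_of_eval_finset_eq A.roots.toFinset ?_ ?_ ?_
    · rwa [hcard, ← degree_eq_natDegree hA0]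
    · refine (degree_sum_le _ _).trans_lt ?_
      rw [Finset.sup_lt_iff (by exact WithBot.bot_lt_coe _)]
      intro x hx
      rw [degree_C_mul (hr x hx).ne', Lagrange.degree_nodal, Finset.card_erase_of_mem hx]
      have : 0 < A.roots.toFinset.card := Finset.card_pos.2 ⟨x, hx⟩
      exact_mod_cast Nat.sub_lt this one_pos
    · intro x hx
      have hne : (derivative A).eval x ≠ 0 := fun h0 => by
        have := h x (hmem x hx); simp [h0] at this
      have hd' := Lagrange.eval_nodal_derivative_eval_node_eq (v := id) hx
      rw [← hnod] at hd'
      rw [eval_finsetSum, Finset.sum_eq_single x]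
      · rw [eval_mul, eval_C]
        simp only [id] at hd'
        rw [← hd', div_mul_cancel₀ _ hne]
      · intro y hy hyx
        have h0 := Lagrange.eval_nodal_at_node (v := (id : ℝ → ℝ))
          (Finset.mem_erase.2 ⟨hyx.symm, hx⟩)
        rw [id] at h0
        rw [eval_mul, h0, mul_zero]
      · exact fun h => absurd hx h

namespace IsPositivePair

variable {A B : ℝ[X]}

theorem monic (h : IsPositivePair A B) : A.Monic := by
  obtain ⟨s, r, hs, hr, rfl, rfl⟩ := h
  exact Lagrange.nodal_monic

theorem splits (h : IsPositivePair A B) : A.Splits := by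
  obtain ⟨s, r, hs, hr, rfl, rfl⟩ := h
  rw [Lagrange.nodal_eq]
  exact Splits.prod fun i _ => Splits.X_sub_C _

theorem natDegree_ne_zero (h : IsPositivePair A B) : A.natDegree ≠ 0 := by
  obtain ⟨s, r, hs, hr, rfl, rfl⟩ := h
  rw [Lagrange.natDegree_nodal]
  exact (Finset.card_pos.2 hs).ne'

theorem natDegree_le (h : IsPositivePair A B) : B.natDegree ≤ A.natDegree - 1 := by
  obtain ⟨s, r, hs, hr, rfl, rfl⟩ := h
  refine natDegree_sum_le_of_forall_le _ _ fun x hx => ?_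
  refine (natDegree_C_mul_le _ _).trans ?_
  rw [Lagrange.natDegree_nodal, Lagrange.natDegree_nodal, Finset.card_erase_of_mem hx]

theorem coeff_pos (h : IsPositivePair A B) : 0 < B.coeff (A.natDegree - 1) := by
  obtain ⟨s, r, hs, hr, rfl, rfl⟩ := h
  rw [finsetSum_coeff]
  refine Finset.sum_pos (fun x hx => ?_) hs
  rw [coeff_C_mul, Lagrange.natDegree_nodal, ← Finset.card_erase_of_mem hx]
  have : (Lagrange.nodal (s.erase x) (id : ℝ → ℝ)).coeff (s.erase x).card = 1 := by
    have := (Lagrange.nodal_monic (s := s.erase x) (v := (id : ℝ → ℝ))).coeff_natDegree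
    rwa [Lagrange.natDegree_nodal] at this
  rw [this, mul_one]
  exact hr x hx

theorem degree_lt (h : IsPositivePair A B) : B.degree < A.degree := by
  have h1 := h.natDegree_le
  have h2 := h.natDegree_ne_zero
  exact degree_lt_degree (by omega)

theorem nodal_eq_mul_erase {s : Finset ℝ} {x : ℝ} (hx : x ∈ s) :
    Lagrange.nodal s id = (X - C x) * Lagrange.nodal (s.erase x) id :=
  Lagrange.nodal_eq_mul_nodal_erase hx

/-- This is A² times the derivative of B/A, namely -∑ r (A/(X - x))². As a polynomial identity it
remains valid at the poles, where exactly one square survives. -/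
theorem wronskian_neg (h : IsPositivePair A B) (x : ℝ) :
    A.eval x * (derivative B).eval x - (derivative A).eval x * B.eval x < 0 := by
  obtain ⟨s, r, hs, hr, rfl, rfl⟩ := h
  have key : Lagrange.nodal s id * derivative (∑ y ∈ s, C (r y) * Lagrange.nodal (s.erase y) id) -
      derivative (Lagrange.nodal s id) * (∑ y ∈ s, C (r y) * Lagrange.nodal (s.erase y) id) =
      - ∑ y ∈ s, C (r y) * Lagrange.nodal (s.erase y) id ^ 2 := by
    rw [derivative_sum, Finset.mul_sum, Finset.mul_sum, ← Finset.sum_sub_distrib,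
      ← Finset.sum_neg_distrib]
    refine Finset.sum_congr rfl fun y hy => ?_
    rw [nodal_eq_mul_erase hy]
    simp only [derivative_mul, derivative_sub, derivative_X, derivative_C]
    ring
  have := congrArg (eval x) key
  rw [eval_sub, eval_mul, eval_mul, eval_neg] at this
  rw [this, neg_lt_zero, eval_finsetSum]
  by_cases hx : x ∈ s
  · refine Finset.sum_pos' (fun y hy => ?_) ⟨x, hx, ?_⟩
    · rw [eval_mul, eval_C, eval_pow]
      exact mul_nonneg (hr y hy).le (sq_nonneg _)
    · rw [eval_mul, eval_C, eval_pow]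
      refine mul_pos (hr x hx) (sq_pos_of_ne_zero ?_)
      refine Lagrange.eval_nodal_not_at_node fun y hy => ?_
      exact (Finset.ne_of_mem_erase hy).symm
  · refine Finset.sum_pos (fun y hy => ?_) hs
    rw [eval_mul, eval_C, eval_pow]
    refine mul_pos (hr y hy) (sq_pos_of_ne_zero ?_)
    refine Lagrange.eval_nodal_not_at_node fun y hy => ?_
    rintro rfl
    exact hx (Finset.mem_of_mem_erase hy)

theorem aeval_nodal_ne_zero (s : Finset ℝ) {z : ℂ} (hz : 0 < z.im) :
    aeval z (Lagrange.nodal s (id : ℝ → ℝ)) ≠ 0 := by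
  rw [Lagrange.nodal_eq, map_prod, Finset.prod_ne_zero_iff]
  intro x _ h
  have := congrArg Complex.im h
  simp at this
  exact hz.ne' this

/-- Nevanlinna property: each r/(z - x) maps the upper half-plane into the lower one. Multiplication
by |A|² clears the denominator. -/
theorem im_neg (h : IsPositivePair A B) {z : ℂ} (hz : 0 < z.im) :
    (aeval z B * starRingEnd ℂ (aeval z A)).im < 0 := by
  obtain ⟨s, r, hs, hr, rfl, rfl⟩ := h
  rw [map_sum, Finset.sum_mul, Complex.im_sum]
  refine Finset.sum_neg (fun x hx => ?_) hs
  have hN := aeval_nodal_ne_zero (s.erase x) hz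
  rw [nodal_eq_mul_erase hx]
  simp only [map_mul, map_sub, aeval_X, aeval_C, Complex.coe_algebraMap, Complex.conj_ofReal]
  set N := aeval z (Lagrange.nodal (s.erase x) (id : ℝ → ℝ))
  have : (r x : ℂ) * N * ((starRingEnd ℂ z - x) * starRingEnd ℂ N) =
      ((r x * Complex.normSq N : ℝ) : ℂ) * (starRingEnd ℂ z - x) := by
    rw [Complex.ofReal_mul, ← Complex.mul_conj]; ring
  rw [this, Complex.im_ofReal_mul, Complex.sub_im, Complex.conj_im, Complex.ofReal_im]
  nlinarith [mul_pos (mul_pos (hr x hx) (Complex.normSq_pos.2 hN)) hz]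

theorem eval_derivative_pos (h : IsPositivePair A B) {x : ℝ} (hx : A.eval x = 0) :
    0 < B.eval x * (derivative A).eval x := by
  have := h.wronskian_neg x
  rw [hx] at this
  linarith

/-- To the left of all poles every simple fraction is negative; multiply by A². -/
theorem eval_mul_neg (h : IsPositivePair A B) (hpos : ∀ x, A.eval x = 0 → 0 < x) {x : ℝ}
    (hx : x ≤ 0) : A.eval x * B.eval x < 0 := by
  obtain ⟨s, r, hs, hr, rfl, rfl⟩ := h
  rw [eval_finsetSum, Finset.mul_sum]
  refine Finset.sum_neg (fun y hy => ?_) hs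
  have hy0 : 0 < y := hpos y (Lagrange.eval_nodal_at_node (v := id) hy)
  have hne : (Lagrange.nodal (s.erase y) id).eval x ≠ 0 := by
    refine Lagrange.eval_nodal_not_at_node fun w hw => ?_
    have := hpos w (Lagrange.eval_nodal_at_node (v := id) (Finset.mem_of_mem_erase hw))
    exact (hx.trans_lt this).ne
  rw [nodal_eq_mul_erase hy]
  simp only [eval_mul, eval_sub, eval_X, eval_C]
  have h1 := hr y hy
  have h2 := sq_pos_of_ne_zero hne
  have : (x - y) * eval x (Lagrange.nodal (s.erase y) id) *
      (r y * eval x (Lagrange.nodal (s.erase y) id)) =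
      -((y - x) * (r y * eval x (Lagrange.nodal (s.erase y) id) ^ 2)) := by ring
  rw [this, neg_lt_zero]
  exact mul_pos (by linarith) (mul_pos h1 h2)

theorem eval_ne_zero_of_im_pos (h : IsPositivePair A B) {z : ℂ} (hz : 0 < z.im) :
    aeval z A ≠ 0 := fun h0 => by
  have := h.im_neg hz
  simp [h0] at this

theorem splits_right (h : IsPositivePair A B) : B.Splits :=
  splits_of_aeval_ne_zero fun z hz h0 => by
    have := h.im_neg hz
    simp [h0] at this

/-- In the upper half-plane (z - α) - vB/A has imaginary part at least Im z, hence no zero. -/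
theorem splits_linear_mul_sub (h : IsPositivePair A B) (α : ℝ) {v : ℝ} (hv : 0 ≤ v) :
    ((X - C α) * A - C v * B).Splits :=
  splits_of_aeval_ne_zero fun z hz h0 => by
    have h1 := h.im_neg hz
    have h2 : aeval z ((X - C α) * A - C v * B) * starRingEnd ℂ (aeval z A) = 0 := by
      rw [h0, zero_mul]
    simp only [map_mul, map_sub, aeval_X, aeval_C, Complex.coe_algebraMap] at h2
    have h3 : ((z - α) * (Complex.normSq (aeval z A) : ℂ) -
        v * (aeval z B * starRingEnd ℂ (aeval z A))).im = 0 := by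
      rw [← Complex.mul_conj, ← Complex.zero_im, ← h2]; congr 1; ring
    rw [Complex.sub_im, Complex.im_mul_ofReal, Complex.im_ofReal_mul, Complex.sub_im,
      Complex.ofReal_im, sub_zero] at h3
    have h4 := Complex.normSq_pos.2 (h.eval_ne_zero_of_im_pos hz)
    nlinarith [mul_pos hz h4]

/-- The function (x - α) - vB/A is increasing between poles; at a zero its derivative has the sign
of A times the derivative of the numerator. -/
theorem derivative_linear_mul_sub_pos (h : IsPositivePair A B) (α : ℝ) {v : ℝ} (hv : 0 ≤ v)
    {x : ℝ} (hA : A.eval x ≠ 0) (hx : ((X - C α) * A - C v * B).eval x = 0) :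
    0 < A.eval x * (derivative ((X - C α) * A - C v * B)).eval x := by
  have h1 := h.wronskian_neg x
  have h2 := sq_pos_of_ne_zero hA
  simp only [derivative_sub, derivative_mul, derivative_X, derivative_C, eval_sub, eval_mul,
    eval_add, eval_X, eval_C, eval_one, eval_zero] at hx ⊢
  have h3 : eval x A * ((1 - 0) * eval x A + (x - α) * eval x (derivative A) -
      (0 * eval x B + v * eval x (derivative B))) = eval x A ^ 2 +
      eval x (derivative A) * ((x - α) * eval x A - v * eval x B) -
      v * (eval x A * eval x (derivative B) - eval x (derivative A) * eval x B) := by ring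
  rw [h3, hx]
  nlinarith

end IsPositivePair

/-! ### Stieltjes pairs and their stability under the recursion, in both directions -/

/-- `P`, `Q` are monic, `P` has simple positive roots and `Q / P` has positive residues. -/
def IsStieltjesPair (P Q : ℝ[X]) : Prop :=
  IsPositivePair P Q ∧ Q.Monic ∧ ∀ x, P.eval x = 0 → 0 < x

namespace IsStieltjesPair

variable {P Q p q : ℝ[X]}

theorem natDegree_eq (h : IsStieltjesPair P Q) : P.natDegree = Q.natDegree + 1 := by
  have h1 := h.1.natDegree_le
  have h2 := le_natDegree_of_ne_zero h.1.coeff_pos.ne'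
  have h3 := h.1.natDegree_ne_zero
  omega

/-- The residues of XQ - P over P are x times those of Q, and the roots x are positive. Monicity of
both polynomials makes the leading terms cancel. -/
theorem X_mul_sub (h : IsStieltjesPair P Q) : IsPositivePair P (X * Q - P) := by
  have hd := h.natDegree_eq
  refine IsPositivePair.of_eval h.1.monic h.1.splits h.1.natDegree_ne_zero ?_ fun x hx => ?_
  · rw [← neg_sub, degree_neg]
    refine degree_sub_lt_left ?_ h.1.monic.ne_zero ?_
    · rw [degree_mul, degree_X, degree_eq_natDegree h.1.monic.ne_zero, hd,
        degree_eq_natDegree h.2.1.ne_zero]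
      push_cast; ring
    · rw [h.1.monic.leadingCoeff, (monic_X.mul h.2.1).leadingCoeff]
  · have := h.1.eval_derivative_pos hx
    rw [eval_sub, hx, eval_mul, eval_X, sub_zero, mul_assoc]
    exact mul_pos (h.2.2 x hx) this

/-- With Q = p - vq, the polynomial XQ - up equals (X - (u + v))p - v(Xq - p), so the results on (X
- α)A - vB apply to the positive pair (p, Xq - p). -/
theorem of_step (h : IsStieltjesPair p q) {u v : ℝ} (hu : 0 < u) (hv : 0 < v) :
    IsStieltjesPair (X * (p - C v * q) - C u * p) (p - C v * q) := by
  have hd := h.natDegree_eq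
  have hM := h.X_mul_sub
  have hdeg : (C v * q).degree < p.degree := by
    rw [degree_C_mul hv.ne']; exact h.1.degree_lt
  have hQ : (p - C v * q).Monic := h.1.monic.sub_of_left hdeg
  have hQd : (p - C v * q).natDegree = p.natDegree := natDegree_sub_eq_left_of_natDegree_lt
    (by rw [natDegree_C_mul hv.ne']; omega)
  have hP : X * (p - C v * q) - C u * p = (X - C (u + v)) * p - C v * (X * q - p) := by
    rw [C_add]; ring
  have hXQ : (X * (p - C v * q)).Monic := monic_X.mul hQ
  have hXQd : (X * (p - C v * q)).natDegree = p.natDegree + 1 := by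
    rw [natDegree_X_mul hQ.ne_zero, hQd]
  have hPlt : (C u * p).degree < (X * (p - C v * q)).degree := by
    refine degree_lt_degree ?_
    rw [natDegree_C_mul hu.ne', hXQd]; omega
  have hPm : (X * (p - C v * q) - C u * p).Monic := hXQ.sub_of_left hPlt
  have hPd : (X * (p - C v * q) - C u * p).natDegree = p.natDegree + 1 := by
    rw [natDegree_sub_eq_left_of_natDegree_lt, hXQd]
    rw [natDegree_C_mul hu.ne', hXQd]; omega
  have hpos : ∀ x, (X * (p - C v * q) - C u * p).eval x = 0 → 0 < x := by
    intro x hx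
    by_contra! hx0
    have h1 := h.1.eval_mul_neg h.2.2 hx0
    have h2 : p.eval x ≠ 0 := fun h0 => by simp [h0] at h1
    simp only [eval_sub, eval_mul, eval_X, eval_C] at hx
    -- The equation times p(x): since pq < 0 on the nonpositive axis, both terms push the left side
    -- below zero.
    have h3 : x * (p.eval x ^ 2 - v * (p.eval x * q.eval x)) - u * p.eval x ^ 2 = 0 := by
      linear_combination p.eval x * hx
    have h4 := sq_pos_of_ne_zero h2
    nlinarith [mul_pos hu h4, mul_neg_of_pos_of_neg hv h1]
  refine ⟨IsPositivePair.of_eval hPm ?_ (by omega) ?_ fun x hx => ?_, hQ, hpos⟩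
  · rw [hP]; exact hM.splits_linear_mul_sub _ hv.le
  · exact degree_lt_degree (by omega)
  · have hx0 := hpos x hx
    -- A common root of p and P would, as x ≠ 0, be a root of q, against qp' > 0 at the roots of p.
    have hpx : p.eval x ≠ 0 := fun h0 => by
      have := h.1.eval_derivative_pos h0
      simp only [eval_sub, eval_mul, eval_X, eval_C, h0] at hx
      have hq : q.eval x = 0 := by
        have : x * v * q.eval x = 0 := by linarith
        simpa [hx0.ne', hv.ne'] using this
      simp [hq] at this
    have h1 := hM.derivative_linear_mul_sub_pos (u + v) hv.le hpx (by rw [← hP]; exact hx)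
    rw [← hP] at h1
    -- At a root of P, xQ = up; this converts the positivity of pP' into that of QP'.
    have h2 : x * (p - C v * q).eval x = u * p.eval x := by
      simp only [eval_sub, eval_mul, eval_X, eval_C] at hx ⊢; linarith
    have h3 := mul_pos hu h1
    rw [← mul_assoc, ← h2, mul_assoc] at h3
    exact (pos_iff_pos_of_mul_pos h3).1 hx0

/-- Inverse of the step. The numerator XQ - P = up of a positive pair over P is real-rooted, and it
cannot vanish on x ≤ 0. At a root of p the Wronskian inequality reads Pp' < 0 with P = xQ, so -Qp' >
0, which is the residue sign for p - Q. -/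
theorem of_derivative_neg (h : IsStieltjesPair P Q) {u : ℝ} (hu : 0 < u) (hp : p.Monic)
    (hpd : p.natDegree ≠ 0) (hpQ : p.natDegree = Q.natDegree) (hM : X * Q - P = C u * p) :
    IsPositivePair p (p - Q) ∧ ∀ x, p.eval x = 0 → 0 < x := by
  have hMP := h.X_mul_sub
  have hpos : ∀ x, p.eval x = 0 → 0 < x := by
    intro x hx
    by_contra! hx0
    have := hMP.eval_mul_neg h.2.2 hx0
    rw [hM, eval_mul, hx] at this
    simp at this
  refine ⟨IsPositivePair.of_eval hp ?_ hpd ?_ fun x hx => ?_, hpos⟩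
  · have := hMP.splits_right
    rw [hM] at this
    have h2 := this.C_mul u⁻¹
    rwa [← mul_assoc, ← C_mul, inv_mul_cancel₀ hu.ne', C_1, one_mul] at h2
  · refine degree_sub_lt_left ?_ hp.ne_zero ?_
    · rw [degree_eq_natDegree hp.ne_zero, degree_eq_natDegree h.2.1.ne_zero, hpQ]
    · rw [hp.leadingCoeff, h.2.1.leadingCoeff]
  · have h0 := hpos x hx
    have h1 := hMP.wronskian_neg x
    rw [hM] at h1
    simp only [derivative_mul, derivative_C, eval_mul, eval_add, eval_C, hx, eval_zero] at h1
    have h2 := congrArg (eval x) hM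
    simp only [eval_sub, eval_mul, eval_X, eval_C, hx] at h2
    have h3 : eval x P = x * eval x Q := by linarith
    rw [h3] at h1
    rw [eval_sub, hx]
    have h4 : 0 < (x * u) * ((0 - eval x Q) * eval x (derivative p)) := by nlinarith
    exact (pos_iff_pos_of_mul_pos h4).1 (mul_pos h0 hu)

end IsStieltjesPair

/-! ### The Stieltjes recursion on coefficient vectors and its inverse -/

/-- One step of the Stieltjes recursion `(p, q) ↦ (X (p - v q) - u p, p - v q)`, on the
non-leading coefficients of monic polynomials. -/
noncomputable def stieltjesStep {d : ℕ} (u v : ℝ) (x : (Fin (d + 1) → ℝ) × (Fin d → ℝ)) :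
    (Fin (d + 2) → ℝ) × (Fin (d + 1) → ℝ) :=
  (Fin.cons 0 (x.1 - Fin.snoc (v • x.2) v) - Fin.snoc (u • x.1) u, x.1 - Fin.snoc (v • x.2) v)

/-- The polynomials obtained from the parameters of a Stieltjes continued fraction. -/
noncomputable def stieltjesPair : (d : ℕ) → (Fin (d + 1) → ℝ) → (Fin d → ℝ) →
    (Fin (d + 1) → ℝ) × (Fin d → ℝ)
  | 0, u, _ => (fun _ => -u 0, Fin.elim0)
  | d + 1, u, v => stieltjesStep (u 0) (v 0) (stieltjesPair d (Fin.tail u) (Fin.tail v))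

/-- The parameter `u` of the last step of the Stieltjes recursion. -/
noncomputable def lastU {d : ℕ} (x : (Fin (d + 2) → ℝ) × (Fin (d + 1) → ℝ)) : ℝ :=
  x.2 (Fin.last d) - x.1 (Fin.last (d + 1))

/-- The polynomial `p` of the last step of the Stieltjes recursion. -/
noncomputable def prevP {d : ℕ} (x : (Fin (d + 2) → ℝ) × (Fin (d + 1) → ℝ)) : Fin (d + 1) → ℝ :=
  fun i => ((Fin.cons 0 x.2 : Fin (d + 2) → ℝ) i.castSucc - x.1 i.castSucc) / lastU x

/-- The parameter `v` of the last step of the Stieltjes recursion. -/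
noncomputable def lastV {d : ℕ} (x : (Fin (d + 2) → ℝ) × (Fin (d + 1) → ℝ)) : ℝ :=
  prevP x (Fin.last d) - x.2 (Fin.last d)

/-- The polynomial `q` of the last step of the Stieltjes recursion. -/
noncomputable def prevQ {d : ℕ} (x : (Fin (d + 2) → ℝ) × (Fin (d + 1) → ℝ)) : Fin d → ℝ :=
  fun i => (prevP x i.castSucc - x.2 i.castSucc) / lastV x

/-- The pairs obtained from positive parameters. -/
def stieltjesRegion : (d : ℕ) → Set ((Fin (d + 1) → ℝ) × (Fin d → ℝ))
  | 0 => {x | x.1 0 < 0}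
  | d + 1 => {x | 0 < lastU x ∧ 0 < lastV x ∧ (prevP x, prevQ x) ∈ stieltjesRegion d}

theorem measurable_snoc {d : ℕ} {α : Type*} [MeasurableSpace α] {f : α → Fin d → ℝ} {g : α → ℝ}
    (hf : Measurable f) (hg : Measurable g) :
    Measurable fun a => (Fin.snoc (f a) (g a) : Fin (d + 1) → ℝ) := by
  refine measurable_pi_lambda _ fun i => ?_
  refine Fin.lastCases ?_ (fun i => ?_) i
  · simpa using hg
  · simpa using measurable_pi_iff.1 hf i

theorem measurable_cons {d : ℕ} {α : Type*} [MeasurableSpace α] {f : α → Fin d → ℝ} {g : α → ℝ}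
    (hf : Measurable f) (hg : Measurable g) :
    Measurable fun a => (Fin.cons (g a) (f a) : Fin (d + 1) → ℝ) := by
  refine measurable_pi_lambda _ fun i => ?_
  refine Fin.cases ?_ (fun i => ?_) i
  · simpa using hg
  · simpa using measurable_pi_iff.1 hf i

theorem measurable_stieltjesStep {d : ℕ} {α : Type*} [MeasurableSpace α] {u v : α → ℝ}
    {x : α → (Fin (d + 1) → ℝ) × (Fin d → ℝ)} (hu : Measurable u) (hv : Measurable v)
    (hx : Measurable x) : Measurable fun a => stieltjesStep (u a) (v a) (x a) := by
  have h1 : Measurable fun a => (x a).1 - (Fin.snoc (v a • (x a).2) (v a) : Fin (d + 1) → ℝ) :=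
    hx.fst.sub (measurable_snoc (hv.smul hx.snd) hv)
  exact ((measurable_cons h1 measurable_const).sub
    (measurable_snoc (hu.smul hx.fst) hu)).prodMk h1

theorem measurable_stieltjesPair (d : ℕ) : Measurable
    fun x : (Fin (d + 1) → ℝ) × (Fin d → ℝ) => stieltjesPair d x.1 x.2 := by
  induction d with
  | zero =>
    refine Measurable.prodMk ?_ measurable_const
    exact measurable_pi_lambda _ fun _ => ((measurable_pi_apply 0).comp measurable_fst).neg
  | succ d ih =>
    refine measurable_stieltjesStep ((measurable_pi_apply 0).comp measurable_fst)
      ((measurable_pi_apply 0).comp measurable_snd) (ih.comp (Measurable.prodMk ?_ ?_))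
    · exact measurable_pi_lambda _ fun i => (measurable_pi_apply i.succ).comp measurable_fst
    · exact measurable_pi_lambda _ fun i => (measurable_pi_apply i.succ).comp measurable_snd

theorem measurable_lastU {d : ℕ} : Measurable (lastU (d := d)) := by
  unfold lastU; fun_prop

theorem measurable_prevP {d : ℕ} : Measurable (prevP (d := d)) := by
  refine measurable_pi_lambda _ fun i => Measurable.div ?_ measurable_lastU
  refine Measurable.sub ?_ (by fun_prop)
  exact (measurable_pi_apply i.castSucc).comp (measurable_cons measurable_snd measurable_const)

theorem measurable_lastV {d : ℕ} : Measurable (lastV (d := d)) := by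
  unfold lastV
  exact ((measurable_pi_apply _).comp measurable_prevP).sub (by fun_prop)

theorem measurable_prevQ {d : ℕ} : Measurable (prevQ (d := d)) := by
  refine measurable_pi_lambda _ fun i => Measurable.div ?_ measurable_lastV
  exact ((measurable_pi_apply _).comp measurable_prevP).sub (by fun_prop)

theorem measurableSet_stieltjesRegion (d : ℕ) : MeasurableSet (stieltjesRegion d) := by
  induction d with
  | zero => exact measurableSet_lt (by fun_prop) measurable_const
  | succ d ih =>
    exact (measurableSet_lt measurable_const measurable_lastU).inter
      ((measurableSet_lt measurable_const measurable_lastV).inter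
        ((measurable_prevP.prodMk measurable_prevQ) ih))

section inverse

variable {d : ℕ} (u v : ℝ) (x : (Fin (d + 1) → ℝ) × (Fin d → ℝ))

theorem lastU_stieltjesStep : lastU (stieltjesStep u v x) = u := by
  have : (Fin.last (d + 1)) = (Fin.last d).succ := rfl
  simp only [lastU, stieltjesStep, Pi.sub_apply]
  rw [this, Fin.cons_succ, ← this, Fin.snoc_last]
  simp

theorem prevP_stieltjesStep (hu : u ≠ 0) : prevP (stieltjesStep u v x) = x.1 := by
  funext i
  rw [prevP, lastU_stieltjesStep]
  simp only [stieltjesStep, Pi.sub_apply, Fin.snoc_castSucc, Pi.smul_apply, smul_eq_mul]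
  field_simp
  ring

theorem lastV_stieltjesStep (hu : u ≠ 0) : lastV (stieltjesStep u v x) = v := by
  rw [lastV, prevP_stieltjesStep _ _ _ hu]
  simp [stieltjesStep]

theorem prevQ_stieltjesStep (hu : u ≠ 0) (hv : v ≠ 0) : prevQ (stieltjesStep u v x) = x.2 := by
  funext i
  rw [prevQ, lastV_stieltjesStep _ _ _ hu, prevP_stieltjesStep _ _ _ hu]
  simp only [stieltjesStep, Pi.sub_apply, Fin.snoc_castSucc, Pi.smul_apply, smul_eq_mul]
  field_simp
  ring

theorem stieltjesStep_mem (hu : u ≠ 0) (hv : v ≠ 0) :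
    stieltjesStep u v x ∈ stieltjesRegion (d + 1) ↔ 0 < u ∧ 0 < v ∧ x ∈ stieltjesRegion d := by
  simp only [stieltjesRegion, Set.mem_ofPred_eq, lastU_stieltjesStep,
    lastV_stieltjesStep _ _ _ hu, prevP_stieltjesStep _ _ _ hu, prevQ_stieltjesStep _ _ _ hu hv]

theorem prevP_sub_snoc_prevQ (y : (Fin (d + 2) → ℝ) × (Fin (d + 1) → ℝ)) (hv : lastV y ≠ 0) :
    prevP y - (Fin.snoc (lastV y • prevQ y) (lastV y) : Fin (d + 1) → ℝ) = y.2 := by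
  funext i
  refine Fin.lastCases ?_ (fun i => ?_) i
  · simp [lastV]
  · simp only [Pi.sub_apply, Fin.snoc_castSucc, Pi.smul_apply, smul_eq_mul, prevQ]
    field_simp
    ring

theorem cons_sub_snoc_prevP (y : (Fin (d + 2) → ℝ) × (Fin (d + 1) → ℝ)) (hu : lastU y ≠ 0) :
    (Fin.cons 0 y.2 : Fin (d + 2) → ℝ) - Fin.snoc (lastU y • prevP y) (lastU y) = y.1 := by
  funext i
  refine Fin.lastCases ?_ (fun i => ?_) i
  · have : (Fin.last (d + 1)) = (Fin.last d).succ := rfl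
    rw [Pi.sub_apply, Fin.snoc_last, lastU, this, Fin.cons_succ]
    ring
  · simp only [Pi.sub_apply, Fin.snoc_castSucc, Pi.smul_apply, smul_eq_mul, prevP]
    field_simp
    ring

end inverse

/-! ### The Jacobian of the recursion -/

theorem lintegral_pi_eq_lintegral_cons {d : ℕ} (μ : Measure ℝ) [SigmaFinite μ]
    {f : (Fin (d + 1) → ℝ) → ENNReal} (hf : Measurable f) :
    ∫⁻ x, f x ∂(Measure.pi fun _ => μ) =
      ∫⁻ a, ∫⁻ x, f (Fin.cons a x) ∂(Measure.pi fun _ => μ) ∂μ := by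
  have := (measurePreserving_piFinSuccAbove (fun _ : Fin (d + 1) => μ) 0).symm
  rw [← this.lintegral_comp hf, lintegral_prod]
  · simp only [MeasurableEquiv.piFinSuccAbove_symm_apply, Fin.insertNthEquiv_zero]
    rfl
  · exact (hf.comp (MeasurableEquiv.measurable _)).aemeasurable

theorem lintegral_pi_eq_lintegral_snoc {d : ℕ} {f : (Fin (d + 1) → ℝ) → ENNReal}
    (hf : Measurable f) : ∫⁻ x, f x = ∫⁻ a : ℝ, ∫⁻ x : Fin d → ℝ, f (Fin.snoc x a) := by
  have := (measurePreserving_piFinSuccAbove (fun _ : Fin (d + 1) => (volume : Measure ℝ))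
    (Fin.last d)).symm
  rw [volume_pi, ← this.lintegral_comp hf, lintegral_prod]
  · simp only [MeasurableEquiv.piFinSuccAbove_symm_apply, Fin.insertNthEquiv_last]
    rfl
  · exact (hf.comp (MeasurableEquiv.measurable _)).aemeasurable

theorem lintegral_eq_lintegral_smul {d : ℕ} {v : ℝ} (hv : v ≠ 0) {f : (Fin d → ℝ) → ENNReal}
    (hf : Measurable f) : ∫⁻ x, f x = ENNReal.ofReal (|v| ^ d) * ∫⁻ x : Fin d → ℝ, f (v • x) := by
  have h := Measure.map_addHaar_smul (volume : Measure (Fin d → ℝ)) hv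
  have h2 : ∫⁻ x : Fin d → ℝ, f (v • x) = ENNReal.ofReal |(v ^ d)⁻¹| * ∫⁻ x, f x := by
    rw [← lintegral_map hf (measurable_const_smul v), h, lintegral_smul_measure]
    simp
  rw [h2, ← mul_assoc, ← ENNReal.ofReal_mul (by positivity), abs_inv, abs_pow,
    mul_inv_cancel₀ (by positivity), ENNReal.ofReal_one, one_mul]

/-- This parametrizes a polynomial by its leading coefficient v and its monic quotient q. The d
lower coefficients scale by v, and the hyperplane v = 0 is null. -/
theorem lintegral_pi_eq_lintegral_snoc_smul {d : ℕ} {f : (Fin (d + 1) → ℝ) → ENNReal}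
    (hf : Measurable f) : ∫⁻ x, f x =
      ∫⁻ v : ℝ, ENNReal.ofReal (|v| ^ d) * ∫⁻ q : Fin d → ℝ, f (Fin.snoc (v • q) v) := by
  rw [lintegral_pi_eq_lintegral_snoc hf]
  refine lintegral_congr_ae ?_
  filter_upwards [Measure.ae_ne volume (0 : ℝ)] with v hv
  exact lintegral_eq_lintegral_smul hv (hf.comp (measurable_snoc measurable_id measurable_const))

/-- For fixed Q write XQ - P as u times a monic p, then for fixed p write p - Q as v times a monic
q. Only the two scalings, of d + 1 and of d coefficients, contribute to the Jacobian. -/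
theorem lintegral_stieltjesStep {d : ℕ} {f : (Fin (d + 2) → ℝ) × (Fin (d + 1) → ℝ) → ENNReal}
    (hf : Measurable f) : ∫⁻ x, f x = ∫⁻ u : ℝ, ∫⁻ v : ℝ,
      ENNReal.ofReal (|u| ^ (d + 1)) * ENNReal.ofReal (|v| ^ d) *
        ∫⁻ x : (Fin (d + 1) → ℝ) × (Fin d → ℝ), f (stieltjesStep u v x) := by
  have hQ : ∀ Q : Fin (d + 1) → ℝ, ∫⁻ P : Fin (d + 2) → ℝ, f (P, Q) =
      ∫⁻ u : ℝ, ENNReal.ofReal (|u| ^ (d + 1)) * ∫⁻ p : Fin (d + 1) → ℝ,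
        f (Fin.cons 0 Q - Fin.snoc (u • p) u, Q) := fun Q => by
    rw [← lintegral_sub_left_eq_self _ (Fin.cons 0 Q : Fin (d + 2) → ℝ)]
    exact lintegral_pi_eq_lintegral_snoc_smul (by fun_prop)
  have m1 : Measurable fun a : (Fin (d + 1) → ℝ) × ℝ × (Fin (d + 1) → ℝ) =>
      f (Fin.cons 0 a.1 - Fin.snoc (a.2.1 • a.2.2) a.2.1, a.1) :=
    hf.comp (((measurable_cons measurable_fst measurable_const).sub
      (measurable_snoc (by fun_prop) (by fun_prop))).prodMk measurable_fst)
  rw [Measure.volume_eq_prod, lintegral_prod_symm _ hf.aemeasurable]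
  simp_rw [hQ]
  rw [lintegral_lintegral_swap (μ := (volume : Measure (Fin (d + 1) → ℝ)))
    (ν := (volume : Measure ℝ))]
  swap
  · refine Measurable.aemeasurable ?_
    refine Measurable.mul (by fun_prop) ?_
    refine Measurable.lintegral_prod_right' (ν := (volume : Measure (Fin (d + 1) → ℝ)))
      (f := fun a : ((Fin (d + 1) → ℝ) × ℝ) × (Fin (d + 1) → ℝ) => f (Fin.cons 0 a.1.1 - Fin.snoc (a.1.2 • a.2) a.1.2, a.1.1)) ?_
    exact m1.comp (by fun_prop : Measurable fun a : ((Fin (d + 1) → ℝ) × ℝ) ×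
      (Fin (d + 1) → ℝ) => (a.1.1, a.1.2, a.2))
  refine lintegral_congr fun u => ?_
  have m2 : Measurable fun a : (Fin (d + 1) → ℝ) × (Fin (d + 1) → ℝ) =>
      f (Fin.cons 0 a.1 - Fin.snoc (u • a.2) u, a.1) :=
    m1.comp (by fun_prop : Measurable fun a : (Fin (d + 1) → ℝ) × (Fin (d + 1) → ℝ) =>
      (a.1, u, a.2))
  rw [lintegral_const_mul _ m2.lintegral_prod_right', lintegral_lintegral_swap m2.aemeasurable]
  have hp : ∀ p : Fin (d + 1) → ℝ,
      ∫⁻ Q : Fin (d + 1) → ℝ, f (Fin.cons 0 Q - Fin.snoc (u • p) u, Q) =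
      ∫⁻ v : ℝ, ENNReal.ofReal (|v| ^ d) * ∫⁻ q : Fin d → ℝ, f (stieltjesStep u v (p, q)) :=
      fun p => by
    rw [← lintegral_sub_left_eq_self _ p]
    exact lintegral_pi_eq_lintegral_snoc_smul (m2.comp
      (by fun_prop : Measurable fun a : Fin (d + 1) → ℝ => (p - a, p)))
  simp_rw [hp]
  have m3 : Measurable fun a : ((Fin (d + 1) → ℝ) × ℝ) × (Fin d → ℝ) =>
      f (stieltjesStep u a.1.2 (a.1.1, a.2)) :=
    hf.comp (measurable_stieltjesStep measurable_const (by fun_prop) (by fun_prop))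
  rw [lintegral_lintegral_swap (μ := (volume : Measure (Fin (d + 1) → ℝ)))
    (ν := (volume : Measure ℝ))]
  swap
  · exact (Measurable.mul (g := fun a : (Fin (d + 1) → ℝ) × ℝ => ∫⁻ q : Fin d → ℝ,
      f (stieltjesStep u a.2 (a.1, q))) (by fun_prop) m3.lintegral_prod_right').aemeasurable
  rw [← lintegral_const_mul]
  swap
  · refine Measurable.lintegral_prod_right' (f := fun a : ℝ × (Fin (d + 1) → ℝ) =>
      ENNReal.ofReal (|a.1| ^ d) * ∫⁻ q : Fin d → ℝ, f (stieltjesStep u a.1 (a.2, q))) ?_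
    exact (Measurable.mul (f := fun a : (Fin (d + 1) → ℝ) × ℝ => ENNReal.ofReal (|a.2| ^ d))
      (g := fun a : (Fin (d + 1) → ℝ) × ℝ => ∫⁻ q : Fin d → ℝ,
      f (stieltjesStep u a.2 (a.1, q))) (by fun_prop)
      m3.lintegral_prod_right').comp measurable_swap
  refine lintegral_congr fun v => ?_
  have m4 : Measurable fun a : (Fin (d + 1) → ℝ) × (Fin d → ℝ) => f (stieltjesStep u v a) :=
    hf.comp (measurable_stieltjesStep measurable_const measurable_const measurable_id)
  rw [lintegral_const_mul _ m4.lintegral_prod_right', mul_assoc, ← lintegral_prod _ m4.aemeasurable]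
  rfl

/-- The Jacobian of the map `stieltjesPair`. -/
noncomputable def stieltjesJacobian (d : ℕ) (u : Fin (d + 1) → ℝ) (v : Fin d → ℝ) : ℝ :=
  (∏ i, u i ^ (d - (i : ℕ))) * ∏ i, v i ^ (d - 1 - (i : ℕ))

theorem stieltjesJacobian_cons {d : ℕ} (a b : ℝ) (u : Fin (d + 1) → ℝ) (v : Fin d → ℝ) :
    stieltjesJacobian (d + 1) (Fin.cons a u) (Fin.cons b v) =
      a ^ (d + 1) * b ^ d * stieltjesJacobian d u v := by
  have h1 : ∀ i : ℕ, d + 1 - (i + 1) = d - i := by omega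
  have h2 : ∀ i : Fin d, d - ((i : ℕ) + 1) = d - 1 - i := by omega
  simp only [stieltjesJacobian, Fin.prod_univ_succ, Fin.cons_zero, Fin.cons_succ, Fin.val_zero,
    Fin.val_succ, Nat.sub_zero, h1, h2]
  ring

theorem measurable_stieltjesJacobian (d : ℕ) : Measurable
    fun x : (Fin (d + 1) → ℝ) × (Fin d → ℝ) => stieltjesJacobian d x.1 x.2 := by
  unfold stieltjesJacobian; fun_prop

/-- Lebesgue measure on the positive orthant. -/
noncomputable def orthantMeasure (d : ℕ) : Measure (Fin d → ℝ) :=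
  Measure.pi fun _ => volume.restrict (Set.Ioi 0)

instance (d : ℕ) : SigmaFinite (orthantMeasure d) := by
  unfold orthantMeasure; infer_instance

/-- Induction on the recursion: each step multiplies the Jacobian by u₀^(d+1) v₀^d, and membership
in the region splits into u₀ > 0, v₀ > 0 and membership of the previous pair. -/
theorem setLIntegral_stieltjesRegion (d : ℕ)
    {g : (Fin (d + 1) → ℝ) × (Fin d → ℝ) → ENNReal} (hg : Measurable g) :
    ∫⁻ x in stieltjesRegion d, g x =
      ∫⁻ u, ∫⁻ v, ENNReal.ofReal (stieltjesJacobian d u v) * g (stieltjesPair d u v)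
        ∂(orthantMeasure d) ∂(orthantMeasure (d + 1)) := by
  have mJ := measurable_stieltjesJacobian
  have mP := measurable_stieltjesPair
  induction d with
  | zero =>
    have h0 : orthantMeasure 0 = Measure.dirac Fin.elim0 := Measure.pi_of_empty _ _
    have h1 : (volume : Measure (Fin 0 → ℝ)) = Measure.dirac Fin.elim0 := Measure.pi_of_empty _ _
    have hgi := hg.indicator (measurableSet_stieltjesRegion 0)
    rw [← lintegral_indicator (measurableSet_stieltjesRegion _), Measure.volume_eq_prod,
      lintegral_prod _ hgi.aemeasurable]
    simp_rw [h0, h1, lintegral_dirac]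
    unfold orthantMeasure
    rw [lintegral_pi_eq_lintegral_cons, volume_pi, lintegral_pi_eq_lintegral_cons,
      Measure.pi_of_empty _ Fin.elim0, Measure.pi_of_empty _ Fin.elim0]
    · simp_rw [lintegral_dirac]
      -- The base pair is (X - u₀, 1), whose only coefficient is -u₀.
      rw [← lintegral_neg_eq_self, ← lintegral_indicator measurableSet_Ioi]
      refine lintegral_congr fun a => ?_
      by_cases ha : 0 < a
      · rw [Set.indicator_of_mem (by simpa [stieltjesRegion] using ha),
          Set.indicator_of_mem (by exact ha)]
        have h2 : (fun _ => -a : Fin 1 → ℝ) = Fin.cons (-a) Fin.elim0 := by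
          funext i; fin_cases i; rfl
        simp [stieltjesJacobian, stieltjesPair, h2]
      · rw [Set.indicator_of_notMem (by simpa [stieltjesRegion] using ha),
          Set.indicator_of_notMem (by exact ha)]
    · exact hgi.comp measurable_prodMk_right
    · exact ((ENNReal.measurable_ofReal.comp (mJ 0)).mul (hg.comp (mP 0))).comp
        measurable_prodMk_right
  | succ d ih =>
    have mG : Measurable fun x : (Fin (d + 2) → ℝ) × (Fin (d + 1) → ℝ) =>
        ENNReal.ofReal (stieltjesJacobian (d + 1) x.1 x.2) * g (stieltjesPair (d + 1) x.1 x.2) :=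
      (ENNReal.measurable_ofReal.comp (mJ _)).mul (hg.comp (mP _))
    set G : (Fin (d + 2) → ℝ) × (Fin (d + 1) → ℝ) → ENNReal := fun x =>
        ENNReal.ofReal (stieltjesJacobian (d + 1) x.1 x.2) * g (stieltjesPair (d + 1) x.1 x.2)
    have hsplit : ∫⁻ u, ∫⁻ v, G (u, v) ∂(orthantMeasure (d + 1)) ∂(orthantMeasure (d + 2)) =
        ∫⁻ a in Set.Ioi (0 : ℝ), ∫⁻ b in Set.Ioi (0 : ℝ), ∫⁻ u, ∫⁻ v,
          G (Fin.cons a u, Fin.cons b v) ∂(orthantMeasure d) ∂(orthantMeasure (d + 1)) := by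
      have mc : Measurable fun y : ((ℝ × (Fin (d + 1) → ℝ)) × ℝ) × (Fin d → ℝ) =>
          G (Fin.cons y.1.1.1 y.1.1.2, Fin.cons y.1.2 y.2) :=
        mG.comp ((measurable_cons (by fun_prop) (by fun_prop)).prodMk
          (measurable_cons (by fun_prop) (by fun_prop)))
      unfold orthantMeasure at *
      rw [lintegral_pi_eq_lintegral_cons _ mG.lintegral_prod_right']
      refine lintegral_congr fun a => ?_
      have h1 : ∀ u : Fin (d + 1) → ℝ,
          ∫⁻ v, G (Fin.cons a u, v) ∂(Measure.pi fun _ : Fin (d + 1) => volume.restrict (Set.Ioi 0)) =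
          ∫⁻ b in Set.Ioi (0 : ℝ), ∫⁻ v, G (Fin.cons a u, Fin.cons b v)
            ∂(Measure.pi fun _ : Fin d => volume.restrict (Set.Ioi 0)) := fun u =>
        lintegral_pi_eq_lintegral_cons _ (mG.comp measurable_prodMk_left)
      simp_rw [h1]
      refine lintegral_lintegral_swap (f := fun (u : Fin (d + 1) → ℝ) (b : ℝ) =>
        ∫⁻ v, G (Fin.cons a u, Fin.cons b v)
          ∂(Measure.pi fun _ : Fin d => volume.restrict (Set.Ioi 0))) ?_
      exact (mc.comp (by fun_prop : Measurable fun y : ((Fin (d + 1) → ℝ) × ℝ) × (Fin d → ℝ) =>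
        (((a, y.1.1), y.1.2), y.2))).lintegral_prod_right'.aemeasurable
    rw [hsplit, ← lintegral_indicator (measurableSet_stieltjesRegion _),
      lintegral_stieltjesStep (hg.indicator (measurableSet_stieltjesRegion _)),
      ← lintegral_indicator measurableSet_Ioi]
    refine lintegral_congr_ae ?_
    filter_upwards [Measure.ae_ne volume (0 : ℝ)] with u hu
    by_cases hu0 : 0 < u
    · rw [Set.indicator_of_mem (by exact hu0), ← lintegral_indicator measurableSet_Ioi]
      refine lintegral_congr_ae ?_
      filter_upwards [Measure.ae_ne volume (0 : ℝ)] with v hv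
      by_cases hv0 : 0 < v
      · rw [Set.indicator_of_mem (by exact hv0)]
        have h1 : ∀ x, (stieltjesRegion (d + 1)).indicator g (stieltjesStep u v x) =
            (stieltjesRegion d).indicator (fun x => g (stieltjesStep u v x)) x := fun x => by
          by_cases hx : x ∈ stieltjesRegion d
          · rw [Set.indicator_of_mem hx,
              Set.indicator_of_mem ((stieltjesStep_mem u v x hu hv).2 ⟨hu0, hv0, hx⟩)]
          · rw [Set.indicator_of_notMem hx, Set.indicator_of_notMem
              fun h => hx ((stieltjesStep_mem u v x hu hv).1 h).2.2]
        have m1 : Measurable fun x => g (stieltjesStep u v x) :=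
          hg.comp (measurable_stieltjesStep measurable_const measurable_const measurable_id)
        have m2 : Measurable fun x : (Fin (d + 1) → ℝ) × (Fin d → ℝ) =>
            ENNReal.ofReal (stieltjesJacobian d x.1 x.2) *
            g (stieltjesStep u v (stieltjesPair d x.1 x.2)) :=
          (ENNReal.measurable_ofReal.comp (mJ _)).mul (m1.comp (mP _))
        simp_rw [h1]
        rw [lintegral_indicator (measurableSet_stieltjesRegion _), ih m1,
          ← ENNReal.ofReal_mul (by positivity), ← lintegral_const_mul _ m2.lintegral_prod_right']
        refine lintegral_congr fun x => ?_
        refine (lintegral_const_mul _ (m2.comp measurable_prodMk_left)).symm.trans ?_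
        refine lintegral_congr fun y => ?_
        dsimp only [Function.comp]
        rw [← mul_assoc, ← ENNReal.ofReal_mul (by positivity), abs_of_pos hu0, abs_of_pos hv0]
        simp only [G, stieltjesJacobian_cons]
        rfl
      · rw [Set.indicator_of_notMem (by exact hv0)]
        have h1 : ∀ x, (stieltjesRegion (d + 1)).indicator g (stieltjesStep u v x) = 0 :=
          fun x => Set.indicator_of_notMem
            (fun h => hv0 ((stieltjesStep_mem u v x hu hv).1 h).2.1) _
        simp [h1]
    · rw [Set.indicator_of_notMem (by exact hu0)]
      refine (lintegral_congr_ae (g := 0) ?_).trans lintegral_zero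
      filter_upwards [Measure.ae_ne volume (0 : ℝ)] with v hv
      have h1 : ∀ x, (stieltjesRegion (d + 1)).indicator g (stieltjesStep u v x) = 0 :=
        fun x => Set.indicator_of_notMem
          (fun h => hu0 ((stieltjesStep_mem u v x hu hv).1 h).1) _
      simp [h1]

/-! ### Monic polynomials as coefficient vectors, and the image of the recursion -/

section monicOf

variable {R S : Type*} [CommRing R] [CommRing S] {d : ℕ}

/-- The monic polynomial of degree `d` with given non-leading coefficients. -/
noncomputable def monicOf (c : Fin d → R) : R[X] := X ^ d + ∑ i : Fin d, C (c i) * X ^ (i : ℕ)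

theorem degree_sum_C_mul_X_pow_lt (c : Fin d → R) :
    (∑ i : Fin d, C (c i) * X ^ (i : ℕ)).degree < (d : WithBot ℕ) := degree_sum_fin_lt c

theorem monicOf_monic (c : Fin d → R) : (monicOf c).Monic :=
  monic_X_pow_add (degree_sum_C_mul_X_pow_lt c)

theorem natDegree_monicOf [Nontrivial R] (c : Fin d → R) : (monicOf c).natDegree = d := by
  rw [monicOf, natDegree_add_eq_left_of_degree_lt, natDegree_X_pow]
  rw [degree_X_pow]; exact degree_sum_C_mul_X_pow_lt c

theorem coeff_monicOf (c : Fin d → R) (i : Fin d) : (monicOf c).coeff i = c i := by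
  rw [monicOf, coeff_add, coeff_X_pow, if_neg i.2.ne, zero_add, finsetSum_coeff,
    Finset.sum_eq_single i]
  · simp
  · intro j _ hj
    rw [coeff_C_mul, coeff_X_pow, if_neg (fun h => hj (Fin.ext h.symm)), mul_zero]
  · simp

theorem monicOf_injective : Function.Injective (monicOf : (Fin d → R) → R[X]) := fun a b h => by
  funext i
  rw [← coeff_monicOf a i, h, coeff_monicOf]

theorem monicOf_coeff {p : R[X]} (hp : p.Monic) (hd : p.natDegree = d) :
    monicOf (fun i : Fin d => p.coeff i) = p := by
  conv_rhs => rw [hp.as_sum, hd, Finset.sum_range]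
  rfl

theorem map_monicOf (f : R →+* S) (c : Fin d → R) : (monicOf c).map f = monicOf (f ∘ c) := by
  simp [monicOf, Polynomial.map_sum]

theorem monicOf_sub_snoc (p : Fin (d + 1) → R) (q : Fin d → R) (v : R) :
    monicOf (p - Fin.snoc (v • q) v) = monicOf p - C v * monicOf q := by
  simp only [monicOf, Fin.sum_univ_castSucc, Pi.sub_apply, Fin.snoc_castSucc, Fin.snoc_last,
    Pi.smul_apply, smul_eq_mul, C_sub, C_mul, sub_mul, Finset.sum_sub_distrib, Fin.val_castSucc,
    Fin.val_last, mul_add, Finset.mul_sum, mul_assoc]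
  ring

theorem monicOf_cons_zero (q : Fin d → R) :
    monicOf (Fin.cons 0 q : Fin (d + 1) → R) = X * monicOf q := by
  simp only [monicOf, Fin.sum_univ_succ, Fin.cons_zero, Fin.cons_succ, C_0, zero_mul, zero_add,
    mul_add, Finset.mul_sum, Fin.val_succ, pow_succ]
  congr 1
  · ring
  · exact Finset.sum_congr rfl fun i _ => by ring

end monicOf

theorem monicOf_stieltjesStep_snd {d : ℕ} (u v : ℝ) (x : (Fin (d + 1) → ℝ) × (Fin d → ℝ)) :
    monicOf (stieltjesStep u v x).2 = monicOf x.1 - C v * monicOf x.2 :=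
  monicOf_sub_snoc _ _ _

theorem monicOf_stieltjesStep_fst {d : ℕ} (u v : ℝ) (x : (Fin (d + 1) → ℝ) × (Fin d → ℝ)) :
    monicOf (stieltjesStep u v x).1 =
      X * (monicOf x.1 - C v * monicOf x.2) - C u * monicOf x.1 := by
  rw [← monicOf_stieltjesStep_snd u v x, ← monicOf_cons_zero]
  exact monicOf_sub_snoc _ _ _

theorem IsPositivePair.of_C_mul {A B : ℝ[X]} {v : ℝ} (hv : 0 < v)
    (h : IsPositivePair A (C v * B)) : IsPositivePair A B := by
  refine .of_eval h.monic h.splits h.natDegree_ne_zero ?_ fun x hx => ?_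
  · rw [← degree_C_mul hv.ne']; exact h.degree_lt
  · have := h.eval_derivative_pos hx
    rw [eval_mul, eval_C, mul_assoc] at this
    exact (pos_iff_pos_of_mul_pos this).1 hv

/-- This is Stieltjes' theorem in finite form: the forward recursion preserves interlacing with
positive roots, and conversely the next-to-leading coefficients produce positive u and v and a
smaller interlacing pair. -/
theorem mem_stieltjesRegion_iff {d : ℕ} (x : (Fin (d + 1) → ℝ) × (Fin d → ℝ)) :
    x ∈ stieltjesRegion d ↔ IsStieltjesPair (monicOf x.1) (monicOf x.2) := by
  induction d with
  | zero =>
    have h1 : monicOf x.1 = X + C (x.1 0) := by simp [monicOf]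
    have h2 : monicOf x.2 = 1 := by simp [monicOf]
    rw [h1, h2]
    constructor
    · intro hx
      have hx' : x.1 0 < 0 := hx
      refine ⟨.of_eval (monic_X_add_C _) (Splits.X_add_C _) (by simp) (by simp) ?_, monic_one, ?_⟩
      · intro y hy; simp
      · intro y hy
        simp at hy; linarith
    · intro h
      have := h.2.2 (-x.1 0) (by simp)
      show x.1 0 < 0
      linarith
  | succ d ih =>
    constructor
    · rintro ⟨hu, hv, hx⟩
      have := ((ih _).1 hx).of_step hu hv
      rw [← monicOf_sub_snoc, prevP_sub_snoc_prevQ x hv.ne', ← monicOf_cons_zero,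
        ← monicOf_sub_snoc, cons_sub_snoc_prevP x hu.ne'] at this
      exact this
    · intro h
      have hM := h.X_mul_sub
      -- Here u is the coefficient of degree d + 1 in XQ - P, which is positive as the sum of the
      -- residues.
      have hu : 0 < lastU x := by
        have := hM.coeff_pos
        rw [natDegree_monicOf, ← monicOf_cons_zero, coeff_sub] at this
        have h1 := coeff_monicOf x.1 (Fin.last (d + 1))
        have h2 := coeff_monicOf (Fin.cons 0 x.2 : Fin (d + 2) → ℝ) (Fin.last (d + 1))
        rw [← Fin.succ_last, Fin.cons_succ] at h2
        simp only [Fin.val_last, Fin.val_succ] at h1 h2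
        simp only [Nat.add_sub_cancel] at this
        rwa [h1, h2] at this
      have hMu : X * monicOf x.2 - monicOf x.1 = C (lastU x) * monicOf (prevP x) := by
        rw [← cons_sub_snoc_prevP x hu.ne', monicOf_sub_snoc, monicOf_cons_zero]
        ring
      obtain ⟨h1, h2⟩ := h.of_derivative_neg hu (monicOf_monic (prevP x))
        (by rw [natDegree_monicOf]; omega) (by rw [natDegree_monicOf, natDegree_monicOf]) hMu
      have hv : 0 < lastV x := by
        have := h1.coeff_pos
        rw [natDegree_monicOf, coeff_sub] at this
        have h1 := coeff_monicOf (prevP x) (Fin.last d)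
        have h2 := coeff_monicOf x.2 (Fin.last d)
        simp only [Fin.val_last] at h1 h2
        simp only [Nat.add_sub_cancel] at this
        rwa [h1, h2] at this
      have hQ : monicOf (prevP x) - monicOf x.2 = C (lastV x) * monicOf (prevQ x) := by
        conv_lhs => rw [← prevP_sub_snoc_prevQ x hv.ne', monicOf_sub_snoc]
        ring
      rw [hQ] at h1
      exact ⟨hu, hv, (ih _).2 ⟨h1.of_C_mul hv, monicOf_monic _, h2⟩⟩

theorem stieltjesPair_mem {d : ℕ} {u : Fin (d + 1) → ℝ} {v : Fin d → ℝ} (hu : ∀ i, 0 < u i)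
    (hv : ∀ i, 0 < v i) : stieltjesPair d u v ∈ stieltjesRegion d := by
  induction d with
  | zero => simpa [stieltjesPair, stieltjesRegion] using hu 0
  | succ d ih =>
    exact (stieltjesStep_mem _ _ _ (hu 0).ne' (hv 0).ne').2
      ⟨hu 0, hv 0, ih (fun i => hu i.succ) fun i => hv i.succ⟩

/-! ### The perturbed polynomial P - i l (XQ - P) and recovery of (l, P, Q) from it -/

section perturbedCoeffs

variable {d : ℕ}

/-- The coefficients of `P - i l (X Q - P)`. -/
noncomputable def perturbedCoeffs (l : ℝ) (x : (Fin (d + 1) → ℝ) × (Fin d → ℝ)) :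
    Fin (d + 1) → ℂ :=
  fun i => (x.1 i : ℂ) - Complex.I * ((l * ((Fin.cons 0 x.2 : Fin (d + 1) → ℝ) i - x.1 i) : ℝ) : ℂ)

theorem monicOf_perturbedCoeffs (l : ℝ) (x : (Fin (d + 1) → ℝ) × (Fin d → ℝ)) :
    monicOf (perturbedCoeffs l x) = (monicOf x.1).map (algebraMap ℝ ℂ) -
      C (Complex.I * l) * (X * monicOf x.2 - monicOf x.1).map (algebraMap ℝ ℂ) := by
  rw [← monicOf_cons_zero, Polynomial.map_sub, map_monicOf, map_monicOf]
  simp only [monicOf, perturbedCoeffs, Function.comp]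
  rw [add_sub_add_left_eq_sub, ← Finset.sum_sub_distrib, Finset.mul_sum, add_sub_assoc,
    ← Finset.sum_sub_distrib]
  congr 1
  refine Finset.sum_congr rfl fun i _ => ?_
  rw [← sub_mul, ← mul_assoc, ← sub_mul, ← C_sub, ← C_mul, ← C_sub]
  congr 2
  simp
  ring

/-- The perturbation parameter, as a function of the coefficients. -/
noncomputable def coeffsL (c : Fin (d + 1) → ℂ) : ℝ := (c 0).im / (c 0).re

/-- The pair of real polynomials, as a function of the coefficients. -/
noncomputable def coeffsPair (c : Fin (d + 1) → ℂ) : (Fin (d + 1) → ℝ) × (Fin d → ℝ) :=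
  (fun i => (c i).re, fun i => (c i.succ).re - (c i.succ).im / coeffsL c)

/-- The coefficients attached to positive parameters. -/
def coeffsRegion (d : ℕ) : Set (Fin (d + 1) → ℂ) :=
  {c | 0 < coeffsL c ∧ coeffsPair c ∈ stieltjesRegion d}

theorem measurable_coeffsL : Measurable (coeffsL (d := d)) := by
  unfold coeffsL; fun_prop

theorem measurable_coeffsPair : Measurable (coeffsPair (d := d)) := by
  refine Measurable.prodMk (by fun_prop) (measurable_pi_lambda _ fun i => ?_)
  exact Measurable.sub (by fun_prop) (Measurable.div (by fun_prop) measurable_coeffsL)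

theorem measurableSet_coeffsRegion : MeasurableSet (coeffsRegion d) :=
  (measurableSet_lt measurable_const measurable_coeffsL).inter
    (measurable_coeffsPair (measurableSet_stieltjesRegion d))

theorem measurable_perturbedCoeffs : Measurable
    fun y : ℝ × (Fin (d + 1) → ℝ) × (Fin d → ℝ) => perturbedCoeffs y.1 y.2 := by
  refine measurable_pi_lambda _ fun i => Measurable.sub (by fun_prop) ?_
  refine Measurable.const_mul (Complex.measurable_ofReal.comp ?_) _
  refine measurable_fst.mul (Measurable.sub ?_ (by fun_prop))
  exact measurable_pi_iff.1 (measurable_cons (by fun_prop) measurable_const) i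

theorem coeffsL_perturbedCoeffs {l : ℝ} {x : (Fin (d + 1) → ℝ) × (Fin d → ℝ)} (hx : x.1 0 ≠ 0) :
    coeffsL (perturbedCoeffs l x) = l := by
  simp [coeffsL, perturbedCoeffs, hx]

theorem coeffsPair_perturbedCoeffs {l : ℝ} {x : (Fin (d + 1) → ℝ) × (Fin d → ℝ)} (hl : l ≠ 0)
    (hx : x.1 0 ≠ 0) : coeffsPair (perturbedCoeffs l x) = x := by
  rw [coeffsPair, coeffsL_perturbedCoeffs hx]
  refine Prod.ext (funext fun i => ?_) (funext fun i => ?_)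
  · simp [perturbedCoeffs]
  · simp [perturbedCoeffs]
    field_simp
    ring

theorem perturbedCoeffs_coeffs {c : Fin (d + 1) → ℂ} (hc : coeffsL c ≠ 0) :
    perturbedCoeffs (coeffsL c) (coeffsPair c) = c := by
  have h0 : (c 0).re ≠ 0 := fun h => hc (by simp [coeffsL, h])
  funext i
  refine Fin.cases ?_ (fun i => ?_) i
  · apply Complex.ext
    · simp [perturbedCoeffs, coeffsPair]
    · simp [perturbedCoeffs, coeffsPair, coeffsL]
      field_simp
  · apply Complex.ext
    · simp [perturbedCoeffs, coeffsPair]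
    · simp [perturbedCoeffs, coeffsPair]
      field_simp

/-- The roots of P are positive, so P(0) ≠ 0; this is what makes l recoverable from the constant
term P(0)(1 + i l). -/
theorem fst_zero_ne_zero {x : (Fin (d + 1) → ℝ) × (Fin d → ℝ)} (hx : x ∈ stieltjesRegion d) :
    x.1 0 ≠ 0 := fun h0 => by
  have := ((mem_stieltjesRegion_iff x).1 hx).2.2 0 (by
    rw [← coeff_zero_eq_eval_zero, ← h0]; exact coeff_monicOf x.1 0)
  exact lt_irrefl _ this

theorem perturbedCoeffs_mem {l : ℝ} {x : (Fin (d + 1) → ℝ) × (Fin d → ℝ)} (hx0 : x.1 0 ≠ 0)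
    (hl : l ≠ 0) : perturbedCoeffs l x ∈ coeffsRegion d ↔ 0 < l ∧ x ∈ stieltjesRegion d := by
  rw [coeffsRegion, Set.mem_ofPred_eq, coeffsL_perturbedCoeffs hx0,
    coeffsPair_perturbedCoeffs hl hx0]

end perturbedCoeffs

/-! ### Acute configurations: a Hermite–Biehler characterization of the roots -/

/-- The non-leading coefficients of the monic polynomial with roots `z`. -/
noncomputable def rootCoeffs {n : ℕ} (z : Fin n → ℂ) : Fin n → ℂ :=
  fun i => (∏ j, (X - C (z j))).coeff i

theorem monicOf_rootCoeffs {n : ℕ} (z : Fin n → ℂ) :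
    monicOf (rootCoeffs z) = ∏ j, (X - C (z j)) :=
  monicOf_coeff (monic_prod_X_sub_C _ _) (by simp [natDegree_prod_of_monic, monic_X_sub_C])

theorem rootCoeffs_zero {d : ℕ} (z : Fin (d + 1) → ℂ) :
    rootCoeffs z 0 = (-1) ^ (d + 1) * ∏ j, z j := by
  have : rootCoeffs z 0 = (∏ j, (X - C (z j))).eval 0 := by
    rw [← coeff_zero_eq_eval_zero]; rfl
  rw [this, eval_prod]
  simp [Finset.prod_neg]

/-- Configurations of points in the upper half-plane whose arguments add up to an acute angle. -/
def acuteConfigurations (n : ℕ) : Set (Fin n → ℂ) :=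
  {z | (∀ j, 0 < (z j).im) ∧ ∑ j, (z j).arg < Real.pi / 2}

theorem prod_eq_norm_mul_exp_sum_arg {ι : Type*} (s : Finset ι) (z : ι → ℂ) :
    ∏ j ∈ s, z j = (∏ j ∈ s, ‖z j‖ : ℝ) * Complex.exp ((∑ j ∈ s, (z j).arg : ℝ) * Complex.I) := by
  conv_lhs => enter [2, j]; rw [← Complex.norm_mul_exp_arg_mul_I (z j)]
  rw [Finset.prod_mul_distrib, ← Complex.exp_sum]
  push_cast
  rw [Finset.sum_mul]

theorem tan_sum_arg {ι : Type*} (s : Finset ι) (z : ι → ℂ) (hz : ∀ j ∈ s, z j ≠ 0) :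
    Real.tan (∑ j ∈ s, (z j).arg) = (∏ j ∈ s, z j).im / (∏ j ∈ s, z j).re := by
  have h : 0 < ∏ j ∈ s, ‖z j‖ := Finset.prod_pos fun j hj => norm_pos_iff.2 (hz j hj)
  rw [prod_eq_norm_mul_exp_sum_arg, Complex.im_ofReal_mul, Complex.re_ofReal_mul,
    Complex.exp_ofReal_mul_I_im, Complex.exp_ofReal_mul_I_re, mul_div_mul_left _ _ h.ne',
    Real.tan_eq_sin_div_cos]

/-- The constant coefficient is ±∏z_j, the sign cancels in Im/Re, and the argument of the product is
the sum of the arguments modulo 2π. -/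
theorem coeffsL_rootCoeffs {d : ℕ} {z : Fin (d + 1) → ℂ} (hz : ∀ j, 0 < (z j).im) :
    coeffsL (rootCoeffs z) = Real.tan (∑ j, (z j).arg) := by
  rw [tan_sum_arg _ _ fun j _ h => (hz j).ne' (by simp [h]), coeffsL, rootCoeffs_zero]
  rcases neg_one_pow_eq_or ℂ (d + 1) with h | h <;> simp [h, neg_div_neg_eq]

/-- Otherwise the difference of the two arguments would lie in (0, π) and have positive sine,
whereas that sine is -t Im z / (|z + t||z|). -/
theorem arg_add_ofReal_le {z : ℂ} (hz : 0 < z.im) {t : ℝ} (ht : 0 ≤ t) :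
    (z + t).arg ≤ z.arg := by
  by_contra! h
  have him : 0 < (z + t).im := by simpa using hz
  have h1 : 0 < z.arg := (Complex.arg_nonneg_iff.2 hz.le).lt_of_ne' fun h0 =>
    hz.ne' (Complex.arg_eq_zero_iff.1 h0).2
  have h3 := Complex.arg_le_pi (z + t)
  have h4 : 0 < Real.sin ((z + t).arg - z.arg) := Real.sin_pos_of_pos_of_lt_pi (by linarith)
    (by linarith)
  have hz0 : z ≠ 0 := fun h0 => by simp [h0] at hz
  have hzt : z + t ≠ 0 := fun h0 => by simp [h0] at him
  rw [Real.sin_sub, Complex.sin_arg, Complex.sin_arg, Complex.cos_arg hz0,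
    Complex.cos_arg hzt] at h4
  have h5 : (z + t).im / ‖z + t‖ * (z.re / ‖z‖) - (z + t).re / ‖z + t‖ * (z.im / ‖z‖) =
      -(t * z.im) / (‖z + t‖ * ‖z‖) := by
    have := norm_pos_iff.2 hz0
    have := norm_pos_iff.2 hzt
    field_simp
    simp
    ring
  rw [h5] at h4
  exact absurd h4 (not_lt.2 (div_nonpos_of_nonpos_of_nonneg
    (by have := mul_nonneg ht hz.le; linarith) (by positivity)))

/-- For t > 0, arg(z + t) = arg(z/t + 1), which tends to 0 as t → ∞. -/
theorem exists_sum_arg_add_lt {n : ℕ} (z : Fin n → ℂ) :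
    ∃ t : ℝ, 0 ≤ t ∧ ∑ j, (z j + t).arg < Real.pi / 2 := by
  have h : Filter.Tendsto (fun t : ℝ => ∑ j, (z j + t).arg) Filter.atTop (nhds (∑ _j : Fin n, 0)) := by
    refine tendsto_finsetSum _ fun j _ => ?_
    have h1 : Filter.Tendsto (fun t : ℝ => z j * ((t⁻¹ : ℝ) : ℂ) + 1) Filter.atTop
        (nhds (z j * ((0 : ℝ) : ℂ) + 1)) :=
      ((Complex.continuous_ofReal.tendsto _).comp tendsto_inv_atTop_zero).const_mul _
        |>.add_const _
    rw [Complex.ofReal_zero, mul_zero, zero_add] at h1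
    have h2 := (Complex.continuousAt_arg (by simp : (1 : ℂ) ∈ Complex.slitPlane)).tendsto.comp h1
    rw [Complex.arg_one] at h2
    refine h2.congr' ?_
    filter_upwards [Filter.eventually_gt_atTop 0] with t ht
    rw [Function.comp, ← Complex.arg_real_mul _ ht]
    congr 1
    have : (t : ℂ) ≠ 0 := by exact_mod_cast ht.ne'
    push_cast
    field_simp
  rw [Finset.sum_const_zero] at h
  obtain ⟨t, h1, h2⟩ := ((Filter.eventually_ge_atTop (0 : ℝ)).and
    (h.eventually (gt_mem_nhds (by positivity : 0 < Real.pi / 2)))).exists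
  exact ⟨t, h1, h2⟩

theorem continuousOn_sum_arg_add {n : ℕ} {z : Fin n → ℂ} (hz : ∀ j, 0 < (z j).im) :
    Continuous fun t : ℝ => ∑ j, (z j + t).arg := by
  refine continuous_finsetSum _ fun j _ => continuous_iff_continuousAt.2 fun t => ?_
  refine ContinuousAt.comp (Complex.continuousAt_arg (Or.inr ?_)) (by fun_prop)
  simpa using (hz j).ne'

section acute

variable {d : ℕ}

theorem eval_prod_X_sub_C_of_mem {z : Fin (d + 1) → ℂ} (h : coeffsL (rootCoeffs z) ≠ 0) (w : ℂ) :
    ∏ j, (w - z j) = aeval w (monicOf (coeffsPair (rootCoeffs z)).1) -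
      Complex.I * coeffsL (rootCoeffs z) *
        aeval w (X * monicOf (coeffsPair (rootCoeffs z)).2 -
          monicOf (coeffsPair (rootCoeffs z)).1) := by
  have h1 := monicOf_rootCoeffs z
  rw [← perturbedCoeffs_coeffs h, monicOf_perturbedCoeffs] at h1
  have h2 := congrArg (eval w) h1
  rw [eval_sub, eval_mul, eval_map_algebraMap, eval_map_algebraMap, eval_C, eval_prod] at h2
  simp only [eval_sub, eval_X, eval_C] at h2
  exact h2.symm

theorem prod_add_eq_neg_one_pow_mul (z : Fin (d + 1) → ℂ) (t : ℝ) :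
    ∏ j, (z j + (t : ℂ)) = (-1) ^ (d + 1) * ∏ j, (((-t : ℝ) : ℂ) - z j) := by
  have := Finset.prod_neg (s := Finset.univ) fun j => ((-t : ℝ) : ℂ) - z j
  rw [Finset.card_univ, Fintype.card_fin] at this
  rw [← this]
  exact Finset.prod_congr rfl fun j _ => by push_cast; ring

theorem mem_acuteConfigurations_of_mem_coeffsRegion {z : Fin (d + 1) → ℂ}
    (h : rootCoeffs z ∈ coeffsRegion d) : z ∈ acuteConfigurations (d + 1) := by
  obtain ⟨hl, hx⟩ := h
  have hS := (mem_stieltjesRegion_iff _).1 hx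
  have hM := hS.X_mul_sub
  have hev := eval_prod_X_sub_C_of_mem hl.ne'
  set l := coeffsL (rootCoeffs z)
  set P := monicOf (coeffsPair (rootCoeffs z)).1
  set M := X * monicOf (coeffsPair (rootCoeffs z)).2 - P
  have him : ∀ j, 0 < (z j).im := by
    intro k
    have h0 : aeval (z k) P - Complex.I * l * aeval (z k) M = 0 := by
      rw [← hev, Finset.prod_eq_zero (Finset.mem_univ k) (sub_self _)]
    by_contra! hk
    rcases hk.lt_or_eq with hk | hk
    -- At the conjugate point, in the upper half-plane, M·conj P must have negative imaginary part;
    -- but P = i l M at z_k makes that imaginary part l|M|² ≥ 0.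
    · have h1 := hM.im_neg (z := starRingEnd ℂ (z k)) (by simpa using hk)
      rw [aeval_conj, aeval_conj, Complex.conj_conj, sub_eq_zero.1 h0] at h1
      have h2 : starRingEnd ℂ (aeval (z k) M) * (Complex.I * l * aeval (z k) M) =
          ((l * Complex.normSq (aeval (z k) M) : ℝ) : ℂ) * Complex.I := by
        rw [Complex.ofReal_mul, Complex.normSq_eq_conj_mul_self]; ring
      rw [h2, Complex.im_ofReal_mul, Complex.I_im, mul_one] at h1
      exact absurd h1 (not_lt.2 (mul_nonneg hl.le (Complex.normSq_nonneg _)))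
    · have hz : z k = ((z k).re : ℂ) := Complex.ext rfl (by simpa using hk)
      rw [hz] at h0
      have hP : ∀ p : ℝ[X], aeval ((z k).re : ℂ) p = ((p.eval (z k).re : ℝ) : ℂ) := fun p => by
        rw [← Complex.coe_algebraMap, aeval_algebraMap_apply, coe_aeval_eq_eval]
      rw [hP, hP] at h0
      have h1 : P.eval (z k).re = 0 := by simpa using congrArg Complex.re h0
      have h2 : M.eval (z k).re = 0 := by simpa [hl.ne'] using congrArg Complex.im h0
      have := hM.eval_derivative_pos h1
      simp [h2] at this
  refine ⟨him, ?_⟩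
  -- If the total argument were at least π/2, shifting all points right by a suitable s ≥ 0 would
  -- make it exactly π/2. The real part of ∏(z_j + s), which is ±P(-s), would vanish, giving P a
  -- nonpositive root.
  by_contra! hge
  obtain ⟨t, ht0, ht⟩ := exists_sum_arg_add_lt z
  have hc := continuousOn_sum_arg_add him
  obtain ⟨s, hs, hs2⟩ := intermediate_value_Icc' ht0 hc.continuousOn
    (Set.mem_Icc.2 ⟨ht.le, by simpa using hge⟩)
  have h1 := prod_eq_norm_mul_exp_sum_arg Finset.univ fun j => z j + (s : ℂ)
  simp only at hs2
  rw [hs2] at h1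
  have h2 : (∏ j, (z j + (s : ℂ))).re = 0 := by
    rw [h1, Complex.re_ofReal_mul, Complex.exp_ofReal_mul_I_re, Real.cos_pi_div_two, mul_zero]
  have h3 := prod_add_eq_neg_one_pow_mul z s
  have hP : ∀ p : ℝ[X], aeval ((-s : ℝ) : ℂ) p = ((p.eval (-s) : ℝ) : ℂ) := fun p => by
    rw [← Complex.coe_algebraMap, aeval_algebraMap_apply, coe_aeval_eq_eval]
  rw [hev, hP, hP] at h3
  have h4 : P.eval (-s) = 0 := by
    rw [h3] at h2
    rcases neg_one_pow_eq_or ℂ (d + 1) with h | h <;> simpa [h] using h2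
  have := hS.2.2 _ h4
  linarith [hs.1]

/-- Factor by factor: a point of the upper half-plane is closer to z_j than to its mirror image. -/
theorem prod_sub_ne_prod_sub_conj {z : Fin (d + 1) → ℂ} (hz : ∀ j, 0 < (z j).im) {w : ℂ}
    (hw : 0 < w.im) : ‖∏ j, (w - z j)‖ < ‖∏ j, (w - starRingEnd ℂ (z j))‖ := by
  rw [norm_prod, norm_prod]
  have hpos : ∀ j, 0 < ‖w - starRingEnd ℂ (z j)‖ := fun j => by
    rw [norm_pos_iff]
    intro h
    have := congrArg Complex.im h
    simp at this
    linarith [hz j]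
  by_cases h0 : ∃ j, w - z j = 0
  · obtain ⟨j, hj⟩ := h0
    rw [Finset.prod_eq_zero (Finset.mem_univ j) (by rw [hj, norm_zero])]
    exact Finset.prod_pos fun j _ => hpos j
  · push Not at h0
    refine Finset.prod_lt_prod_of_nonempty (fun j _ => norm_pos_iff.2 (h0 j)) (fun j _ => ?_)
      Finset.univ_nonempty
    rw [Complex.norm_def, Complex.norm_def]
    refine Real.sqrt_lt_sqrt (Complex.normSq_nonneg _) ?_
    simp only [Complex.normSq_apply, Complex.sub_re, Complex.sub_im, Complex.conj_re,
      Complex.conj_im]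
    nlinarith [mul_pos hw (hz j)]

theorem mem_coeffsRegion_of_mem_acuteConfigurations {z : Fin (d + 1) → ℂ}
    (h : z ∈ acuteConfigurations (d + 1)) : rootCoeffs z ∈ coeffsRegion d := by
  obtain ⟨him, hsum⟩ := h
  have hargpos : ∀ w : ℂ, 0 < w.im → 0 < w.arg := fun w hw =>
    (Complex.arg_nonneg_iff.2 hw.le).lt_of_ne' fun h0 => hw.ne' (Complex.arg_eq_zero_iff.1 h0).2
  have hl : 0 < coeffsL (rootCoeffs z) := by
    rw [coeffsL_rootCoeffs him]
    exact Real.tan_pos_of_pos_of_lt_pi_div_two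
      (Finset.sum_pos (fun j _ => hargpos _ (him j)) Finset.univ_nonempty) hsum
  refine ⟨hl, (mem_stieltjesRegion_iff _).2 ?_⟩
  have hev := eval_prod_X_sub_C_of_mem hl.ne'
  set l := coeffsL (rootCoeffs z)
  set P := monicOf (coeffsPair (rootCoeffs z)).1 with hPdef
  set Q := monicOf (coeffsPair (rootCoeffs z)).2 with hQdef
  have hPm : P.Monic := monicOf_monic _
  have hPd : P.natDegree = d + 1 := natDegree_monicOf _
  have hQm : Q.Monic := monicOf_monic _
  have hQd : Q.natDegree = d := natDegree_monicOf _
  have hreal : ∀ (x : ℝ) (p : ℝ[X]), aeval (x : ℂ) p = ((p.eval x : ℝ) : ℂ) := fun x p => by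
    rw [← Complex.coe_algebraMap, aeval_algebraMap_apply, coe_aeval_eq_eval]
  have hpos : ∀ x, P.eval x = 0 → 0 < x := by
    intro x hx
    by_contra! hx0
    -- Shifting right by -x ≥ 0 only decreases arguments, so the product still has positive real
    -- part; but that real part is ±P(x).
    have h1 := prod_eq_norm_mul_exp_sum_arg Finset.univ fun j => z j + ((-x : ℝ) : ℂ)
    have h2 : 0 < ∑ j, (z j + ((-x : ℝ) : ℂ)).arg :=
      Finset.sum_pos (fun j _ => hargpos _ (by simpa using him j)) Finset.univ_nonempty
    have h3 : ∑ j, (z j + ((-x : ℝ) : ℂ)).arg < Real.pi / 2 :=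
      (Finset.sum_le_sum fun j _ => arg_add_ofReal_le (him j) (by linarith)).trans_lt hsum
    have h4 : 0 < (∏ j, (z j + ((-x : ℝ) : ℂ))).re := by
      rw [h1, Complex.re_ofReal_mul, Complex.exp_ofReal_mul_I_re]
      refine mul_pos (Finset.prod_pos fun j _ => norm_pos_iff.2 fun h0 => ?_)
        (Real.cos_pos_of_mem_Ioo ⟨by linarith, h3⟩)
      have := congrArg Complex.im h0
      simp at this
      exact (him j).ne' this
    rw [prod_add_eq_neg_one_pow_mul, neg_neg, hev, hreal, hreal, hx] at h4
    rcases neg_one_pow_eq_or ℂ (d + 1) with h | h <;> simp [h] at h4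
  have hsplit : P.Splits := by
    refine splits_of_aeval_ne_zero fun w hw h0 => ?_
    -- At a zero of P the polynomial f = P - i l M and its conjugate P + i l M have equal modulus,
    -- against the strict inequality.
    have h1 := prod_sub_ne_prod_sub_conj him hw
    have h2 : ∏ j, (w - starRingEnd ℂ (z j)) = starRingEnd ℂ (∏ j, (starRingEnd ℂ w - z j)) := by
      simp [map_prod]
    rw [h2, hev, hev] at h1
    simp only [map_sub, map_mul, ← aeval_conj, Complex.conj_conj, h0, Complex.conj_I,
      Complex.conj_ofReal] at h1
    simp at h1
  refine ⟨.of_eval hPm hsplit (by omega) (degree_lt_degree (by omega)) fun x hx => ?_, hQm, hpos⟩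
  have hx0 := hpos x hx
  have hne : ∀ j, (x : ℂ) - z j ≠ 0 := fun j h0 => by
    have := congrArg Complex.im h0
    simp at this
    exact (him j).ne' this
  have hpoly : (∏ j, (X - C (z j))) = P.map (algebraMap ℝ ℂ) -
      C (Complex.I * l) * (X * Q - P).map (algebraMap ℝ ℂ) := by
    rw [← monicOf_rootCoeffs, ← monicOf_perturbedCoeffs, perturbedCoeffs_coeffs hl.ne']
  have hder := congrArg (fun p => eval (x : ℂ) (derivative p)) hpoly
  simp only [derivative_sub, derivative_mul, derivative_C, zero_mul, zero_add, derivative_map,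
    eval_sub, eval_mul, eval_map_algebraMap, eval_C, hreal] at hder
  have hval := hev (x : ℂ)
  simp only [hreal, hx, Complex.ofReal_zero, zero_sub] at hval
  -- This is f'·conj f = |f|² ∑ 1/(x - z_k) with denominators cleared; each summand has positive
  -- imaginary part.
  have hdl : eval (x : ℂ) (derivative (∏ j, (X - C (z j)))) *
      starRingEnd ℂ (∏ j, ((x : ℂ) - z j)) =
      ∑ k, ((∏ j ∈ Finset.univ.erase k, Complex.normSq ((x : ℂ) - z j) : ℝ) : ℂ) *
        starRingEnd ℂ ((x : ℂ) - z k) := by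
    rw [derivative_prod_finset, eval_finsetSum, Finset.sum_mul]
    refine Finset.sum_congr rfl fun k _ => ?_
    rw [map_prod, ← Finset.mul_prod_erase _ _ (Finset.mem_univ k)]
    simp only [derivative_sub, derivative_X, derivative_C, sub_zero, mul_one, eval_prod, eval_sub,
      eval_X, eval_C]
    push_cast
    simp_rw [← Complex.mul_conj]
    rw [Finset.prod_mul_distrib]
    ring
  have him2 : 0 < (eval (x : ℂ) (derivative (∏ j, (X - C (z j)))) *
      starRingEnd ℂ (∏ j, ((x : ℂ) - z j))).im := by
    rw [hdl, Complex.im_sum]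
    refine Finset.sum_pos (fun k _ => ?_) Finset.univ_nonempty
    rw [Complex.im_ofReal_mul, Complex.conj_im, Complex.sub_im, Complex.ofReal_im]
    exact mul_pos (Finset.prod_pos fun j _ => Complex.normSq_pos.2 (hne j))
      (by linarith [him k])
  rw [hder, hval] at him2
  -- At a root of P, f = -i l x Q, so the imaginary part just found to be positive is l x Q P'.
  have h6 : (X * Q - P).eval x = x * Q.eval x := by simp [hx]
  rw [h6] at him2
  simp only [map_neg, map_mul, Complex.conj_I, Complex.conj_ofReal] at him2
  simp at him2
  have h7 : 0 < (l * x) * (eval x Q * eval x (derivative P)) := by linarith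
  exact (pos_iff_pos_of_mul_pos h7).1 (mul_pos hl hx0)

end acute

/-! ### From roots to coefficients: the Vandermonde Jacobian and sorted labellings -/

section rootCoeffs

variable {n : ℕ}

theorem vandermonde_mulVec_rootCoeffs (a z : Fin n → ℂ) :
    (Matrix.vandermonde a).mulVec (rootCoeffs z) = fun k => ∏ j, (a k - z j) - a k ^ n := by
  funext k
  have h := congrArg (eval (a k)) (monicOf_rootCoeffs z)
  rw [eval_prod, monicOf, eval_add, eval_finsetSum] at h
  simp only [eval_sub, eval_X, eval_C, eval_pow, eval_mul] at h
  rw [← h, add_sub_cancel_left, Matrix.mulVec, dotProduct]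
  exact Finset.sum_congr rfl fun i _ => by rw [Matrix.vandermonde_apply, mul_comm]

/-- Evaluation at n distinct nodes is an invertible linear map of the coefficients, and the values
are explicit products in z. The nodes can be chosen freely. -/
theorem rootCoeffs_eq_mulVec {a : Fin n → ℂ} (ha : Function.Injective a) (z : Fin n → ℂ) :
    rootCoeffs z =
      (Matrix.vandermonde a)⁻¹.mulVec (fun k => ∏ j, (a k - z j) - a k ^ n) := by
  rw [← vandermonde_mulVec_rootCoeffs, Matrix.mulVec_mulVec, Matrix.nonsing_inv_mul,
    Matrix.one_mulVec]
  exact isUnit_iff_ne_zero.2 (Matrix.det_vandermonde_ne_zero_iff.2 ha)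

theorem differentiable_rootCoeffs : Differentiable ℝ (rootCoeffs (n := n)) := by
  -- Fixed nodes 0, …, n - 1 suffice for differentiability everywhere.
  have ha : Function.Injective fun k : Fin n => ((k : ℕ) : ℂ) := fun i j h =>
    Fin.ext (by have h2 : ((i : ℕ) : ℂ) = ((j : ℕ) : ℂ) := h; exact_mod_cast h2)
  have : rootCoeffs (n := n) = fun z => (Matrix.vandermonde fun k : Fin n => ((k : ℕ) : ℂ))⁻¹.mulVec
      (fun k : Fin n => ∏ j, (((k : ℕ) : ℂ) - z j) - ((k : ℕ) : ℂ) ^ n) :=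
    funext fun z => rootCoeffs_eq_mulVec ha z
  rw [this]
  refine differentiable_pi.2 fun i => ?_
  simp only [Matrix.mulVec, dotProduct]
  fun_prop

theorem measurable_rootCoeffs : Measurable (rootCoeffs (n := n)) :=
  differentiable_rootCoeffs.continuous.measurable

/-- The derivative of `rootCoeffs` at a point with distinct entries. -/
noncomputable def rootCoeffsDeriv (a : Fin n → ℂ) : (Fin n → ℂ) →L[ℂ] (Fin n → ℂ) :=
  LinearMap.toContinuousLinearMap (Matrix.toLin' ((Matrix.vandermonde a)⁻¹ *
    Matrix.diagonal fun k => -∏ j ∈ Finset.univ.erase k, (a k - a j)))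

/-- Taking the base point itself as nodes, the k-th value ∏(a_k - z_j) has derivative only in the
direction z_k, because every other partial derivative retains the factor a_k - a_k. -/
theorem hasFDerivAt_rootCoeffs {a : Fin n → ℂ} (ha : Function.Injective a) :
    HasFDerivAt rootCoeffs (rootCoeffsDeriv a) a := by
  have h1 : HasFDerivAt (fun z : Fin n → ℂ => fun k : Fin n => ∏ j, (a k - z j) - a k ^ n)
      (LinearMap.toContinuousLinearMap (Matrix.toLin'
        (Matrix.diagonal fun k => -∏ j ∈ Finset.univ.erase k, (a k - a j)))) a := by
    rw [hasFDerivAt_pi']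
    intro k
    have h2 : ∀ j ∈ Finset.univ, HasFDerivAt (fun z : Fin n → ℂ => a k - z j)
        (-ContinuousLinearMap.proj (R := ℂ) (φ := fun _ : Fin n => ℂ) j) a := fun j _ =>
      (hasFDerivAt_apply j a).const_sub (a k)
    have h3 := (HasFDerivAt.finsetProd h2).sub_const (a k ^ n)
    refine h3.congr_fderiv ?_
    ext w
    rw [sum_apply, Finset.sum_eq_single k]
    · simp [Matrix.mulVec_diagonal]
    · intro j _ hj
      rw [smul_apply, Finset.prod_eq_zero
        (Finset.mem_erase.2 ⟨hj.symm, Finset.mem_univ k⟩) (sub_self _), zero_smul]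
    · simp
  have h4 := ((LinearMap.toContinuousLinearMap
    (Matrix.toLin' (Matrix.vandermonde a)⁻¹)).hasFDerivAt).comp a h1
  have h5 : rootCoeffs = (LinearMap.toContinuousLinearMap
      (Matrix.toLin' (Matrix.vandermonde a)⁻¹)) ∘
      fun z : Fin n → ℂ => fun k : Fin n => ∏ j, (a k - z j) - a k ^ n :=
    funext fun z => by
      rw [rootCoeffs_eq_mulVec ha]; simp
  rw [h5]
  refine h4.congr_fderiv ?_
  ext w : 1
  simp [rootCoeffsDeriv, Matrix.toLin'_mul]

/-- The squared modulus of the Vandermonde determinant. -/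
noncomputable def vandermondeSq (z : Fin n → ℂ) : ℝ := ∏ j, ∏ k ∈ Finset.Ioi j, ‖z j - z k‖ ^ 2

/-- The diagonal factor has the modulus of the square of the Vandermonde determinant, and the
inverse Vandermonde matrix removes one power. -/
theorem norm_det_rootCoeffsDeriv {a : Fin n → ℂ} (ha : Function.Injective a) :
    ‖LinearMap.det (rootCoeffsDeriv a : (Fin n → ℂ) →ₗ[ℂ] (Fin n → ℂ))‖ ^ 2 =
      vandermondeSq a := by
  have h0 : (∏ i, ∏ j ∈ Finset.Ioi i, ‖a i - a j‖) ≠ 0 := by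
    refine Finset.prod_ne_zero_iff.2 fun i _ => Finset.prod_ne_zero_iff.2 fun j hj => ?_
    exact norm_ne_zero_iff.2 (sub_ne_zero.2 (ha.ne (Finset.mem_Ioi.1 hj).ne))
  have hV : ‖(Matrix.vandermonde a).det‖ = ∏ i, ∏ j ∈ Finset.Ioi i, ‖a i - a j‖ := by
    rw [Matrix.det_vandermonde, norm_prod]
    refine Finset.prod_congr rfl fun i _ => ?_
    rw [norm_prod]
    exact Finset.prod_congr rfl fun j _ => norm_sub_rev _ _
  have hD : ‖∏ k, -∏ j ∈ Finset.univ.erase k, (a k - a j)‖ =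
      (∏ i, ∏ j ∈ Finset.Ioi i, ‖a i - a j‖) ^ 2 := by
    rw [norm_prod]
    simp only [norm_neg, norm_prod]
    have := Finset.prod_prod_Ioi_mul_eq_prod_prod_off_diag fun j i : Fin n => ‖a i - a j‖
    rw [← Finset.prod_pow]
    simp only [← Finset.prod_pow]
    have h2 : ∀ k : Fin n, Finset.univ.erase k = {k}ᶜ := fun k => by ext; simp
    simp only [h2]
    rw [← this]
    refine Finset.prod_congr rfl fun i _ => Finset.prod_congr rfl fun j _ => ?_
    rw [norm_sub_rev (a j), sq]
  have h1 : vandermondeSq a = (∏ i, ∏ j ∈ Finset.Ioi i, ‖a i - a j‖) ^ 2 := by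
    simp only [vandermondeSq, ← Finset.prod_pow]
  rw [h1, rootCoeffsDeriv, LinearMap.coe_toContinuousLinearMap, LinearMap.det_toLin',
    Matrix.det_mul, Matrix.det_diagonal, Matrix.det_nonsing_inv, norm_mul, hD,
    Ring.inverse_eq_inv', norm_inv, hV]
  congr 1
  field_simp

theorem abs_det_restrictScalars_rootCoeffsDeriv {a : Fin n → ℂ} (ha : Function.Injective a) :
    |((rootCoeffsDeriv a).restrictScalars ℝ).det| = vandermondeSq a := by
  have : ((rootCoeffsDeriv a).restrictScalars ℝ).det = LinearMap.det
      ((rootCoeffsDeriv a : (Fin n → ℂ) →ₗ[ℂ] (Fin n → ℂ)).restrictScalars ℝ) := rfl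
  rw [this, LinearMap.det_restrictScalars, Algebra.norm_complex_apply,
    abs_of_nonneg (Complex.normSq_nonneg _), Complex.normSq_eq_norm_sq,
    norm_det_rootCoeffsDeriv ha]

/-- Configurations labelled by increasing real part. -/
def sortedConfigurations (n : ℕ) : Set (Fin n → ℂ) := {z | StrictMono fun j => (z j).re}

theorem measurableSet_sortedConfigurations : MeasurableSet (sortedConfigurations n) := by
  have : sortedConfigurations n =
      ⋂ (i : Fin n) (j : Fin n) (_ : i < j), {z | (z i).re < (z j).re} := by
    ext z; simp [sortedConfigurations, StrictMono]
  rw [this]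
  exact .iInter fun i => .iInter fun j => .iInter fun _ =>
    measurableSet_lt (by fun_prop) (by fun_prop)

theorem injective_of_mem_sorted {z : Fin n → ℂ} (hz : z ∈ sortedConfigurations n) :
    Function.Injective z := fun i j h => hz.injective (by simp only [h])

theorem eval_monicOf_rootCoeffs (z : Fin n → ℂ) (w : ℂ) :
    (monicOf (rootCoeffs z)).eval w = ∏ j, (w - z j) := by
  rw [monicOf_rootCoeffs, eval_prod]; simp

theorem range_eq_of_rootCoeffs_eq {z w : Fin n → ℂ} (h : rootCoeffs z = rootCoeffs w) :
    Set.range z = Set.range w := by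
  have : ∀ (z : Fin n → ℂ) x, x ∈ Set.range z ↔ (monicOf (rootCoeffs z)).eval x = 0 := by
    intro z x
    rw [eval_monicOf_rootCoeffs, Finset.prod_eq_zero_iff]
    simp only [Set.mem_range, Finset.mem_univ, true_and, sub_eq_zero, eq_comm]
  ext x
  rw [this, this, h]

/-- The polynomial determines the set of roots, hence the increasing list of their real parts, and
distinct real parts determine which root carries which label. -/
theorem injOn_rootCoeffs : Set.InjOn rootCoeffs (sortedConfigurations n) := by
  intro z hz w hw h
  have h1 := range_eq_of_rootCoeffs_eq h
  have h2 : (fun j => (z j).re) = fun j => (w j).re := by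
    refine StrictMono.range_inj hz hw |>.1 ?_
    rw [Set.range_comp' Complex.re z, Set.range_comp' Complex.re w, h1]
  funext j
  obtain ⟨k, hk⟩ : z j ∈ Set.range w := h1 ▸ Set.mem_range_self j
  have h3 : (w k).re = (w j).re := by rw [hk]; exact congrFun h2 j
  rw [← hk, hw.injective h3]

theorem rootCoeffs_comp_perm (z : Fin n → ℂ) (σ : Equiv.Perm (Fin n)) :
    rootCoeffs (fun j => z (σ j)) = rootCoeffs z := by
  funext i
  rw [rootCoeffs, rootCoeffs, Equiv.prod_comp σ fun j => X - C (z j)]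

theorem existsUnique_perm_sorted {z : Fin n → ℂ} (hz : Function.Injective fun j => (z j).re) :
    ∃! σ : Equiv.Perm (Fin n), (fun j => z (σ j)) ∈ sortedConfigurations n := by
  refine ⟨Tuple.sort fun j => (z j).re, ?_, fun τ hτ => ?_⟩
  · exact (Tuple.monotone_sort fun j => (z j).re).strictMono_of_injective
      (hz.comp (Equiv.injective _))
  · have := Tuple.unique_monotone (f := fun j => (z j).re) (σ := τ) hτ.monotone
      (Tuple.monotone_sort fun j => (z j).re)
    exact Equiv.ext fun j => hz (congrFun this j)

/-- Configurations in which two points have the same real part. -/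
def degenerateConfigurations (n : ℕ) : Set (Fin n → ℂ) :=
  {z | ¬ Function.Injective fun j => (z j).re}

theorem volume_degenerateConfigurations : volume (degenerateConfigurations n) = 0 := by
  have : degenerateConfigurations n ⊆
      ⋃ (p : {p : Fin n × Fin n // p.1 ≠ p.2}), {z | (z p.1.1).re = (z p.1.2).re} := by
    intro z hz
    simp only [degenerateConfigurations, Function.Injective, Set.mem_ofPred_eq, not_forall] at hz
    obtain ⟨i, j, h, hij⟩ := hz
    exact Set.mem_iUnion.2 ⟨⟨(i, j), hij⟩, h⟩
  refine measure_mono_null this (measure_iUnion_null fun p => ?_)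
  let f : (Fin n → ℂ) →ₗ[ℝ] ℝ := Complex.reLm ∘ₗ LinearMap.proj p.1.1 -
    Complex.reLm ∘ₗ LinearMap.proj p.1.2
  have hf : {z : Fin n → ℂ | (z p.1.1).re = (z p.1.2).re} = (LinearMap.ker f : Set (Fin n → ℂ)) := by
    ext z; simp [f, sub_eq_zero]
  rw [hf]
  refine Measure.addHaar_submodule _ _ fun h => ?_
  have h1 : (Pi.single p.1.1 1 : Fin n → ℂ) ∈ LinearMap.ker f := h ▸ Submodule.mem_top
  simp [f, p.2.symm] at h1

theorem ae_injective_re : ∀ᵐ z : Fin n → ℂ, Function.Injective fun j => (z j).re :=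
  volume_degenerateConfigurations

theorem volume_image_degenerateConfigurations :
    volume (rootCoeffs '' degenerateConfigurations n) = 0 :=
  addHaar_image_eq_zero_of_differentiableOn_of_addHaar_eq_zero volume
    differentiable_rootCoeffs.differentiableOn volume_degenerateConfigurations

theorem surjective_rootCoeffs : Function.Surjective (rootCoeffs (n := n)) := by
  intro c
  have hs : (monicOf c).Splits := IsAlgClosed.splits _
  have hcard : (monicOf c).roots.toList.length = n := by
    rw [Multiset.length_toList, ← hs.natDegree_eq_card_roots, natDegree_monicOf]
  refine ⟨fun j => (monicOf c).roots.toList.get (j.cast hcard.symm), monicOf_injective ?_⟩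
  rw [monicOf_rootCoeffs]
  conv_rhs => rw [hs.eq_prod_roots_of_monic (monicOf_monic c)]
  have h : (Finset.univ : Finset (Fin n)).val.map
      (fun j => (monicOf c).roots.toList.get (j.cast hcard.symm)) = (monicOf c).roots := by
    rw [Fin.univ_val_map, ← List.ofFn_congr hcard, List.ofFn_get, Multiset.coe_toList]
  conv_rhs => rw [← h, Multiset.map_map]
  rfl

theorem exists_sorted_rootCoeffs_eq {c : Fin n → ℂ}
    (hc : c ∉ rootCoeffs '' degenerateConfigurations n) :
    ∃ z ∈ sortedConfigurations n, rootCoeffs z = c := by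
  obtain ⟨z, rfl⟩ := surjective_rootCoeffs c
  have hz : Function.Injective fun j => (z j).re := by
    by_contra h
    exact hc ⟨z, h, rfl⟩
  obtain ⟨σ, hσ, -⟩ := existsUnique_perm_sorted hz
  exact ⟨_, hσ, rootCoeffs_comp_perm z σ⟩

/-- Sorted configurations map injectively onto all coefficient vectors outside the image of the
degenerate ones. That image is null, being the differentiable image of a null set. The real Jacobian
is the squared modulus of the complex determinant. -/
theorem setLIntegral_sortedConfigurations (g : (Fin n → ℂ) → ENNReal) :
    ∫⁻ z in sortedConfigurations n, ENNReal.ofReal (vandermondeSq z) * g (rootCoeffs z) =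
      ∫⁻ c, g c := by
  have h1 := lintegral_image_eq_lintegral_abs_det_fderiv_mul volume
    measurableSet_sortedConfigurations (fun a ha =>
      ((hasFDerivAt_rootCoeffs (injective_of_mem_sorted ha)).restrictScalars ℝ).hasFDerivWithinAt)
    injOn_rootCoeffs g
  have h2 : rootCoeffs '' sortedConfigurations n =ᵐ[volume] Set.univ := by
    refine Filter.eventuallyEq_univ.2 ?_
    rw [mem_ae_iff]
    refine measure_mono_null ?_ (volume_image_degenerateConfigurations (n := n))
    intro c hc
    by_contra h
    exact hc (exists_sorted_rootCoeffs_eq h)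
  rw [← setLIntegral_univ g, ← setLIntegral_congr h2, h1]
  refine setLIntegral_congr_fun measurableSet_sortedConfigurations fun z hz => ?_
  rw [abs_det_restrictScalars_rootCoeffsDeriv (injective_of_mem_sorted hz)]

theorem measurePreserving_comp_perm (σ : Equiv.Perm (Fin n)) :
    MeasurePreserving (fun z : Fin n → ℂ => fun j => z (σ j)) volume volume := by
  have h := volume_measurePreserving_piCongrLeft (fun _ : Fin n => ℂ) σ⁻¹
  convert h using 1
  funext z j
  rw [MeasurableEquiv.coe_piCongrLeft]
  have := Equiv.piCongrLeft_apply_apply (fun _ : Fin n => ℂ) σ⁻¹ z (σ j)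
  simpa using this.symm

theorem sum_indicator_sorted {z : Fin n → ℂ} (hz : Function.Injective fun j => (z j).re) :
    ∑ σ : Equiv.Perm (Fin n),
      (sortedConfigurations n).indicator (1 : (Fin n → ℂ) → ENNReal) (fun j => z (σ j)) = 1 := by
  obtain ⟨σ, hσ, hu⟩ := existsUnique_perm_sorted hz
  rw [Finset.sum_eq_single σ, Set.indicator_of_mem hσ, Pi.one_apply]
  · intro τ _ hτ
    exact Set.indicator_of_notMem (fun h => hτ (hu τ h)) _
  · simp

/-- Sorted configurations are a fundamental domain for the permutations, up to the null set of
coinciding real parts. -/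
theorem lintegral_symmetric {Φ : (Fin n → ℂ) → ENNReal} (hΦ : Measurable Φ)
    (hs : ∀ z (σ : Equiv.Perm (Fin n)), Φ (fun j => z (σ j)) = Φ z) :
    ∫⁻ z, Φ z = (n.factorial : ENNReal) * ∫⁻ z in sortedConfigurations n, Φ z := by
  have mI : Measurable ((sortedConfigurations n).indicator (1 : (Fin n → ℂ) → ENNReal)) :=
    measurable_one.indicator measurableSet_sortedConfigurations
  have mσ : ∀ σ : Equiv.Perm (Fin n), Measurable fun z : Fin n → ℂ => fun j => z (σ j) :=
    fun σ => (measurePreserving_comp_perm σ).measurable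
  have h1 : ∫⁻ z, Φ z = ∫⁻ z : Fin n → ℂ, ∑ σ : Equiv.Perm (Fin n),
      (sortedConfigurations n).indicator (1 : (Fin n → ℂ) → ENNReal) (fun j => z (σ j)) *
        Φ (fun j => z (σ j)) := by
    refine lintegral_congr_ae ?_
    filter_upwards [ae_injective_re] with z hz
    simp_rw [hs]
    rw [← Finset.sum_mul, sum_indicator_sorted hz, one_mul]
  refine h1.trans ((lintegral_finsetSum _
    fun σ _ => (mI.comp (mσ σ)).mul (hΦ.comp (mσ σ))).trans ?_)
  have h2 : ∀ σ : Equiv.Perm (Fin n), ∫⁻ z : Fin n → ℂ,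
      (sortedConfigurations n).indicator (1 : (Fin n → ℂ) → ENNReal) (fun j => z (σ j)) *
        Φ (fun j => z (σ j)) = ∫⁻ z in sortedConfigurations n, Φ z := fun σ => by
    refine ((measurePreserving_comp_perm σ).lintegral_comp (mI.mul hΦ)).trans ?_
    rw [← lintegral_indicator measurableSet_sortedConfigurations]
    refine lintegral_congr fun z => ?_
    by_cases hz : z ∈ sortedConfigurations n <;> simp [hz]
  refine (Finset.sum_congr rfl fun σ _ => h2 σ).trans ?_
  rw [Finset.sum_const, Finset.card_univ, Fintype.card_perm, Fintype.card_fin, nsmul_eq_mul]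

/-- As a product of |z_i - z_j| over ordered pairs i ≠ j, the expression no longer refers to the
order of the labels. -/
theorem vandermondeSq_comp_perm (z : Fin n → ℂ) (σ : Equiv.Perm (Fin n)) :
    vandermondeSq (fun j => z (σ j)) = vandermondeSq z := by
  have h : ∀ z : Fin n → ℂ, vandermondeSq z = ∏ i, ∏ j, if i = j then 1 else ‖z i - z j‖ := by
    intro z
    have := Finset.prod_prod_Ioi_mul_eq_prod_prod_off_diag fun j i : Fin n => ‖z i - z j‖
    have h1 : vandermondeSq z = ∏ i, ∏ j ∈ Finset.Ioi i, ‖z i - z j‖ * ‖z j - z i‖ := by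
      refine Finset.prod_congr rfl fun i _ => Finset.prod_congr rfl fun j _ => ?_
      rw [norm_sub_rev (z j), sq]
    rw [h1, this]
    refine Finset.prod_congr rfl fun i _ => ?_
    rw [← Finset.prod_subset (Finset.subset_univ ({i}ᶜ : Finset (Fin n)))]
    · refine Finset.prod_congr rfl fun j hj => ?_
      rw [if_neg]
      rintro rfl
      simp at hj
    · intro j _ hj
      rw [if_pos]
      simpa [eq_comm] using hj
  rw [h, h]
  rw [← Equiv.prod_comp σ fun i => ∏ j, if i = j then 1 else ‖z i - z j‖]
  refine Finset.prod_congr rfl fun i _ => ?_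
  rw [← Equiv.prod_comp σ fun j => if σ i = j then 1 else ‖z (σ i) - z j‖]
  simp

theorem measurable_vandermondeSq : Measurable (vandermondeSq (n := n)) := by
  unfold vandermondeSq; fun_prop

theorem lintegral_vandermondeSq_mul {g : (Fin n → ℂ) → ENNReal} (hg : Measurable g) :
    ∫⁻ z, ENNReal.ofReal (vandermondeSq z) * g (rootCoeffs z) =
      (n.factorial : ENNReal) * ∫⁻ c, g c := by
  rw [lintegral_symmetric, setLIntegral_sortedConfigurations]
  · exact measurable_vandermondeSq.ennreal_ofReal.mul (hg.comp measurable_rootCoeffs)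
  · intro z σ
    rw [vandermondeSq_comp_perm, rootCoeffs_comp_perm]

/-- Lusin–Souslin: a continuous injection on a Borel set is a measurable embedding, so its inverse
extends measurably. This is the measurable choice of sorted roots of a polynomial. -/
theorem exists_measurable_rightInverse_rootCoeffs (n : ℕ) :
    ∃ r : (Fin n → ℂ) → (Fin n → ℂ), Measurable r ∧
      ∀ z ∈ sortedConfigurations n, r (rootCoeffs z) = z := by
  have h := (differentiable_rootCoeffs (n := n)).continuous.continuousOn.measurableEmbedding
    measurableSet_sortedConfigurations injOn_rootCoeffs
  obtain ⟨r, hr, h2⟩ := h.exists_measurable_extend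
    (g := ((↑) : sortedConfigurations n → (Fin n → ℂ))) measurable_subtype_coe fun _ => ⟨0⟩
  exact ⟨r, hr, fun z hz => congrFun h2 ⟨z, hz⟩⟩

/-! ### Uniform labellings as an operation on laws -/

/-- Averaging over all labellings, as an operation on laws. -/
noncomputable def symmetrization (μ : Measure (Fin n → ℂ)) : Measure (Fin n → ℂ) :=
  (n.factorial : ENNReal)⁻¹ • ∑ σ : Equiv.Perm (Fin n), μ.map fun z j => z (σ j)

theorem symmetrization_apply (μ : Measure (Fin n → ℂ)) {A : Set (Fin n → ℂ)}
    (hA : MeasurableSet A) : symmetrization μ A = (n.factorial : ENNReal)⁻¹ *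
      ∫⁻ z, ∑ σ : Equiv.Perm (Fin n), A.indicator 1 (fun j => z (σ j)) ∂μ := by
  have mσ : ∀ σ : Equiv.Perm (Fin n), Measurable fun z : Fin n → ℂ => fun j => z (σ j) :=
    fun σ => (measurePreserving_comp_perm σ).measurable
  rw [symmetrization, Measure.smul_apply, Measure.finsetSum_apply, smul_eq_mul]
  refine congrArg _ (Eq.trans ?_ (lintegral_finsetSum _
    fun σ _ => (measurable_one.indicator hA).comp (mσ σ)).symm)
  refine Finset.sum_congr rfl fun σ _ => ?_
  rw [← lintegral_indicator_one hA, lintegral_map (measurable_one.indicator hA) (mσ σ)]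
  rfl

/-- The average over labellings forgets the initial one, so it can be computed from the sorted
roots, a measurable function of the polynomial alone. -/
theorem symmetrization_congr {μ ν : Measure (Fin n → ℂ)}
    (hμ : ∀ᵐ z ∂μ, Function.Injective fun j => (z j).re)
    (hν : ∀ᵐ z ∂ν, Function.Injective fun j => (z j).re)
    (h : μ.map rootCoeffs = ν.map rootCoeffs) : symmetrization μ = symmetrization ν := by
  obtain ⟨r, hr, hr2⟩ := exists_measurable_rightInverse_rootCoeffs n
  ext A hA
  have key : ∀ μ : Measure (Fin n → ℂ), (∀ᵐ z ∂μ, Function.Injective fun j => (z j).re) →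
      symmetrization μ A = (n.factorial : ENNReal)⁻¹ * ∫⁻ c, ∑ σ : Equiv.Perm (Fin n),
        A.indicator 1 (fun j => r c (σ j)) ∂(μ.map rootCoeffs) := by
    intro μ hμ
    rw [symmetrization_apply μ hA, lintegral_map _ measurable_rootCoeffs]
    · congr 1
      refine lintegral_congr_ae ?_
      filter_upwards [hμ] with z hz
      obtain ⟨τ, hτ, -⟩ := existsUnique_perm_sorted hz
      have h1 := hr2 _ hτ
      rw [rootCoeffs_comp_perm] at h1
      rw [h1]
      -- The sorted labelling differs from z by τ, and σ ↦ τσ permutes the terms of the sum.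
      exact (Equiv.sum_comp (Equiv.mulLeft τ) fun σ : Equiv.Perm (Fin n) =>
        A.indicator (1 : (Fin n → ℂ) → ENNReal) fun j => z (σ j)).symm
    · refine Finset.measurable_sum _ fun σ _ => (measurable_one.indicator hA).comp ?_
      exact (measurePreserving_comp_perm σ).measurable.comp hr
  rw [key μ hμ, key ν hν, h]

theorem symmetrization_withDensity {Φ : (Fin n → ℂ) → ENNReal} (hΦ : Measurable Φ)
    (hs : ∀ z (σ : Equiv.Perm (Fin n)), Φ (fun j => z (σ j)) = Φ z) :
    symmetrization (volume.withDensity Φ) = volume.withDensity Φ := by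
  have h : ∀ σ : Equiv.Perm (Fin n),
      (volume.withDensity Φ).map (fun z j => z (σ j)) = volume.withDensity Φ := fun σ => by
    have mp := measurePreserving_comp_perm σ
    ext A hA
    rw [Measure.map_apply mp.measurable hA, withDensity_apply _ (mp.measurable hA),
      withDensity_apply _ hA, ← mp.setLIntegral_comp_preimage hA hΦ]
    simp_rw [hs]
  simp only [symmetrization, h, Finset.sum_const, Finset.card_univ, Fintype.card_perm,
    Fintype.card_fin]
  rw [← Nat.cast_smul_eq_nsmul ENNReal, smul_smul, ENNReal.inv_mul_cancel, one_smul]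
  · exact_mod_cast n.factorial_ne_zero
  · exact ENNReal.natCast_ne_top _

theorem unorderedLaw_eq_symmetrization {Ω : Type*} [MeasurableSpace Ω] {P : Measure Ω}
    {z : Ω → Fin n → ℂ} (hz : AEMeasurable z P) : unorderedLaw P z = symmetrization (P.map z) := by
  rw [unorderedLaw, symmetrization]
  congr 1
  refine Finset.sum_congr rfl fun σ _ => ?_
  rw [AEMeasurable.map_map_of_aemeasurable
    (measurePreserving_comp_perm σ).measurable.aemeasurable hz]
  rfl

end rootCoeffs

/-! ### Lebesgue measure on acute configurations in the parameters (l, u, v) -/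

theorem lintegral_pi_complex {n : ℕ} {f : (Fin n → ℂ) → ENNReal} (hf : Measurable f) :
    ∫⁻ c, f c = ∫⁻ p : Fin n → ℝ, ∫⁻ y : Fin n → ℝ, f fun i => ⟨p i, y i⟩ := by
  have h1 := volume_preserving_pi fun _ : Fin n => Complex.volume_preserving_equiv_real_prod.symm
  have h2 := (volume_measurePreserving_arrowProdEquivProdArrow ℝ ℝ (Fin n)).symm
  have h3 := h1.comp h2
  rw [← h3.lintegral_comp hf, Measure.volume_eq_prod, lintegral_prod]
  · rfl
  · exact (hf.comp h3.measurable).aemeasurable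

theorem lintegral_real_eq_mul {a : ℝ} (ha : a ≠ 0) {f : ℝ → ENNReal} (hf : Measurable f) :
    ∫⁻ x, f x = ENNReal.ofReal |a| * ∫⁻ x, f (x * a) := by
  have h := Real.map_volume_mul_right ha
  have h2 := lintegral_map (μ := volume) hf (measurable_id.mul_const a)
  simp only [id] at h2
  rw [← h2, h, lintegral_smul_measure, smul_eq_mul,
    ← mul_assoc, ← ENNReal.ofReal_mul (abs_nonneg _), abs_inv, mul_inv_cancel₀ (by positivity),
    ENNReal.ofReal_one, one_mul]

/-- For fixed real parts p, the imaginary parts are l p₀ and l(p_{i+1} - q_i): the first coordinate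
contributes |p₀| and the other d a factor l each. -/
theorem setLIntegral_coeffsRegion {d : ℕ} {g : (Fin (d + 1) → ℂ) → ENNReal} (hg : Measurable g) :
    ∫⁻ c in coeffsRegion d, g c = ∫⁻ l in Set.Ioi (0 : ℝ), ∫⁻ x in stieltjesRegion d,
      ENNReal.ofReal (|x.1 0| * l ^ d) * g (perturbedCoeffs l x) := by
  set f := (coeffsRegion d).indicator g with hf
  have mf : Measurable f := hg.indicator measurableSet_coeffsRegion
  have mG : Measurable fun y : ((Fin (d + 1) → ℝ) × ℝ) × (Fin d → ℝ) =>
      f (perturbedCoeffs y.1.2 (y.1.1, y.2)) :=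
    mf.comp (measurable_perturbedCoeffs.comp (by fun_prop :
      Measurable fun y : ((Fin (d + 1) → ℝ) × ℝ) × (Fin d → ℝ) => (y.1.2, (y.1.1, y.2))))
  have h1 : ∀ p : Fin (d + 1) → ℝ, p 0 ≠ 0 → ∫⁻ y : Fin (d + 1) → ℝ, f (fun i => ⟨p i, y i⟩) =
      ∫⁻ l : ℝ, ENNReal.ofReal (|p 0| * |l| ^ d) *
        ∫⁻ q : Fin d → ℝ, f (perturbedCoeffs l (p, q)) := by
    intro p hp
    have m1 : Measurable fun y : Fin (d + 1) → ℝ => f fun i => ⟨p i, y i⟩ := by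
      refine mf.comp (measurable_pi_lambda _ fun i => ?_)
      exact Complex.measurableEquivRealProd.symm.measurable.comp
        (measurable_const.prodMk (measurable_pi_apply i))
    have m2 : Measurable fun a : ℝ × (Fin d → ℝ) =>
        f fun i => ⟨p i, (Fin.cons a.1 a.2 : Fin (d + 1) → ℝ) i⟩ :=
      m1.comp (measurable_cons measurable_snd measurable_fst)
    rw [volume_pi, lintegral_pi_eq_lintegral_cons _ m1, ← volume_pi,
      lintegral_real_eq_mul hp m2.lintegral_prod_right', ← lintegral_const_mul]
    · refine lintegral_congr_ae ?_
      filter_upwards [Measure.ae_ne volume (0 : ℝ)] with l hl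
      have m3 : Measurable fun y : Fin d → ℝ =>
          f fun i => ⟨p i, (Fin.cons (l * p 0) y : Fin (d + 1) → ℝ) i⟩ :=
        m2.comp measurable_prodMk_left
      refine (congrArg _ (lintegral_eq_lintegral_smul hl m3)).trans ?_
      rw [← lintegral_sub_left_eq_self _ (Fin.tail p), ← mul_assoc,
        ← ENNReal.ofReal_mul (abs_nonneg _)]
      congr 1
      refine lintegral_congr fun q => ?_
      congr 1
      funext i
      refine Fin.cases ?_ (fun i => ?_) i
      · apply Complex.ext <;> simp [perturbedCoeffs]
      · apply Complex.ext
        · simp [perturbedCoeffs]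
        · simp [perturbedCoeffs, Fin.tail]
          ring
    · exact m2.lintegral_prod_right'.comp (measurable_id.mul_const _)
  have h2 : ∀ᵐ p : Fin (d + 1) → ℝ, p 0 ≠ 0 := by
    have := (Measure.quasiMeasurePreserving_eval (fun _ : Fin (d + 1) => (volume : Measure ℝ)) 0).ae
      (Measure.ae_ne volume (0 : ℝ))
    exact this
  rw [← lintegral_indicator measurableSet_coeffsRegion, lintegral_pi_complex mf]
  rw [lintegral_congr_ae (g := fun p => ∫⁻ l : ℝ, ENNReal.ofReal (|p 0| * |l| ^ d) *
        ∫⁻ q : Fin d → ℝ, f (perturbedCoeffs l (p, q)))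
    (by filter_upwards [h2] with p hp using h1 p hp)]
  rw [lintegral_lintegral_swap (μ := (volume : Measure (Fin (d + 1) → ℝ)))
    (ν := (volume : Measure ℝ)) (f := fun p l => ENNReal.ofReal (|p 0| * |l| ^ d) *
        ∫⁻ q : Fin d → ℝ, f (perturbedCoeffs l (p, q)))
    (Measurable.mul (f := fun a : (Fin (d + 1) → ℝ) × ℝ => ENNReal.ofReal (|a.1 0| * |a.2| ^ d))
      (g := fun a : (Fin (d + 1) → ℝ) × ℝ => ∫⁻ q : Fin d → ℝ, f (perturbedCoeffs a.2 (a.1, q)))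
      (by fun_prop) mG.lintegral_prod_right').aemeasurable,
    ← lintegral_indicator measurableSet_Ioi]
  refine lintegral_congr_ae ?_
  filter_upwards [Measure.ae_ne volume (0 : ℝ)] with l hl
  have m3 : Measurable fun x : (Fin (d + 1) → ℝ) × (Fin d → ℝ) =>
      ENNReal.ofReal (|x.1 0| * |l| ^ d) * f (perturbedCoeffs l x) :=
    Measurable.mul (by fun_prop) (mf.comp (measurable_perturbedCoeffs.comp measurable_prodMk_left))
  have h3 : ∫⁻ p : Fin (d + 1) → ℝ, ENNReal.ofReal (|p 0| * |l| ^ d) *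
        ∫⁻ q : Fin d → ℝ, f (perturbedCoeffs l (p, q)) =
      ∫⁻ x : (Fin (d + 1) → ℝ) × (Fin d → ℝ),
        ENNReal.ofReal (|x.1 0| * |l| ^ d) * f (perturbedCoeffs l x) := by
    rw [Measure.volume_eq_prod, lintegral_prod _ m3.aemeasurable]
    refine lintegral_congr fun p => (lintegral_const_mul _ ?_).symm
    exact mf.comp ((measurable_perturbedCoeffs.comp measurable_prodMk_left).comp
      measurable_prodMk_left)
  rw [h3]
  have h4 : ∀ᵐ x : (Fin (d + 1) → ℝ) × (Fin d → ℝ), x.1 0 ≠ 0 :=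
    (Measure.quasiMeasurePreserving_fst (μ := (volume : Measure (Fin (d + 1) → ℝ)))
      (ν := (volume : Measure (Fin d → ℝ)))).ae h2
  by_cases hl0 : 0 < l
  · rw [Set.indicator_of_mem (by exact hl0),
      ← lintegral_indicator (measurableSet_stieltjesRegion d)]
    refine lintegral_congr_ae ?_
    filter_upwards [h4] with x hx
    by_cases hxS : x ∈ stieltjesRegion d
    · rw [Set.indicator_of_mem hxS, hf,
        Set.indicator_of_mem ((perturbedCoeffs_mem hx hl).2 ⟨hl0, hxS⟩), abs_of_pos hl0]
    · rw [Set.indicator_of_notMem hxS, hf, Set.indicator_of_notMem, mul_zero]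
      exact fun h => hxS ((perturbedCoeffs_mem hx hl).1 h).2
  · rw [Set.indicator_of_notMem (by exact hl0)]
    refine (lintegral_congr_ae (g := 0) ?_).trans lintegral_zero
    filter_upwards [h4] with x hx
    rw [hf, Set.indicator_of_notMem, mul_zero, Pi.zero_apply]
    exact fun h => hl0 ((perturbedCoeffs_mem hx hl).1 h).1

/-- Lebesgue measure on configurations, in terms of the continued fraction parameters and of the
perturbation parameter. -/
theorem setLIntegral_acuteConfigurations {d : ℕ} {g : (Fin (d + 1) → ℂ) → ENNReal}
    (hg : Measurable g) :
    ∫⁻ z in acuteConfigurations (d + 1), ENNReal.ofReal (vandermondeSq z) * g (rootCoeffs z) =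
      ((d + 1).factorial : ENNReal) * ∫⁻ l in Set.Ioi (0 : ℝ),
        ∫⁻ u, ∫⁻ v, ENNReal.ofReal (stieltjesJacobian d u v) *
          (ENNReal.ofReal (|(stieltjesPair d u v).1 0| * l ^ d) *
            g (perturbedCoeffs l (stieltjesPair d u v)))
          ∂(orthantMeasure d) ∂(orthantMeasure (d + 1)) := by
  have h1 : acuteConfigurations (d + 1) = rootCoeffs ⁻¹' coeffsRegion d := Set.ext fun z =>
    ⟨mem_coeffsRegion_of_mem_acuteConfigurations, mem_acuteConfigurations_of_mem_coeffsRegion⟩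
  have mS : MeasurableSet (acuteConfigurations (d + 1)) :=
    h1 ▸ measurable_rootCoeffs measurableSet_coeffsRegion
  have h2 : ∫⁻ z in acuteConfigurations (d + 1),
      ENNReal.ofReal (vandermondeSq z) * g (rootCoeffs z) =
      ∫⁻ z, ENNReal.ofReal (vandermondeSq z) * (coeffsRegion d).indicator g (rootCoeffs z) := by
    rw [← lintegral_indicator mS]
    refine lintegral_congr fun z => ?_
    by_cases hz : z ∈ acuteConfigurations (d + 1)
    · rw [Set.indicator_of_mem hz, Set.indicator_of_mem (by rwa [h1] at hz)]
    · rw [Set.indicator_of_notMem hz, Set.indicator_of_notMem (by rwa [h1] at hz), mul_zero]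
  rw [h2, lintegral_vandermondeSq_mul (hg.indicator measurableSet_coeffsRegion),
    lintegral_indicator measurableSet_coeffsRegion, setLIntegral_coeffsRegion hg]
  congr 1
  refine lintegral_congr fun l => ?_
  rw [setLIntegral_stieltjesRegion]
  exact Measurable.mul (by fun_prop)
    (hg.comp (measurable_perturbedCoeffs.comp measurable_prodMk_left))

/-! ### Characteristic polynomials of the Jacobi matrix and of its perturbation -/

section determinants

variable {R : Type*} [CommRing R] {d : ℕ}

theorem det_tridiagonal_corner (M : Matrix (Fin (d + 2)) (Fin (d + 2)) R)
    (h1 : ∀ j : Fin d, M 0 j.succ.succ = 0) (h2 : ∀ i : Fin d, M i.succ.succ 0 = 0) :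
    M.det = M 0 0 * (M.submatrix Fin.succ Fin.succ).det -
      M 0 1 * M 1 0 * ((M.submatrix Fin.succ Fin.succ).submatrix Fin.succ Fin.succ).det := by
  rw [Matrix.det_succ_row_zero, Fin.sum_univ_succ, Fin.sum_univ_succ]
  have h3 : ∑ i : Fin d, (-1) ^ (i.succ.succ : ℕ) * M 0 i.succ.succ *
      (M.submatrix Fin.succ i.succ.succ.succAbove).det = 0 :=
    Finset.sum_eq_zero fun i _ => by rw [h1]; ring
  rw [h3, Matrix.det_succ_column_zero (M.submatrix Fin.succ (Fin.succ 0).succAbove),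
    Fin.sum_univ_succ]
  have h4 : ∑ i : Fin d, (-1) ^ (i.succ : ℕ) *
      (M.submatrix Fin.succ (Fin.succ 0).succAbove) i.succ 0 *
      ((M.submatrix Fin.succ (Fin.succ 0).succAbove).submatrix i.succ.succAbove Fin.succ).det = 0 :=
    Finset.sum_eq_zero fun i _ => by
      have : (M.submatrix Fin.succ (Fin.succ 0).succAbove) i.succ 0 = M i.succ.succ 0 := rfl
      rw [this, h2]; ring
  rw [h4]
  have h5 : (M.submatrix Fin.succ (Fin.succ 0).succAbove).submatrix (Fin.succAbove 0) Fin.succ =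
      (M.submatrix Fin.succ Fin.succ).submatrix Fin.succ Fin.succ := by
    ext i j
    simp only [Matrix.submatrix_apply, Fin.succAbove_zero]
    congr 1
  rw [h5]
  simp [Fin.succAbove_zero]
  ring

/-- Linearity in the first row. It is used twice: to peel the corner entry y₀² off a Gram matrix,
and to insert the perturbation. -/
theorem det_update_corner (M N : Matrix (Fin (d + 1)) (Fin (d + 1)) R) (a b : R)
    (h1 : ∀ i : Fin d, ∀ j, N i.succ j = M i.succ j) (h2 : N 0 0 = a * M 0 0 + b)
    (h3 : ∀ j : Fin d, N 0 j.succ = a * M 0 j.succ) :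
    N.det = a * M.det + b * (M.submatrix Fin.succ Fin.succ).det := by
  have h4 : ∀ f : Fin d → Fin (d + 1), N.submatrix Fin.succ f = M.submatrix Fin.succ f := fun f => by
    ext i j; exact h1 i (f j)
  rw [Matrix.det_succ_row_zero N, Matrix.det_succ_row_zero M, Fin.sum_univ_succ, Fin.sum_univ_succ]
  simp only [h4, h2, h3, Fin.succAbove_zero, Fin.val_zero, pow_zero, one_mul, mul_add,
    Finset.mul_sum, add_mul]
  rw [add_right_comm]
  congr 2
  · ring
  · exact Finset.sum_congr rfl fun i _ => by ring

end determinants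

section gram

variable {d : ℕ}

/-- The Jacobi matrix `Bᵀ B`. -/
noncomputable def gram (x : Fin (d + 1) → ℝ) (y : Fin d → ℝ) :
    Matrix (Fin (d + 1)) (Fin (d + 1)) ℝ :=
  (bidiagonal x (y : Fin (d + 1 - 1) → ℝ)).transpose * bidiagonal x (y : Fin (d + 1 - 1) → ℝ)

theorem bidiagonal_succ_succ (x : Fin (d + 2) → ℝ) (y : Fin (d + 1) → ℝ) (i j : Fin (d + 1)) :
    bidiagonal x (y : Fin (d + 2 - 1) → ℝ) i.succ j.succ =
      bidiagonal (Fin.tail x) (Fin.tail y : Fin (d + 1 - 1) → ℝ) i j := by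
  simp only [bidiagonal, Matrix.of_apply, Fin.succ_inj, Fin.val_succ, Nat.add_right_cancel_iff]
  split_ifs <;> rfl

theorem bidiagonal_succ_zero (x : Fin (d + 2) → ℝ) (y : Fin (d + 1) → ℝ) (i : Fin (d + 1)) :
    bidiagonal x (y : Fin (d + 2 - 1) → ℝ) i.succ 0 = 0 := by
  simp [bidiagonal]

theorem bidiagonal_zero_zero (x : Fin (d + 1) → ℝ) (y : Fin d → ℝ) :
    bidiagonal x (y : Fin (d + 1 - 1) → ℝ) 0 0 = x 0 := by
  simp [bidiagonal]

theorem bidiagonal_zero_one (x : Fin (d + 2) → ℝ) (y : Fin (d + 1) → ℝ) :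
    bidiagonal x (y : Fin (d + 2 - 1) → ℝ) 0 1 = y 0 := by
  simp [bidiagonal]

theorem bidiagonal_zero_succ_succ (x : Fin (d + 2) → ℝ) (y : Fin (d + 1) → ℝ) (j : Fin d) :
    bidiagonal x (y : Fin (d + 2 - 1) → ℝ) 0 j.succ.succ = 0 := by
  simp only [bidiagonal, Matrix.of_apply]
  rw [if_neg (Fin.succ_ne_zero _).symm, dif_neg (by simp)]

theorem gram_zero (x : Fin (d + 2) → ℝ) (y : Fin (d + 1) → ℝ) (j : Fin (d + 2)) :
    gram x y 0 j = x 0 * bidiagonal x (y : Fin (d + 2 - 1) → ℝ) 0 j := by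
  rw [gram, Matrix.mul_apply, Fin.sum_univ_succ]
  simp only [Matrix.transpose_apply, bidiagonal_succ_zero, zero_mul, Finset.sum_const_zero,
    add_zero, bidiagonal_zero_zero]

theorem gram_symm (x : Fin (d + 1) → ℝ) (y : Fin d → ℝ) (i j : Fin (d + 1)) :
    gram x y i j = gram x y j i := by
  simp only [gram, Matrix.mul_apply, Matrix.transpose_apply, mul_comm]

theorem gram_succ_succ (x : Fin (d + 2) → ℝ) (y : Fin (d + 1) → ℝ) (i j : Fin (d + 1)) :
    gram x y i.succ j.succ = bidiagonal x (y : Fin (d + 2 - 1) → ℝ) 0 i.succ *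
      bidiagonal x (y : Fin (d + 2 - 1) → ℝ) 0 j.succ + gram (Fin.tail x) (Fin.tail y) i j := by
  simp only [gram]
  rw [Matrix.mul_apply, Fin.sum_univ_succ, Matrix.mul_apply]
  simp only [Matrix.transpose_apply, bidiagonal_succ_succ]

theorem charpoly_submatrix_succ (A : Matrix (Fin (d + 1)) (Fin (d + 1)) ℝ) :
    (A.charmatrix.submatrix Fin.succ Fin.succ).det = (A.submatrix Fin.succ Fin.succ).charpoly := by
  rw [Matrix.charpoly]
  congr 1
  ext i j : 2
  simp only [Matrix.submatrix_apply, Matrix.charmatrix_apply, Matrix.diagonal_apply, Fin.succ_inj]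

/-- Deleting the first row and column of BᵀB leaves the Gram matrix of the shorter bidiagonal matrix
with y₀² added in its corner, whence Q = p - v₀q. The three-term recurrence for P then becomes the
Stieltjes step. -/
theorem charpoly_gram (d : ℕ) (x : Fin (d + 1) → ℝ) (y : Fin d → ℝ) :
    (gram x y).charpoly = monicOf (stieltjesPair d (fun i => x i ^ 2) fun i => y i ^ 2).1 ∧
    ((gram x y).submatrix Fin.succ Fin.succ).charpoly =
      monicOf (stieltjesPair d (fun i => x i ^ 2) fun i => y i ^ 2).2 := by
  induction d with
  | zero =>
    constructor
    · have : (gram x y) 0 0 = x 0 ^ 2 := by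
        simp [gram, Matrix.mul_apply, bidiagonal, sq]
      rw [Matrix.charpoly, Matrix.det_fin_one, Matrix.charmatrix_apply_eq, this]
      simp [monicOf, stieltjesPair, sub_eq_add_neg]
    · simp [Matrix.charpoly, monicOf]
  | succ d ih =>
    obtain ⟨ih1, ih2⟩ := ih (Fin.tail x) (Fin.tail y)
    have hP := monicOf_stieltjesStep_fst (x 0 ^ 2) (y 0 ^ 2)
      (stieltjesPair d (fun i => Fin.tail x i ^ 2) fun i => Fin.tail y i ^ 2)
    have hQ := monicOf_stieltjesStep_snd (x 0 ^ 2) (y 0 ^ 2)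
      (stieltjesPair d (fun i => Fin.tail x i ^ 2) fun i => Fin.tail y i ^ 2)
    rw [← ih1, ← ih2] at hP hQ
    have hsub : ((gram x y).submatrix Fin.succ Fin.succ).charpoly =
        (gram (Fin.tail x) (Fin.tail y)).charpoly - C (y 0 ^ 2) *
          ((gram (Fin.tail x) (Fin.tail y)).submatrix Fin.succ Fin.succ).charpoly := by
      rw [Matrix.charpoly, det_update_corner (gram (Fin.tail x) (Fin.tail y)).charmatrix _ 1
        (-C (y 0 ^ 2)), charpoly_submatrix_succ, ← Matrix.charpoly]
      · ring
      · intro i j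
        have : (gram x y) i.succ.succ j.succ = gram (Fin.tail x) (Fin.tail y) i.succ j := by
          rw [gram_succ_succ, bidiagonal_zero_succ_succ, zero_mul, zero_add]
        simp only [Matrix.charmatrix_apply, Matrix.submatrix_apply, this]
      · have : (gram x y) (Fin.succ 0) (Fin.succ 0) =
            y 0 * y 0 + gram (Fin.tail x) (Fin.tail y) 0 0 := by
          rw [gram_succ_succ, Fin.succ_zero_eq_one, bidiagonal_zero_one]
        simp only [Matrix.charmatrix_apply_eq, Matrix.submatrix_apply, this, C_add, sq]
        ring
      · intro j
        have : (gram x y) (Fin.succ 0) j.succ.succ = gram (Fin.tail x) (Fin.tail y) 0 j.succ := by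
          rw [gram_succ_succ, bidiagonal_zero_succ_succ, mul_zero, zero_add]
        simp only [Matrix.charmatrix_apply, Matrix.submatrix_apply, this, one_mul]
    refine ⟨?_, hsub.trans hQ.symm⟩
    refine Eq.trans ?_ hP.symm
    have hne : ∀ i : Fin d, (i.succ.succ : Fin (d + 2)) ≠ 0 := fun i => Fin.succ_ne_zero _
    -- The expansion is (X - u₀)Q - u₀v₀q, which equals XQ - u₀p since Q + v₀q = p.
    rw [← hsub, Matrix.charpoly, det_tridiagonal_corner]
    · have h1 : ((gram x y).charmatrix.submatrix Fin.succ Fin.succ).submatrix Fin.succ Fin.succ =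
          (gram (Fin.tail x) (Fin.tail y)).charmatrix.submatrix Fin.succ Fin.succ := by
        ext i j : 2
        simp only [Matrix.submatrix_apply, Matrix.charmatrix_apply, Matrix.diagonal_apply,
          Fin.succ_inj, gram_succ_succ, bidiagonal_zero_succ_succ, zero_mul, zero_add]
      have h00 : gram x y 0 0 = x 0 ^ 2 := by rw [gram_zero, bidiagonal_zero_zero, sq]
      have h01 : gram x y 0 1 = x 0 * y 0 := by rw [gram_zero, bidiagonal_zero_one]
      have h10 : gram x y 1 0 = x 0 * y 0 := by rw [gram_symm, h01]
      rw [h1, charpoly_submatrix_succ, charpoly_submatrix_succ, hsub, Matrix.charmatrix_apply_eq,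
        Matrix.charmatrix_apply_ne _ _ _ (by simp), Matrix.charmatrix_apply_ne _ _ _ (by simp),
        h00, h01, h10]
      simp only [C_mul, C_pow]
      ring
    · intro j
      rw [Matrix.charmatrix_apply_ne _ _ _ (hne j).symm, gram_zero, bidiagonal_zero_succ_succ]
      simp
    · intro j
      rw [Matrix.charmatrix_apply_ne _ _ _ (hne j), gram_symm, gram_zero,
        bidiagonal_zero_succ_succ]
      simp

theorem perturbed_apply (l : ℝ) (J : Matrix (Fin (d + 1)) (Fin (d + 1)) ℝ) (i j : Fin (d + 1)) :
    perturbed l J i j = (J i j : ℂ) + if i = 0 then Complex.I * l * J 0 j else 0 := by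
  rw [perturbed, add_mul, one_mul, Matrix.add_apply, Matrix.map_apply, Matrix.mul_apply,
    Finset.sum_eq_single 0]
  · by_cases hi : i = 0
    · simp [hi, e₁, Matrix.vecMulVec_apply]
    · simp [hi, e₁, Matrix.vecMulVec_apply]
  · intro k _ hk
    simp [hk, e₁, Matrix.vecMulVec_apply]
  · simp

/-- The first row of X - (I + i l e₁e₁*)J is (1 + i l) times that of X - J, minus i l X in the
corner. Hence the determinant (1 + i l)P - i l XQ. -/
theorem charpoly_perturbed (l : ℝ) (x : Fin (d + 1) → ℝ) (y : Fin d → ℝ) :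
    (perturbed l (gram x y)).charpoly = monicOf (perturbedCoeffs l
      (stieltjesPair d (fun i => x i ^ 2) fun i => y i ^ 2)) := by
  obtain ⟨h1, h2⟩ := charpoly_gram d x y
  rw [monicOf_perturbedCoeffs, ← h1, ← h2, Matrix.charpoly,
    det_update_corner ((gram x y).map (algebraMap ℝ ℂ)).charmatrix _ (1 + C (Complex.I * l))
      (-(C (Complex.I * l) * X))]
  · have h3 : (((gram x y).map (algebraMap ℝ ℂ)).charmatrix.submatrix Fin.succ Fin.succ).det =
        ((gram x y).submatrix Fin.succ Fin.succ).charpoly.map (algebraMap ℝ ℂ) := by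
      rw [← charpoly_submatrix_succ, Matrix.charmatrix_map, ← coe_mapRingHom, RingHom.map_det]
      rfl
    have h4 : ((gram x y).map (algebraMap ℝ ℂ)).charmatrix.det =
        (gram x y).charpoly.map (algebraMap ℝ ℂ) := (Matrix.charpoly_map _ _)
    rw [h3, h4, Polynomial.map_sub, Polynomial.map_mul, map_X]
    ring
  · intro i j
    simp [Matrix.charmatrix_apply, perturbed_apply]
  · simp only [Matrix.charmatrix_apply_eq, perturbed_apply, Matrix.map_apply, if_true, C_add, C_mul,
      Complex.coe_algebraMap]
    ring
  · intro j
    rw [Matrix.charmatrix_apply_ne _ _ _ (Fin.succ_ne_zero j).symm,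
      Matrix.charmatrix_apply_ne _ _ _ (Fin.succ_ne_zero j).symm]
    simp only [perturbed_apply, Matrix.map_apply, if_true, C_add, C_mul, Complex.coe_algebraMap]
    ring

end gram

/-- The non-leading coefficients of the characteristic polynomial of `(I + i l e₁ e₁*) J`. -/
noncomputable def charCoeffs {n : ℕ} [NeZero n] (a : Matrix (Fin n) (Fin n) ℝ × ℝ) : Fin n → ℂ :=
  fun i => (perturbed a.2 a.1).charpoly.coeff i

theorem monicOf_charCoeffs {n : ℕ} [NeZero n] (a : Matrix (Fin n) (Fin n) ℝ × ℝ) :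
    monicOf (charCoeffs a) = (perturbed a.2 a.1).charpoly :=
  monicOf_coeff (Matrix.charpoly_monic _) (by simp [Matrix.charpoly_natDegree_eq_dim])

theorem measurable_charCoeffs (d : ℕ) : Measurable
    (charCoeffs : Matrix (Fin (d + 1)) (Fin (d + 1)) ℝ × ℝ → Fin (d + 1) → ℂ) := by
  refine measurable_pi_lambda _ fun i => ?_
  have h : ∀ a : Matrix (Fin (d + 1)) (Fin (d + 1)) ℝ × ℝ, charCoeffs a i =
      MvPolynomial.eval (fun ij : Fin (d + 1) × Fin (d + 1) => perturbed a.2 a.1 ij.1 ij.2)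
        ((Matrix.charpoly.univ ℂ (Fin (d + 1))).coeff i) := by
    intro a
    have := Matrix.charpoly.univ_coeff_eval₂Hom (n := Fin (d + 1)) (RingHom.id ℂ)
      (fun ij => perturbed a.2 a.1 ij.1 ij.2) i
    exact this.symm
  simp_rw [h]
  refine (MvPolynomial.continuous_eval _).measurable.comp (measurable_pi_lambda _ fun ij => ?_)
  have hm : ∀ i j : Fin (d + 1), Measurable
      fun a : Matrix (Fin (d + 1)) (Fin (d + 1)) ℝ × ℝ => a.1 i j := fun i j =>
    (measurable_pi_iff.1 (measurable_pi_iff.1 measurable_fst i) j)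
  simp only [perturbed_apply]
  refine (Complex.measurable_ofReal.comp (hm _ _)).add ?_
  split_ifs
  · exact (measurable_const.mul (Complex.measurable_ofReal.comp measurable_snd)).mul
      (Complex.measurable_ofReal.comp (hm _ _))
  · exact measurable_const

theorem listsEigenvalues_iff {n : ℕ} [NeZero n] (a : Matrix (Fin n) (Fin n) ℝ × ℝ) (z : Fin n → ℂ) :
    ListsEigenvalues (perturbed a.2 a.1) z ↔ rootCoeffs z = charCoeffs a := by
  have h1 : (∏ j, (X - C (z j))) = ((Finset.univ.val.map z).map fun a => X - C a).prod := by
    rw [Multiset.map_map]; rfl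
  constructor
  · intro h
    refine monicOf_injective ?_
    rw [monicOf_rootCoeffs, monicOf_charCoeffs, h1, ← h]
    exact ((IsAlgClosed.splits _).eq_prod_roots_of_monic (Matrix.charpoly_monic _)).symm
  · intro h
    rw [ListsEigenvalues, ← monicOf_charCoeffs, ← h, monicOf_rootCoeffs, h1,
      roots_multiset_prod_X_sub_C]

/-! ### The law of the squared entries of the bidiagonal matrix -/

/-- The density of the square of a chi variable. -/
noncomputable def chiSqDensity (k t : ℝ) : ℝ :=
  2 ^ (-(k / 2)) / Real.Gamma (k / 2) * t ^ (k / 2 - 1) * Real.exp (-t / 2)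

theorem measurable_chiSqDensity (k : ℝ) : Measurable (chiSqDensity k) := by
  unfold chiSqDensity; fun_prop

theorem chiSqDensity_nonneg {k t : ℝ} (hk : 0 < k) (ht : 0 < t) : 0 ≤ chiSqDensity k t := by
  have := Real.Gamma_pos_of_pos (half_pos hk)
  unfold chiSqDensity; positivity

theorem map_sq_chiLaw (k : ℝ) : (chiLaw k).map (fun t => t ^ 2) =
    (volume.restrict (Set.Ioi 0)).withDensity fun t => ENNReal.ofReal (chiSqDensity k t) := by
  have himg : (fun t : ℝ => t ^ 2) '' Set.Ioi 0 = Set.Ioi 0 := by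
    ext t
    refine ⟨?_, fun ht => ⟨√t, Real.sqrt_pos.2 ht, Real.sq_sqrt (le_of_lt ht)⟩⟩
    rintro ⟨s, hs, rfl⟩
    exact pow_pos (show (0 : ℝ) < s from hs) 2
  have hder : ∀ x ∈ Set.Ioi (0 : ℝ), HasDerivWithinAt (fun t : ℝ => t ^ 2) (2 * x) (Set.Ioi 0) x :=
    fun x _ => by simpa using (hasDerivAt_pow 2 x).hasDerivWithinAt
  have hinj : Set.InjOn (fun t : ℝ => t ^ 2) (Set.Ioi 0) := fun a ha b hb h =>
    (pow_left_inj₀ (le_of_lt ha) (le_of_lt hb) two_ne_zero).1 h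
  have mc : Measurable fun t : ℝ => ENNReal.ofReal
      (2 ^ (1 - k / 2) / Real.Gamma (k / 2) * t ^ (k - 1) * Real.exp (-t ^ 2 / 2)) := by fun_prop
  ext A hA
  rw [Measure.map_apply (by fun_prop) hA, chiLaw, withDensity_apply _ ((by fun_prop :
    Measurable fun t : ℝ => t ^ 2) hA), withDensity_apply _ hA, ← lintegral_indicator hA,
    ← lintegral_indicator ((by fun_prop : Measurable fun t : ℝ => t ^ 2) hA)]
  conv_rhs => rw [← himg]
  rw [lintegral_image_eq_lintegral_abs_deriv_mul measurableSet_Ioi hder hinj]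
  refine setLIntegral_congr_fun measurableSet_Ioi fun t ht => ?_
  have ht0 : 0 < t := ht
  by_cases htA : t ^ 2 ∈ A
  · rw [Set.indicator_of_mem (by exact htA), Set.indicator_of_mem htA,
      ← ENNReal.ofReal_mul (abs_nonneg _), abs_of_pos (by positivity)]
    congr 1
    have h1 : (t ^ 2) ^ (k / 2 - 1) * t = t ^ (k - 1) := by
      rw [← Real.rpow_natCast t 2, ← Real.rpow_mul ht0.le]
      nth_rw 2 [← Real.rpow_one t]
      rw [← Real.rpow_add ht0]
      congr 1; push_cast; ring
    have h2 : (2 : ℝ) ^ (1 - k / 2) = 2 * 2 ^ (-(k / 2)) := by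
      rw [sub_eq_add_neg, Real.rpow_add two_pos, Real.rpow_one]
    rw [chiSqDensity, ← h1, h2]
    ring
  · rw [Set.indicator_of_notMem (by exact htA), Set.indicator_of_notMem htA, mul_zero]

theorem lintegral_pi_prod {d : ℕ} (μ : Fin d → Measure ℝ) [∀ i, SigmaFinite (μ i)]
    {f : Fin d → ℝ → ENNReal} (hf : ∀ i, Measurable (f i)) :
    ∫⁻ x, ∏ i, f i (x i) ∂(Measure.pi μ) = ∏ i, ∫⁻ t, f i t ∂(μ i) := by
  induction d with
  | zero => rw [Measure.pi_of_empty, lintegral_dirac]; simp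
  | succ d ih =>
    have h := (measurePreserving_piFinSuccAbove μ 0).symm
    have m1 : Measurable fun x : Fin (d + 1) → ℝ => ∏ i, f i (x i) := by fun_prop
    rw [← h.lintegral_comp m1, Fin.prod_univ_succ, ← ih (fun i => μ i.succ) fun i => hf i.succ]
    simp only [MeasurableEquiv.piFinSuccAbove_symm_apply, Fin.insertNthEquiv_zero,
      Fin.prod_univ_succ]
    refine (lintegral_prod_mul (μ := μ 0) (ν := Measure.pi fun i => μ (Fin.succ i))
      (f := f 0) (g := fun x => ∏ i, f (Fin.succ i) (x i)) (hf 0).aemeasurable ?_)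
    exact Measurable.aemeasurable (by fun_prop)

theorem pi_withDensity {d : ℕ} (μ : Fin d → Measure ℝ) [∀ i, SigmaFinite (μ i)]
    {f : Fin d → ℝ → ENNReal} (hf : ∀ i, Measurable (f i))
    [∀ i, SigmaFinite ((μ i).withDensity (f i))] :
    Measure.pi (fun i => (μ i).withDensity (f i)) =
      (Measure.pi μ).withDensity fun x => ∏ i, f i (x i) := by
  refine Measure.pi_eq fun s hs => ?_
  rw [withDensity_apply _ (.univ_pi hs), Measure.restrict_pi_pi, lintegral_pi_prod _ hf]
  exact Finset.prod_congr rfl fun i _ => (withDensity_apply _ (hs i)).symm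


theorem map_sq_pi_chiLaw {d : ℕ} (k : Fin d → ℝ) :
    (Measure.pi fun i => chiLaw (k i)).map (fun x i => x i ^ 2) =
      (orthantMeasure d).withDensity fun u => ∏ i, ENNReal.ofReal (chiSqDensity (k i) (u i)) := by
  have hs : ∀ i, SigmaFinite ((volume.restrict (Set.Ioi 0)).withDensity
      fun t => ENNReal.ofReal (chiSqDensity (k i) t)) := fun i =>
    SigmaFinite.withDensity_of_ne_top (ae_of_all _ fun _ => ENNReal.ofReal_ne_top)
  have hs' : ∀ i, SigmaFinite ((chiLaw (k i)).map fun t => t ^ 2) := fun i => by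
    rw [map_sq_chiLaw]; exact hs i
  rw [Measure.pi_map_pi (f := fun _ t => t ^ 2) fun i => by fun_prop]
  simp only [map_sq_chiLaw]
  exact pi_withDensity _ fun i => (measurable_chiSqDensity _).ennreal_ofReal

instance sigmaFinite_chiLaw (k : ℝ) : SigmaFinite (chiLaw k) :=
  SigmaFinite.withDensity_of_ne_top (ae_of_all _ fun _ => ENNReal.ofReal_ne_top)

theorem ae_orthantMeasure_pos (d : ℕ) : ∀ᵐ u ∂(orthantMeasure d), ∀ i, 0 < u i := by
  rw [orthantMeasure, ← Measure.restrict_pi_pi]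
  filter_upwards [ae_restrict_mem (MeasurableSet.univ_pi fun _ => measurableSet_Ioi)] with u hu i
  exact hu i (Set.mem_univ i)

/-- The density of the squared coefficients. -/
noncomputable def squaredDensity (β : ℝ) (m d : ℕ) (u : Fin (d + 1) → ℝ) (v : Fin d → ℝ) : ℝ :=
  (∏ i : Fin (d + 1), chiSqDensity (β * ((m : ℝ) - (i : ℕ))) (u i)) *
    ∏ j : Fin d, chiSqDensity (β * (((d + 1 : ℕ) : ℝ) - ((j : ℕ) + 1))) (v j)

theorem degrees_pos {β : ℝ} (hβ : 0 < β) {m d : ℕ} (hm : d + 1 ≤ m) (i : Fin (d + 1)) :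
    0 < β * ((m : ℝ) - (i : ℕ)) := by
  have h : ((i : ℕ) : ℝ) < m := by exact_mod_cast i.2.trans_le hm
  exact mul_pos hβ (by linarith)

theorem degrees_pos' {β : ℝ} (hβ : 0 < β) {d : ℕ} (j : Fin d) :
    0 < β * (((d + 1 : ℕ) : ℝ) - ((j : ℕ) + 1)) := by
  have h : ((j : ℕ) : ℝ) < d := by exact_mod_cast j.2
  exact mul_pos hβ (by push_cast; linarith)

theorem lintegral_coefficientLaw {β : ℝ} (hβ : 0 < β) {m d : ℕ} (hm : d + 1 ≤ m)
    {f : (Fin (d + 1) → ℝ) × (Fin d → ℝ) → ENNReal} (hf : Measurable f) :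
    ∫⁻ p : (Fin (d + 1) → ℝ) × (Fin d → ℝ), f (fun i => p.1 i ^ 2, fun i => p.2 i ^ 2)
        ∂(coefficientLaw β m (d + 1)) =
      ∫⁻ u, ∫⁻ v, ENNReal.ofReal (squaredDensity β m d u v) * f (u, v)
        ∂(orthantMeasure d) ∂(orthantMeasure (d + 1)) := by
  have hc : coefficientLaw β m (d + 1) =
      ((Measure.pi fun j : Fin (d + 1) => chiLaw (β * ((m : ℝ) - (j : ℕ)))).prod
        (Measure.pi fun j : Fin d => chiLaw (β * (((d + 1 : ℕ) : ℝ) - ((j : ℕ) + 1)))) :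
        Measure ((Fin (d + 1) → ℝ) × (Fin d → ℝ))) := rfl
  have m1 : Measurable fun x : Fin (d + 1) → ℝ => fun i => x i ^ 2 := by fun_prop
  have m2 : Measurable fun x : Fin d → ℝ => fun i => x i ^ 2 := by fun_prop
  have h1 := map_sq_pi_chiLaw fun i : Fin (d + 1) => β * ((m : ℝ) - (i : ℕ))
  have h2 := map_sq_pi_chiLaw fun j : Fin d => β * (((d + 1 : ℕ) : ℝ) - ((j : ℕ) + 1))
  have m3 : ∀ k : ℝ, Measurable fun t => ENNReal.ofReal (chiSqDensity k t) := fun k =>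
    (measurable_chiSqDensity k).ennreal_ofReal
  have m4 : Measurable fun u : Fin (d + 1) → ℝ =>
      ∏ i : Fin (d + 1), ENNReal.ofReal (chiSqDensity (β * ((m : ℝ) - (i : ℕ))) (u i)) :=
    Finset.measurable_fun_prod _ fun i _ => (m3 _).comp (measurable_pi_apply i)
  have m5 : Measurable fun v : Fin d → ℝ =>
      ∏ j : Fin d, ENNReal.ofReal (chiSqDensity (β * (((d + 1 : ℕ) : ℝ) - ((j : ℕ) + 1))) (v j)) :=
    Finset.measurable_fun_prod _ fun i _ => (m3 _).comp (measurable_pi_apply i)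
  have h3 := Measure.map_prod_map
    (Measure.pi fun j : Fin (d + 1) => chiLaw (β * ((m : ℝ) - (j : ℕ))))
    (Measure.pi fun j : Fin d => chiLaw (β * (((d + 1 : ℕ) : ℝ) - ((j : ℕ) + 1)))) m1 m2
  have h4 : ∫⁻ p : (Fin (d + 1) → ℝ) × (Fin d → ℝ), f (fun i => p.1 i ^ 2, fun i => p.2 i ^ 2)
      ∂(coefficientLaw β m (d + 1)) = ∫⁻ p, f p ∂((((Measure.pi fun j : Fin (d + 1) =>
        chiLaw (β * ((m : ℝ) - (j : ℕ)))).prod (Measure.pi fun j : Fin d =>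
        chiLaw (β * (((d + 1 : ℕ) : ℝ) - ((j : ℕ) + 1))))).map
        (Prod.map (fun x i => x i ^ 2) (fun x i => x i ^ 2)))) := by
    rw [lintegral_map hf (m1.prodMap m2), hc]
    rfl
  have m6 : Measurable fun z : (Fin (d + 1) → ℝ) × (Fin d → ℝ) =>
      (∏ i : Fin (d + 1), ENNReal.ofReal (chiSqDensity (β * ((m : ℝ) - (i : ℕ))) (z.1 i))) *
        ∏ j : Fin d,
          ENNReal.ofReal (chiSqDensity (β * (((d + 1 : ℕ) : ℝ) - ((j : ℕ) + 1))) (z.2 j)) :=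
    (m4.comp measurable_fst).mul (m5.comp measurable_snd)
  rw [h4, ← h3, h1, h2, prod_withDensity m4 m5, lintegral_withDensity_eq_lintegral_mul _ m6 hf,
    lintegral_prod _ (m6.mul hf).aemeasurable]
  refine lintegral_congr_ae ?_
  filter_upwards [ae_orthantMeasure_pos (d + 1)] with u hu
  refine lintegral_congr_ae ?_
  filter_upwards [ae_orthantMeasure_pos d] with v hv
  rw [Pi.mul_apply, squaredDensity, ENNReal.ofReal_mul, ENNReal.ofReal_prod_of_nonneg,
    ENNReal.ofReal_prod_of_nonneg]
  · exact fun i _ => chiSqDensity_nonneg (degrees_pos' hβ i) (hv i)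
  · exact fun i _ => chiSqDensity_nonneg (degrees_pos hβ hm i) (hu i)
  · exact Finset.prod_nonneg fun i _ => chiSqDensity_nonneg (degrees_pos hβ hm i) (hu i)

/-! ### Moduli of resultants -/

section resNorm

/-- The modulus of the product of the values of `B` at the roots of `A`. -/
noncomputable def resNorm (A B : ℂ[X]) : ℝ := (A.roots.map fun a => ‖B.eval a‖).prod

theorem resNorm_congr {A B B' : ℂ[X]} (h : ∀ a, A.eval a = 0 → ‖B.eval a‖ = ‖B'.eval a‖) :
    resNorm A B = resNorm A B' := by
  unfold resNorm
  exact congrArg _ (Multiset.map_congr rfl fun a ha => h a (isRoot_of_mem_roots ha))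

theorem resNorm_mul (A B B' : ℂ[X]) : resNorm A (B * B') = resNorm A B * resNorm A B' := by
  simp only [resNorm, eval_mul, norm_mul, Multiset.prod_map_mul]

theorem resNorm_C (A : ℂ[X]) (c : ℂ) : resNorm A (C c) = ‖c‖ ^ A.natDegree := by
  simp [resNorm, IsAlgClosed.card_roots_eq_natDegree]

theorem resNorm_eq_prod_prod {A B : ℂ[X]} (hB : B.Monic) :
    resNorm A B = (A.roots.map fun a => (B.roots.map fun b => ‖a - b‖).prod).prod := by
  refine congrArg _ (Multiset.map_congr rfl fun a _ => ?_)
  conv_lhs => rw [(IsAlgClosed.splits B).eq_prod_roots_of_monic hB, eval_multiset_prod,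
    Multiset.map_map]
  rw [show ∀ s : Multiset ℂ, ‖s.prod‖ = (s.map fun z => ‖z‖).prod from
    fun s => map_multiset_prod (normHom : ℂ →*₀ ℝ) s, Multiset.map_map]
  simp

/-- For monic polynomials both sides are the product of |a - b| over pairs of roots. -/
theorem resNorm_comm {A B : ℂ[X]} (hA : A.Monic) (hB : B.Monic) : resNorm A B = resNorm B A := by
  rw [resNorm_eq_prod_prod hB, resNorm_eq_prod_prod hA, Multiset.prod_map_prod_map]
  simp only [norm_sub_rev]

theorem resNorm_X {A : ℂ[X]} (hA : A.Monic) : resNorm A X = ‖A.eval 0‖ := by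
  rw [resNorm_comm hA monic_X, resNorm, roots_X]
  simp

end resNorm

/-! ### Determinant, trace and resultant in terms of the continued fraction parameters -/

section stieltjesPair

variable {d : ℕ}

theorem stieltjesPair_succ (u : Fin (d + 2) → ℝ) (v : Fin (d + 1) → ℝ) :
    stieltjesPair (d + 1) u v =
      stieltjesStep (u 0) (v 0) (stieltjesPair d (Fin.tail u) (Fin.tail v)) := rfl

theorem exists_monic_X_mul_sub (u : Fin (d + 1) → ℝ) (v : Fin d → ℝ) :
    ∃ p : ℝ[X], p.Monic ∧ X * monicOf (stieltjesPair d u v).2 - monicOf (stieltjesPair d u v).1 =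
      C (u 0) * p := by
  cases d with
  | zero => exact ⟨1, monic_one, by simp [stieltjesPair, monicOf]⟩
  | succ d =>
    refine ⟨_, monicOf_monic (stieltjesPair d (Fin.tail u) (Fin.tail v)).1, ?_⟩
    rw [stieltjesPair_succ, monicOf_stieltjesStep_fst, monicOf_stieltjesStep_snd]
    ring

theorem abs_stieltjesPair_fst_zero {u : Fin (d + 1) → ℝ} (hu : ∀ i, 0 < u i) (v : Fin d → ℝ) :
    |(stieltjesPair d u v).1 0| = ∏ i, u i := by
  induction d with
  | zero => simp [stieltjesPair, abs_of_pos (hu 0)]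
  | succ d ih =>
    rw [Fin.prod_univ_succ, ← show _ = ∏ i : Fin (d + 1), u i.succ from
      ih (u := Fin.tail u) (fun i => hu i.succ) (Fin.tail v), stieltjesPair_succ]
    have h : (0 : Fin (d + 2)) = (0 : Fin (d + 1)).castSucc := rfl
    rw [stieltjesStep]
    dsimp only
    rw [Pi.sub_apply, Fin.cons_zero, h, Fin.snoc_castSucc, Pi.smul_apply, zero_sub,
      abs_neg, smul_eq_mul, abs_mul, ← h, abs_of_pos (hu 0)]

theorem stieltjesPair_fst_last (u : Fin (d + 1) → ℝ) (v : Fin d → ℝ) :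
    (stieltjesPair d u v).1 (Fin.last d) = -(∑ i, u i + ∑ i, v i) := by
  induction d with
  | zero => simp [stieltjesPair]
  | succ d ih =>
    have h : (stieltjesPair d (Fin.tail u) (Fin.tail v)).1 (Fin.last d) =
      -(∑ i : Fin (d + 1), u i.succ + ∑ i : Fin d, v i.succ) := ih (Fin.tail u) (Fin.tail v)
    rw [stieltjesPair_succ, Fin.sum_univ_succ u, Fin.sum_univ_succ v, stieltjesStep]
    dsimp only
    rw [Pi.sub_apply, Fin.snoc_last, ← Fin.succ_last, Fin.cons_succ, Pi.sub_apply, h, Fin.snoc_last]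
    ring

/-- The image in `ℂ[X]` of a real polynomial. -/
noncomputable abbrev complexify (p : ℝ[X]) : ℂ[X] := p.map (algebraMap ℝ ℂ)

theorem norm_eval_complexify_zero (c : Fin (d + 1) → ℝ) :
    ‖(complexify (monicOf c)).eval 0‖ = |c 0| := by
  have h : (monicOf c).eval 0 = c 0 := by
    rw [← coeff_zero_eq_eval_zero]; exact coeff_monicOf c 0
  rw [complexify, ← map_zero (algebraMap ℝ ℂ), eval_map_apply, h]
  simp

theorem resNorm_complexify_X_mul (c : Fin (d + 1) → ℝ) (q : ℝ[X]) :
    resNorm (complexify (monicOf c)) (complexify (X * q)) =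
      |c 0| * resNorm (complexify (monicOf c)) (complexify q) := by
  rw [complexify, complexify, Polynomial.map_mul, resNorm_mul, map_X,
    resNorm_X ((monicOf_monic c).map _), norm_eval_complexify_zero]

theorem resNorm_complexify_C_mul (A : ℂ[X]) {t : ℝ} (ht : 0 < t) (q : ℝ[X]) :
    resNorm A (complexify (C t * q)) = t ^ A.natDegree * resNorm A (complexify q) := by
  rw [complexify, Polynomial.map_mul, resNorm_mul, map_C, resNorm_C]
  simp [abs_of_pos ht]

theorem natDegree_complexify_monicOf (c : Fin d → ℝ) : (complexify (monicOf c)).natDegree = d := by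
  rw [complexify, (monicOf_monic c).natDegree_map, natDegree_monicOf]

/-- Real polynomials which agree up to a sign at the roots of a third one may be exchanged. -/
theorem resNorm_complexify_congr {A : ℂ[X]} {B B' D : ℝ[X]}
    (h : B - B' = D ∨ B - B' = -D) (hD : ∀ a, A.eval a = 0 → (complexify D).eval a = 0) :
    resNorm A (complexify B) = resNorm A (complexify B') := by
  refine resNorm_congr fun a ha => ?_
  have h' : (complexify (B - B')).eval a = 0 := by
    rcases h with h | h <;> rw [h]
    · exact hD a ha
    · rw [complexify, Polynomial.map_neg, eval_neg, hD a ha, neg_zero]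
  rw [complexify, Polynomial.map_sub, eval_sub, sub_eq_zero] at h'
  rw [complexify, h']

/-- A Euclidean algorithm on |P(0)| Res(P, Q) = Res(P, XQ). Modulo P, XQ is u₀p; swapping, P is XQ
modulo p up to a multiple of p, and Q is -v₀q modulo p. Each step thus produces u₀^(d+2) v₀^(d+1)
|p(0)| Res(p, q). -/
theorem resNorm_stieltjesPair {u : Fin (d + 1) → ℝ} {v : Fin d → ℝ} (hu : ∀ i, 0 < u i)
    (hv : ∀ i, 0 < v i) :
    resNorm (complexify (monicOf (stieltjesPair d u v).1))
        (complexify (monicOf (stieltjesPair d u v).2)) =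
      (∏ i, u i ^ (d - (i : ℕ))) * ∏ i, v i ^ (d - (i : ℕ)) := by
  induction d with
  | zero =>
    have h1 : monicOf (stieltjesPair 0 u v).2 = 1 := by simp [stieltjesPair, monicOf]
    rw [h1]
    simp [resNorm]
  | succ d ih =>
    have ih' := ih (u := Fin.tail u) (v := Fin.tail v) (fun i => hu i.succ) fun i => hv i.succ
    set x := stieltjesPair d (Fin.tail u) (Fin.tail v) with hx
    set y := stieltjesPair (d + 1) u v with hy
    have hyx : y = stieltjesStep (u 0) (v 0) x := rfl
    have hP : monicOf y.1 = X * monicOf y.2 - C (u 0) * monicOf x.1 := by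
      rw [hyx, monicOf_stieltjesStep_fst, monicOf_stieltjesStep_snd]
    have hQ : monicOf y.2 = monicOf x.1 - C (v 0) * monicOf x.2 := by
      rw [hyx, monicOf_stieltjesStep_snd]
    have hy0 : |y.1 0| = u 0 * |x.1 0| := by
      rw [abs_stieltjesPair_fst_zero hu, abs_stieltjesPair_fst_zero (u := Fin.tail u)
        (fun i => hu i.succ), Fin.prod_univ_succ]
      rfl
    have hx0 : 0 < |x.1 0| := by
      rw [abs_stieltjesPair_fst_zero (u := Fin.tail u) (fun i => hu i.succ)]
      exact Finset.prod_pos fun i _ => hu i.succ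
    have mP := (monicOf_monic y.1).map (algebraMap ℝ ℂ)
    have mp := (monicOf_monic x.1).map (algebraMap ℝ ℂ)
    have e1 : |y.1 0| * resNorm (complexify (monicOf y.1)) (complexify (monicOf y.2)) =
        u 0 ^ (d + 2) * (|x.1 0| *
          (v 0 ^ (d + 1) * resNorm (complexify (monicOf x.1)) (complexify (monicOf x.2)))) := by
      calc _ = resNorm (complexify (monicOf y.1)) (complexify (C (u 0) * monicOf x.1)) := by
            rw [← resNorm_complexify_X_mul]
            exact resNorm_complexify_congr (D := monicOf y.1) (Or.inl (by rw [hP]))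
              fun a ha => ha
        _ = u 0 ^ (d + 2) * resNorm (complexify (monicOf x.1)) (complexify (monicOf y.1)) := by
            rw [resNorm_complexify_C_mul _ (hu 0), natDegree_complexify_monicOf,
              resNorm_comm mP mp]
        _ = u 0 ^ (d + 2) * resNorm (complexify (monicOf x.1)) (complexify (X * monicOf y.2)) := by
            congr 1
            refine resNorm_complexify_congr (D := C (u 0) * monicOf x.1)
              (Or.inr (by rw [hP]; ring)) fun a ha => ?_
            rw [complexify, Polynomial.map_mul, eval_mul, ha, mul_zero]
        _ = u 0 ^ (d + 2) * (|x.1 0| *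
              resNorm (complexify (monicOf x.1)) (complexify (C (v 0) * monicOf x.2))) := by
            rw [resNorm_complexify_X_mul]
            congr 2
            refine resNorm_congr fun a ha => ?_
            rw [hQ, complexify, Polynomial.map_sub, eval_sub, ha, zero_sub, norm_neg]
        _ = _ := by rw [resNorm_complexify_C_mul _ (hv 0), natDegree_complexify_monicOf]
    have e2 : resNorm (complexify (monicOf y.1)) (complexify (monicOf y.2)) =
        u 0 ^ (d + 1) * v 0 ^ (d + 1) *
          resNorm (complexify (monicOf x.1)) (complexify (monicOf x.2)) := by
      -- Cancelling |P(0)| = u₀|p(0)| lowers the exponent of u₀ by one.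
      have h0 : u 0 * |x.1 0| ≠ 0 := (mul_pos (hu 0) hx0).ne'
      refine mul_left_cancel₀ h0 ?_
      rw [← hy0, e1, hy0]
      ring
    have h1 : ∀ i : ℕ, d + 1 - (i + 1) = d - i := by omega
    rw [e2, ih', Fin.prod_univ_succ fun i => u i ^ (d + 1 - (i : ℕ)),
      Fin.prod_univ_succ fun i => v i ^ (d + 1 - (i : ℕ))]
    simp only [Fin.val_zero, Fin.val_succ, h1, Nat.sub_zero, Fin.tail]
    ring

/-- M is u₀ times a monic p, and f ≡ P modulo p, so f may be replaced by P and then M by XQ. The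
factor X contributes |P(0)| = ∏u, which raises each exponent of u by one. -/
theorem resNorm_perturbed (l : ℝ) {u : Fin (d + 1) → ℝ} {v : Fin d → ℝ} (hu : ∀ i, 0 < u i)
    (hv : ∀ i, 0 < v i) :
    resNorm (monicOf (perturbedCoeffs l (stieltjesPair d u v)))
        (complexify (X * monicOf (stieltjesPair d u v).2 - monicOf (stieltjesPair d u v).1)) =
      (∏ i, u i ^ (d - (i : ℕ) + 1)) * ∏ i, v i ^ (d - (i : ℕ)) := by
  obtain ⟨p, hp, hM⟩ := exists_monic_X_mul_sub u v
  set x := stieltjesPair d u v with hx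
  have mP := (monicOf_monic x.1).map (algebraMap ℝ ℂ)
  have mp := hp.map (algebraMap ℝ ℂ)
  have mz := monicOf_monic (perturbedCoeffs l x)
  calc _ = u 0 ^ (d + 1) * resNorm (complexify p) (monicOf (perturbedCoeffs l x)) := by
        rw [hM, resNorm_complexify_C_mul _ (hu 0), natDegree_monicOf, resNorm_comm mz mp]
    _ = u 0 ^ (d + 1) * resNorm (complexify p) (complexify (monicOf x.1)) := by
        congr 1
        refine resNorm_congr fun a ha => ?_
        rw [monicOf_perturbedCoeffs, hM, Polynomial.map_mul, eval_sub, eval_mul, eval_mul, ha,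
          mul_zero, mul_zero, sub_zero]
    _ = resNorm (complexify (monicOf x.1)) (complexify (C (u 0) * p)) := by
        rw [resNorm_complexify_C_mul _ (hu 0), natDegree_complexify_monicOf, resNorm_comm mP mp]
    _ = resNorm (complexify (monicOf x.1)) (complexify (X * monicOf x.2)) := by
        refine resNorm_complexify_congr (D := monicOf x.1) (Or.inr (by rw [← hM]; ring))
          fun a ha => ha
    _ = _ := by
        rw [resNorm_complexify_X_mul, abs_stieltjesPair_fst_zero hu, resNorm_stieltjesPair hu hv,
          ← mul_assoc, ← Finset.prod_mul_distrib]
        congr 1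
        exact Finset.prod_congr rfl fun i _ => (pow_succ' _ _).symm

end stieltjesPair

/-! ### Symmetric functions of the eigenvalues in terms of (l, u, v) -/

section roots

variable {d : ℕ} {l : ℝ} {z : Fin (d + 1) → ℂ} {x : (Fin (d + 1) → ℝ) × (Fin d → ℝ)}

theorem roots_monicOf_rootCoeffs {n : ℕ} (z : Fin n → ℂ) :
    (monicOf (rootCoeffs z)).roots = Finset.univ.val.map z := by
  have h : ∏ j, (X - C (z j)) = ((Finset.univ.val.map z).map fun a => X - C a).prod := by
    rw [Multiset.map_map]; rfl
  rw [monicOf_rootCoeffs, h, roots_multiset_prod_X_sub_C]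

/-- The left side is the modulus at z_j of the conjugate polynomial, which is f + 2 i l M, and
f(z_j) = 0. -/
theorem norm_eval_conj (hz : rootCoeffs z = perturbedCoeffs l x) (hl : 0 < l) (j : Fin (d + 1)) :
    ∏ k, ‖z j - starRingEnd ℂ (z k)‖ =
      2 * l * ‖(complexify (X * monicOf x.2 - monicOf x.1)).eval (z j)‖ := by
  have h1 : (monicOf (perturbedCoeffs l x)).eval (z j) = 0 := by
    rw [← hz, monicOf_rootCoeffs, eval_prod]
    exact Finset.prod_eq_zero (Finset.mem_univ j) (by simp)
  have h2 : (monicOf (perturbedCoeffs l x)).map (starRingEnd ℂ) =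
      ∏ k, (X - C (starRingEnd ℂ (z k))) := by
    rw [← hz, monicOf_rootCoeffs, Polynomial.map_prod]
    simp
  have h3 : (monicOf (perturbedCoeffs l x)).map (starRingEnd ℂ) =
      monicOf (perturbedCoeffs l x) + C (2 * Complex.I * l) *
        complexify (X * monicOf x.2 - monicOf x.1) := by
    have h4 : (starRingEnd ℂ).comp (algebraMap ℝ ℂ) = algebraMap ℝ ℂ := by
      ext t; simp
    rw [monicOf_perturbedCoeffs, Polynomial.map_sub, Polynomial.map_mul, Polynomial.map_map,
      Polynomial.map_map, h4, map_C]
    simp only [map_mul, Complex.conj_I, Complex.conj_ofReal, C_neg]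
    rw [show (C (2 : ℂ)) = 2 from rfl]
    ring
  have h5 := congrArg (fun p => ‖p.eval (z j)‖) (h2.symm.trans h3)
  simp only [eval_prod, norm_prod, eval_sub, eval_X, eval_C, eval_add, h1, zero_add, eval_mul,
    norm_mul] at h5
  rw [h5]
  simp [abs_of_pos hl]

theorem prod_norm_sub_conj {u : Fin (d + 1) → ℝ} {v : Fin d → ℝ} (hu : ∀ i, 0 < u i)
    (hv : ∀ i, 0 < v i) (hl : 0 < l) (hz : rootCoeffs z = perturbedCoeffs l (stieltjesPair d u v)) :
    ∏ j, ∏ k, ‖z j - starRingEnd ℂ (z k)‖ =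
      (2 * l) ^ (d + 1) * ((∏ i, u i ^ (d - (i : ℕ) + 1)) * ∏ i, v i ^ (d - (i : ℕ))) := by
  rw [← resNorm_perturbed l hu hv, ← hz, resNorm, roots_monicOf_rootCoeffs, Multiset.map_map]
  simp only [norm_eval_conj hz hl]
  rw [Finset.prod_mul_distrib, Finset.prod_const, Finset.card_univ, Fintype.card_fin]
  rfl

theorem abs_re_prod (hz : rootCoeffs z = perturbedCoeffs l x) : |(∏ j, z j).re| = |x.1 0| := by
  have h := congrArg Complex.re (congrFun hz 0)
  rw [rootCoeffs_zero, show ((-1 : ℂ) ^ (d + 1)) = (((-1 : ℝ) ^ (d + 1) : ℝ) : ℂ) by simp,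
    Complex.re_ofReal_mul] at h
  have h2 := congrArg abs h
  rw [abs_mul, abs_pow, abs_neg, abs_one, one_pow, one_mul] at h2
  rw [h2]
  simp [perturbedCoeffs]

theorem sum_re_eq (hz : rootCoeffs z = perturbedCoeffs l x) :
    ∑ j, (z j).re = -x.1 (Fin.last d) := by
  have h1 : rootCoeffs z (Fin.last d) = -∑ j, z j := by
    rw [← prod_X_sub_C_nextCoeff, nextCoeff, if_neg] <;>
      simp [natDegree_prod_of_monic, monic_X_sub_C, rootCoeffs]
  have h := congrArg Complex.re (congrFun hz (Fin.last d))
  rw [h1] at h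
  simp [perturbedCoeffs] at h
  linarith

end roots

/-! ### Normalizing constants and the pointwise density identity -/

theorem sum_sub_add_sum_sub (m : ℝ) (d : ℕ) :
    ∑ i : Fin (d + 1), (m - (i : ℕ)) + ∑ j : Fin d, ((d : ℝ) - (j : ℕ)) = (d + 1) * m := by
  have h : ∑ j : Fin d, ((d : ℝ) - (j : ℕ)) = ∑ j : Fin d, (((j : ℕ) : ℝ) + 1) := by
    rw [← Equiv.sum_comp Fin.revPerm]
    refine Finset.sum_congr rfl fun j _ => ?_
    rw [Fin.revPerm_apply, Fin.val_rev, Nat.cast_sub (by omega)]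
    push_cast; ring
  rw [h, Finset.sum_sub_distrib, Fin.sum_univ_succ fun i : Fin (d + 1) => ((i : ℕ) : ℝ)]
  simp

/-- By Γ(1 + t) = tΓ(t), the ratio Γ(1 + βj/2)/Γ(1 + β/2) is jΓ(βj/2)/Γ(β/2). The factors j make n!,
the last Γ(βj/2) cancels Γ(βn/2), and reversing the indices turns the other Gamma factors into those
of the chi densities. -/
theorem sConst_eq {β : ℝ} (hβ : 0 < β) {m d : ℕ} :
    sConst β m (d + 1) = (d + 1).factorial * 2 ^ (β * ((d + 1) * m) / 2) *
      (∏ i : Fin (d + 1), Real.Gamma (β * ((m : ℝ) - (i : ℕ)) / 2)) *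
      ∏ j : Fin d, Real.Gamma (β * (((d + 1 : ℕ) : ℝ) - ((j : ℕ) + 1)) / 2) := by
  have hG : ∀ j : ℕ, Real.Gamma (β * (j + 1) / 2) ≠ 0 := fun j =>
    (Real.Gamma_pos_of_pos (by positivity)).ne'
  have hG0 : Real.Gamma (β / 2) ≠ 0 := (Real.Gamma_pos_of_pos (by positivity)).ne'
  have e1 : ∏ i : Fin (d + 1), Real.Gamma (β * ((m : ℝ) - (i : ℕ)) / 2) =
      ∏ j : Fin (d + 1), Real.Gamma (1 + β * aParam β m (d + 1) / 2 + β * (j : ℕ) / 2) := by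
    rw [← Equiv.prod_comp Fin.revPerm]
    refine Finset.prod_congr rfl fun j _ => ?_
    rw [Fin.revPerm_apply, Fin.val_rev, Nat.cast_sub (by omega), aParam]
    congr 1
    field_simp
    push_cast; ring
  have e2 : ∏ j : Fin d, Real.Gamma (β * (((d + 1 : ℕ) : ℝ) - ((j : ℕ) + 1)) / 2) =
      ∏ j : Fin d, Real.Gamma (β * ((j : ℕ) + 1) / 2) := by
    rw [← Equiv.prod_comp Fin.revPerm]
    refine Finset.prod_congr rfl fun j _ => ?_
    rw [Fin.revPerm_apply, Fin.val_rev, Nat.cast_sub (by omega)]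
    congr 1
    push_cast; ring
  have e3 : ∏ j : Fin (d + 1), (((j : ℕ) : ℝ) + 1) = (d + 1).factorial := by
    rw [← Finset.prod_range_add_one_eq_factorial, Finset.prod_range]
    push_cast; rfl
  have e4 : ∀ j : ℕ, ∀ t : ℝ, Real.Gamma (1 + β * (j + 1) / 2) * t / Real.Gamma (1 + β / 2) =
      (j + 1) * Real.Gamma (β * (j + 1) / 2) * t / Real.Gamma (β / 2) := by
    intro j t
    rw [add_comm 1 (β * _ / 2), Real.Gamma_add_one (by positivity), add_comm 1 (β / 2),
      Real.Gamma_add_one (by positivity)]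
    field_simp
  have e5 : ((d + 1 : ℕ) : ℝ) * (aParam β m (d + 1) * β / 2 + 1 + (((d + 1 : ℕ) : ℝ) - 1) * β / 2) =
      β * ((d + 1) * m) / 2 := by
    rw [aParam]
    field_simp
    push_cast; ring
  rw [sConst, e5, e1, e2]
  simp only [e4, Finset.prod_div_distrib, Finset.prod_mul_distrib, e3, Finset.prod_const,
    Finset.card_univ, Fintype.card_fin]
  rw [Fin.prod_univ_castSucc fun j : Fin (d + 1) => Real.Gamma (β * ((j : ℕ) + 1) / 2)]
  have := hG d
  simp only [Fin.val_castSucc, Fin.val_last]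
  push_cast
  field_simp

/-- The powers of 2 cancel because the degrees of freedom add up to βnm. The remaining n! is
compensated by the n! labellings of each polynomial. -/
theorem prod_const_mul_sConst {β : ℝ} (hβ : 0 < β) {m d : ℕ} (hm : d + 1 ≤ m) :
    (∏ i : Fin (d + 1), 2 ^ (-(β * ((m : ℝ) - (i : ℕ)) / 2)) /
        Real.Gamma (β * ((m : ℝ) - (i : ℕ)) / 2)) *
      (∏ j : Fin d, 2 ^ (-(β * (((d + 1 : ℕ) : ℝ) - ((j : ℕ) + 1)) / 2)) /
        Real.Gamma (β * (((d + 1 : ℕ) : ℝ) - ((j : ℕ) + 1)) / 2)) *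
      sConst β m (d + 1) = (d + 1).factorial := by
  have h1 : ∏ i : Fin (d + 1), Real.Gamma (β * ((m : ℝ) - (i : ℕ)) / 2) ≠ 0 :=
    Finset.prod_ne_zero_iff.2 fun i _ =>
      (Real.Gamma_pos_of_pos (half_pos (degrees_pos hβ hm i))).ne'
  have h2 : ∏ j : Fin d, Real.Gamma (β * (((d + 1 : ℕ) : ℝ) - ((j : ℕ) + 1)) / 2) ≠ 0 :=
    Finset.prod_ne_zero_iff.2 fun j _ =>
      (Real.Gamma_pos_of_pos (half_pos (degrees_pos' hβ j))).ne'
  have h3 : (∏ i : Fin (d + 1), (2 : ℝ) ^ (-(β * ((m : ℝ) - (i : ℕ)) / 2))) *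
      (∏ j : Fin d, (2 : ℝ) ^ (-(β * (((d + 1 : ℕ) : ℝ) - ((j : ℕ) + 1)) / 2))) *
      2 ^ (β * ((d + 1) * m) / 2) = 1 := by
    rw [← Real.rpow_sum_of_pos two_pos, ← Real.rpow_sum_of_pos two_pos, ← Real.rpow_add two_pos,
      ← Real.rpow_add two_pos, ← sum_sub_add_sum_sub]
    have : ∀ j : ℕ, ((d + 1 : ℕ) : ℝ) - ((j : ℝ) + 1) = d - j := fun j => by push_cast; ring
    simp only [this, Finset.sum_neg_distrib, ← Finset.sum_div, ← Finset.mul_sum]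
    rw [← Real.rpow_zero 2]
    congr 1
    ring
  rw [sConst_eq hβ, Finset.prod_div_distrib, Finset.prod_div_distrib]
  generalize (2 : ℝ) ^ (β * ((d + 1) * m) / 2) = A at *
  field_simp
  linear_combination h3

/-- The joint density without its Vandermonde factor. -/
noncomputable def reducedDensity (β : ℝ) (m n : ℕ) (F : ℝ → ℝ) (z : Fin n → ℂ) : ℝ :=
  (cConst β m n)⁻¹ * Real.exp (-(∑ j, (z j).re) / 2) *
    |(∏ j, z j).re| ^ (aParam β m n * β / 2 - β / 2) *
    (∏ j, ∏ k, ‖z j - starRingEnd ℂ (z k)‖ ^ (β / 2 - 1)) *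
    (F (Real.tan (∑ j, (z j).arg)) / Real.tan (∑ j, (z j).arg) ^ (β * n / 2 - 1))

set_option maxHeartbeats 800000 in
theorem squaredDensity_mul {β : ℝ} (hβ : 0 < β) {m d : ℕ} (hm : d + 1 ≤ m) (F : ℝ → ℝ)
    {u : Fin (d + 1) → ℝ} {v : Fin d → ℝ} {l : ℝ} (hu : ∀ i, 0 < u i) (hv : ∀ i, 0 < v i)
    (hl : 0 < l) {z : Fin (d + 1) → ℂ} (him : ∀ j, 0 < (z j).im)
    (hz : rootCoeffs z = perturbedCoeffs l (stieltjesPair d u v)) :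
    squaredDensity β m d u v * F l = (d + 1).factorial * (stieltjesJacobian d u v *
      (|(stieltjesPair d u v).1 0| * l ^ d * reducedDensity β m (d + 1) F z)) := by
  have hP0 := abs_stieltjesPair_fst_zero hu v
  have hx0 : (stieltjesPair d u v).1 0 ≠ 0 := fst_zero_ne_zero (stieltjesPair_mem hu hv)
  have htan : Real.tan (∑ j, (z j).arg) = l := by
    rw [← coeffsL_rootCoeffs him, hz, coeffsL_perturbedCoeffs hx0]
  have hpp : ∏ j, ∏ k, ‖z j - starRingEnd ℂ (z k)‖ ^ (β / 2 - 1) =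
      2 ^ (((d + 1 : ℕ) : ℝ) * (β / 2 - 1)) * l ^ (((d + 1 : ℕ) : ℝ) * (β / 2 - 1)) *
        ((∏ i, (u i ^ (d - (i : ℕ) + 1)) ^ (β / 2 - 1)) *
          ∏ i, (v i ^ (d - (i : ℕ))) ^ (β / 2 - 1)) := by
    have h1 : ∀ j, ∏ k, ‖z j - starRingEnd ℂ (z k)‖ ^ (β / 2 - 1) =
        (∏ k, ‖z j - starRingEnd ℂ (z k)‖) ^ (β / 2 - 1) := fun j =>
      Real.finsetProd_rpow _ _ (fun k _ => norm_nonneg _) _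
    simp only [h1]
    rw [Real.finsetProd_rpow _ _ fun j _ => Finset.prod_nonneg fun k _ => norm_nonneg _,
      prod_norm_sub_conj hu hv hl hz,
      Real.finsetProd_rpow _ _ fun i _ => (pow_pos (hu i) _).le,
      Real.finsetProd_rpow _ _ fun i _ => (pow_pos (hv i) _).le,
      Real.mul_rpow (by positivity), Real.mul_rpow, mul_pow, Real.mul_rpow (by positivity)
        (by positivity), ← Real.rpow_natCast_mul two_pos.le, ← Real.rpow_natCast_mul hl.le]
    · exact Finset.prod_nonneg fun i _ => (pow_pos (hu i) _).le
    · exact Finset.prod_nonneg fun i _ => (pow_pos (hv i) _).le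
    · exact mul_nonneg (Finset.prod_nonneg fun i _ => (pow_pos (hu i) _).le)
        (Finset.prod_nonneg fun i _ => (pow_pos (hv i) _).le)
  -- The Jacobian factor l^d and the powers of l from the conjugate differences together cancel the
  -- denominator l^(βn/2 - 1).
  have hlp : l ^ d * l ^ (((d + 1 : ℕ) : ℝ) * (β / 2 - 1)) = l ^ (β * ((d + 1 : ℕ) : ℝ) / 2 - 1) := by
    rw [← Real.rpow_natCast, ← Real.rpow_add hl]
    congr 1; push_cast; ring
  -- The exponent of u_i splits into the Jacobian (d - i), the factor |P(0)| (1), the power of |Re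
  -- ∏z| and the conjugate differences; this fixes the value of a.
  have hup : ∀ i : Fin (d + 1), u i ^ (β * ((m : ℝ) - (i : ℕ)) / 2 - 1) = u i ^ (d - (i : ℕ)) *
      (u i * u i ^ (aParam β m (d + 1) * β / 2 - β / 2)) *
        (u i ^ (d - (i : ℕ) + 1)) ^ (β / 2 - 1) := by
    intro i
    have hi : (i : ℕ) ≤ d := by omega
    nth_rw 3 [← Real.rpow_one (u i)]
    rw [← Real.rpow_natCast_mul (hu i).le, ← Real.rpow_natCast (u i) (d - i),
      ← Real.rpow_add (hu i), ← Real.rpow_add (hu i), ← Real.rpow_add (hu i), aParam]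
    congr 1
    push_cast [Nat.cast_sub hi]
    field_simp
    ring
  have hvp : ∀ j : Fin d, v j ^ (β * (((d + 1 : ℕ) : ℝ) - ((j : ℕ) + 1)) / 2 - 1) =
      v j ^ (d - 1 - (j : ℕ)) * (v j ^ (d - (j : ℕ))) ^ (β / 2 - 1) := by
    intro j
    have hj : (j : ℕ) ≤ d := by omega
    have hj1 : ((d - 1 - (j : ℕ) : ℕ) : ℝ) = d - 1 - (j : ℕ) := by
      rw [Nat.cast_sub (by omega), Nat.cast_sub (by omega), Nat.cast_one]
    rw [← Real.rpow_natCast_mul (hv j).le, ← Real.rpow_natCast (v j) (d - 1 - j),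
      ← Real.rpow_add (hv j), hj1, Nat.cast_sub hj]
    congr 1
    push_cast
    ring
  have hexp : Real.exp (-(∑ j, (z j).re) / 2) =
      (∏ i, Real.exp (-u i / 2)) * ∏ i, Real.exp (-v i / 2) := by
    rw [sum_re_eq hz, stieltjesPair_fst_last, ← Real.exp_sum, ← Real.exp_sum, ← Real.exp_add,
      ← Finset.sum_div, ← Finset.sum_div, Finset.sum_neg_distrib, Finset.sum_neg_distrib]
    congr 1; ring
  have hre : |(∏ j, z j).re| ^ (aParam β m (d + 1) * β / 2 - β / 2) =
      ∏ i, u i ^ (aParam β m (d + 1) * β / 2 - β / 2) := by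
    rw [abs_re_prod hz, hP0, Real.finsetProd_rpow _ _ fun i _ => (hu i).le]
  have hK := prod_const_mul_sConst hβ hm
  have hs : sConst β m (d + 1) ≠ 0 := fun h => by
    rw [h, mul_zero] at hK
    exact (Nat.cast_ne_zero.2 (Nat.factorial_ne_zero (d + 1))) hK.symm
  have h2 : (2 : ℝ) ^ (((d + 1 : ℕ) : ℝ) * (β / 2 - 1)) ≠ 0 := (Real.rpow_pos_of_pos two_pos _).ne'
  have hl2 : l ^ (β * ((d + 1 : ℕ) : ℝ) / 2 - 1) ≠ 0 := (Real.rpow_pos_of_pos hl _).ne'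
  rw [squaredDensity, reducedDensity, htan, hpp, hexp, hre, hP0, cConst, stieltjesJacobian, ← hK]
  simp only [chiSqDensity, hup, hvp, Finset.prod_mul_distrib]
  rw [← hlp] at hl2 ⊢
  have hl3 := right_ne_zero_of_mul hl2
  have hl4 := left_ne_zero_of_mul hl2
  clear hK hup hvp hpp hexp hre hlp hx0 hP0 htan hl2
  generalize (2 : ℝ) ^ (((d + 1 : ℕ) : ℝ) * (β / 2 - 1)) = A at *
  generalize l ^ (((d + 1 : ℕ) : ℝ) * (β / 2 - 1)) = B at *
  generalize sConst β m (d + 1) = s at *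
  generalize ∏ x, (u x ^ (d - (x : ℕ) + 1)) ^ (β / 2 - 1) = p₁
  generalize ∏ x, (v x ^ (d - (x : ℕ))) ^ (β / 2 - 1) = p₂
  generalize ∏ x, u x ^ (aParam β m (d + 1) * β / 2 - β / 2) = p₃
  generalize ∏ x, Real.exp (-u x / 2) = p₄
  generalize ∏ x, Real.exp (-v x / 2) = p₅
  generalize ∏ x, u x ^ (d - (x : ℕ)) = p₆
  generalize ∏ x, v x ^ (d - 1 - (x : ℕ)) = p₇
  generalize (∏ i : Fin (d + 1), (2 : ℝ) ^ (-(β * ((m : ℝ) - (i : ℕ)) / 2)) /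
    Real.Gamma (β * ((m : ℝ) - (i : ℕ)) / 2)) = p₈
  generalize (∏ j : Fin d, (2 : ℝ) ^ (-(β * (((d + 1 : ℕ) : ℝ) - ((j : ℕ) + 1)) / 2)) /
    Real.Gamma (β * (((d + 1 : ℕ) : ℝ) - ((j : ℕ) + 1)) / 2)) = p₉
  generalize ∏ x, u x = p₀
  field_simp

/-! ### Transport of null sets through the changes of variables -/

section nullSets

variable {n d : ℕ}

theorem vandermondeSq_pos {z : Fin n → ℂ} (hz : Function.Injective fun j => (z j).re) :
    0 < vandermondeSq z :=
  Finset.prod_pos fun _ _ => Finset.prod_pos fun _ hk => pow_pos (norm_pos_iff.2 <|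
    sub_ne_zero.2 fun h => (Finset.mem_Ioi.1 hk).ne (hz (congrArg Complex.re h))) 2

/-- Apply the change of variables to the indicator of a measurable hull of A: the integral vanishes,
while the Vandermonde factor is positive almost everywhere. -/
theorem ae_rootCoeffs_notMem {A : Set (Fin n → ℂ)} (hA : volume A = 0) :
    ∀ᵐ z, rootCoeffs z ∉ A := by
  have mT := measurableSet_toMeasurable volume A
  have hT : volume (toMeasurable volume A) = 0 := by rwa [measure_toMeasurable]
  have m1 : Measurable ((toMeasurable volume A).indicator (1 : (Fin n → ℂ) → ENNReal)) :=
    measurable_one.indicator mT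
  have h := lintegral_vandermondeSq_mul m1
  have m2 : Measurable fun z : Fin n → ℂ => ENNReal.ofReal (vandermondeSq z) *
      (toMeasurable volume A).indicator (1 : (Fin n → ℂ) → ENNReal) (rootCoeffs z) :=
    measurable_vandermondeSq.ennreal_ofReal.mul (m1.comp measurable_rootCoeffs)
  rw [lintegral_indicator_one mT, hT, mul_zero, lintegral_eq_zero_iff m2] at h
  filter_upwards [h, ae_injective_re] with z hz hi hzA
  rw [Set.indicator_of_mem (subset_toMeasurable _ _ hzA), Pi.one_apply, mul_one, Pi.zero_apply,
    ENNReal.ofReal_eq_zero] at hz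
  exact absurd (vandermondeSq_pos hi) hz.not_gt

theorem measurable_perturbedCoeffs_stieltjesPair : Measurable
    fun y : (ℝ × (Fin (d + 1) → ℝ)) × (Fin d → ℝ) =>
      perturbedCoeffs y.1.1 (stieltjesPair d y.1.2 y.2) :=
  measurable_perturbedCoeffs.comp ((measurable_fst.comp measurable_fst).prodMk
    ((measurable_stieltjesPair d).comp ((measurable_snd.comp measurable_fst).prodMk
      measurable_snd)))

theorem measurable_acute_integrand {g : (Fin (d + 1) → ℂ) → ENNReal} (hg : Measurable g) :
    Measurable fun y : (ℝ × (Fin (d + 1) → ℝ)) × (Fin d → ℝ) =>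
      ENNReal.ofReal (stieltjesJacobian d y.1.2 y.2) *
        (ENNReal.ofReal (|(stieltjesPair d y.1.2 y.2).1 0| * y.1.1 ^ d) *
          g (perturbedCoeffs y.1.1 (stieltjesPair d y.1.2 y.2))) := by
  have m0 : Measurable fun y : (ℝ × (Fin (d + 1) → ℝ)) × (Fin d → ℝ) => (y.1.2, y.2) := by fun_prop
  have m1 := (measurable_stieltjesPair d).comp m0
  have m2 : Measurable fun y : (ℝ × (Fin (d + 1) → ℝ)) × (Fin d → ℝ) =>
      (stieltjesPair d y.1.2 y.2).1 0 := (measurable_pi_apply 0).comp (measurable_fst.comp m1)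
  refine ((measurable_stieltjesJacobian d).comp m0).ennreal_ofReal.mul (Measurable.mul ?_
    (hg.comp measurable_perturbedCoeffs_stieltjesPair))
  have m3 : Measurable fun y : (ℝ × (Fin (d + 1) → ℝ)) × (Fin d → ℝ) => y.1.1 ^ d := by fun_prop
  exact ((_root_.measurable_abs.comp m2).mul m3).ennreal_ofReal

theorem stieltjesJacobian_pos {u : Fin (d + 1) → ℝ} {v : Fin d → ℝ} (hu : ∀ i, 0 < u i)
    (hv : ∀ i, 0 < v i) : 0 < stieltjesJacobian d u v :=
  mul_pos (Finset.prod_pos fun i _ => pow_pos (hu i) _) (Finset.prod_pos fun i _ => pow_pos (hv i) _)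

/-- The same argument in the parameters (l, u, v), whose Jacobian is positive. It guarantees that
almost every parameter yields roots with distinct real parts. -/
theorem ae_perturbedCoeffs_notMem {A : Set (Fin (d + 1) → ℂ)} (hA : volume A = 0) :
    ∀ᵐ l ∂(volume.restrict (Set.Ioi (0 : ℝ))), ∀ᵐ u ∂(orthantMeasure (d + 1)),
      ∀ᵐ v ∂(orthantMeasure d), perturbedCoeffs l (stieltjesPair d u v) ∉ A := by
  have mT := measurableSet_toMeasurable volume A
  have hT : volume (toMeasurable volume A) = 0 := by rwa [measure_toMeasurable]
  have m1 : Measurable ((toMeasurable volume A).indicator (1 : (Fin (d + 1) → ℂ) → ENNReal)) :=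
    measurable_one.indicator mT
  have mI := measurable_acute_integrand m1
  have h := setLIntegral_acuteConfigurations m1
  have h0 : ∫⁻ z in acuteConfigurations (d + 1), ENNReal.ofReal (vandermondeSq z) *
      (toMeasurable volume A).indicator (1 : (Fin (d + 1) → ℂ) → ENNReal) (rootCoeffs z) = 0 := by
    refine lintegral_eq_zero_of_ae_eq_zero (ae_restrict_of_ae ?_)
    filter_upwards [ae_rootCoeffs_notMem hT] with z hz
    rw [Set.indicator_of_notMem hz, mul_zero, Pi.zero_apply]
  rw [h0, zero_eq_mul, or_iff_right (Nat.cast_ne_zero.2 (Nat.factorial_ne_zero _)),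
    lintegral_eq_zero_iff mI.lintegral_prod_right'.lintegral_prod_right'] at h
  filter_upwards [h, ae_restrict_mem measurableSet_Ioi] with l hl hl0
  have hl' := (lintegral_eq_zero_iff
    (mI.lintegral_prod_right'.comp (measurable_prodMk_left (x := l)))).1 hl
  filter_upwards [hl', ae_orthantMeasure_pos (d + 1)] with u hu hu0
  have hu' := (lintegral_eq_zero_iff (mI.comp (measurable_prodMk_left (x := (l, u))))).1 hu
  filter_upwards [hu', ae_orthantMeasure_pos d] with v hv hv0 hvA
  have hP := fst_zero_ne_zero (stieltjesPair_mem hu0 hv0)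
  rw [Function.comp_apply, Set.indicator_of_mem (subset_toMeasurable _ _ hvA), Pi.one_apply,
    mul_one, Pi.zero_apply, mul_eq_zero, ENNReal.ofReal_eq_zero, ENNReal.ofReal_eq_zero] at hv
  rcases hv with hv | hv
  · exact absurd (stieltjesJacobian_pos hu0 hv0) hv.not_gt
  · exact absurd (mul_pos (abs_pos.2 hP) (pow_pos hl0 d)) hv.not_gt

theorem measurableSet_acuteConfigurations : MeasurableSet (acuteConfigurations (d + 1)) := by
  have h1 : acuteConfigurations (d + 1) = rootCoeffs ⁻¹' coeffsRegion d := Set.ext fun z =>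
    ⟨mem_coeffsRegion_of_mem_acuteConfigurations, mem_acuteConfigurations_of_mem_coeffsRegion⟩
  exact h1 ▸ measurable_rootCoeffs measurableSet_coeffsRegion

/-- The map from acute configurations to the perturbation parameter is quasi measure preserving. -/
theorem ae_tan_sum_arg_notMem {N : Set ℝ} (hN : volume N = 0) :
    ∀ᵐ z : Fin (d + 1) → ℂ, z ∈ acuteConfigurations (d + 1) →
      Real.tan (∑ j, (z j).arg) ∉ N := by
  have mT := measurableSet_toMeasurable volume N
  have hT : volume (toMeasurable volume N) = 0 := by rwa [measure_toMeasurable]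
  have m1 : Measurable ((coeffsL (d := d) ⁻¹' toMeasurable volume N).indicator
      (1 : (Fin (d + 1) → ℂ) → ENNReal)) := measurable_one.indicator (measurable_coeffsL mT)
  have h := setLIntegral_acuteConfigurations m1
  have h0 : ∫⁻ l in Set.Ioi (0 : ℝ), ∫⁻ u, ∫⁻ v, ENNReal.ofReal (stieltjesJacobian d u v) *
      (ENNReal.ofReal (|(stieltjesPair d u v).1 0| * l ^ d) *
        (coeffsL (d := d) ⁻¹' toMeasurable volume N).indicator 1
          (perturbedCoeffs l (stieltjesPair d u v)))
        ∂(orthantMeasure d) ∂(orthantMeasure (d + 1)) = 0 := by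
    refine lintegral_eq_zero_of_ae_eq_zero (ae_restrict_of_ae ?_)
    filter_upwards [measure_eq_zero_iff_ae_notMem.1 hT] with l hl
    refine lintegral_eq_zero_of_ae_eq_zero ?_
    filter_upwards [ae_orthantMeasure_pos (d + 1)] with u hu
    refine lintegral_eq_zero_of_ae_eq_zero ?_
    filter_upwards [ae_orthantMeasure_pos d] with v hv
    rw [Set.indicator_of_notMem, mul_zero, mul_zero, Pi.zero_apply]
    rwa [Set.mem_preimage, coeffsL_perturbedCoeffs (fst_zero_ne_zero (stieltjesPair_mem hu hv))]
  have m2 : Measurable fun z : Fin (d + 1) → ℂ => ENNReal.ofReal (vandermondeSq z) *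
      (coeffsL (d := d) ⁻¹' toMeasurable volume N).indicator
        (1 : (Fin (d + 1) → ℂ) → ENNReal) (rootCoeffs z) :=
    measurable_vandermondeSq.ennreal_ofReal.mul (m1.comp measurable_rootCoeffs)
  rw [h0, mul_zero, setLIntegral_eq_zero_iff measurableSet_acuteConfigurations m2] at h
  filter_upwards [h, ae_injective_re] with z hz hi hza hzN
  have h2 := hz hza
  rw [Set.indicator_of_mem, Pi.one_apply, mul_one, ENNReal.ofReal_eq_zero] at h2
  · exact absurd (vandermondeSq_pos hi) h2.not_gt
  · rw [Set.mem_preimage, coeffsL_rootCoeffs hza.1]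
    exact subset_toMeasurable _ _ hzN

theorem measurableSet_injective_re :
    MeasurableSet {z : Fin n → ℂ | Function.Injective fun j => (z j).re} := by
  have : {z : Fin n → ℂ | Function.Injective fun j => (z j).re} =
      ⋂ (i : Fin n) (j : Fin n) (_ : i ≠ j), {z | (z i).re = (z j).re}ᶜ := by
    ext z
    simp only [Set.mem_ofPred_eq, Set.mem_iInter, Set.mem_compl_iff]
    exact ⟨fun h i j hij he => hij (h he), fun h i j he => by_contra fun hij => h i j hij he⟩
  rw [this]
  refine MeasurableSet.iInter fun i => MeasurableSet.iInter fun j => MeasurableSet.iInter fun _ =>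
    (measurableSet_eq_fun ?_ ?_).compl <;> fun_prop

end nullSets

/-! ### Symmetry and measurability of the joint density -/

section densities

variable {β : ℝ} {m n : ℕ} {F : ℝ → ℝ}

theorem jointDensity_eq (z : Fin n → ℂ) :
    jointDensity β m n F z = vandermondeSq z * reducedDensity β m n F z := by
  rw [jointDensity, reducedDensity, vandermondeSq]
  ring

theorem measurable_tan_sum_arg : Measurable fun z : Fin n → ℂ => Real.tan (∑ j, (z j).arg) := by
  have h : Measurable Real.tan := by
    have : Real.tan = fun x => Real.sin x / Real.cos x := funext Real.tan_eq_sin_div_cos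
    rw [this]; fun_prop
  exact h.comp (by fun_prop)

theorem measurable_reducedDensity (hF : Measurable F) : Measurable (reducedDensity β m n F) := by
  have h := measurable_tan_sum_arg (n := n)
  unfold reducedDensity
  refine Measurable.mul (by fun_prop) ((hF.comp h).div (h.pow_const _))

theorem reducedDensity_comp_perm (z : Fin n → ℂ) (σ : Equiv.Perm (Fin n)) :
    reducedDensity β m n F (fun j => z (σ j)) = reducedDensity β m n F z := by
  simp only [reducedDensity]
  rw [Equiv.sum_comp σ fun j => (z j).re, Equiv.sum_comp σ fun j => (z j).arg,
    Equiv.prod_comp σ z,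
    Equiv.prod_comp σ fun j => ∏ k, ‖z j - starRingEnd ℂ (z (σ k))‖ ^ (β / 2 - 1)]
  have h : ∀ j, ∏ k, ‖z j - starRingEnd ℂ (z (σ k))‖ ^ (β / 2 - 1) =
      ∏ k, ‖z j - starRingEnd ℂ (z k)‖ ^ (β / 2 - 1) := fun j =>
    Equiv.prod_comp σ fun k => ‖z j - starRingEnd ℂ (z k)‖ ^ (β / 2 - 1)
  simp only [h]

end densities

/-! ### The law of the characteristic polynomial -/

section law

variable {β : ℝ} {m d : ℕ} {F : ℝ → ℝ}

theorem measurable_gram : Measurable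
    fun p : (Fin (d + 1) → ℝ) × (Fin d → ℝ) => gram p.1 p.2 := by
  have h : ∀ i j, Measurable fun p : (Fin (d + 1) → ℝ) × (Fin d → ℝ) =>
      bidiagonal p.1 (p.2 : Fin (d + 1 - 1) → ℝ) i j := by
    intro i j
    simp only [bidiagonal, Matrix.of_apply]
    split_ifs <;> fun_prop
  refine measurable_pi_lambda _ fun i => measurable_pi_lambda _ fun j => ?_
  simp only [gram, Matrix.mul_apply, Matrix.transpose_apply]
  exact Finset.measurable_sum _ fun k _ => (h k i).mul (h k j)

instance : SFinite (coefficientLaw β m (d + 1)) := by unfold coefficientLaw; infer_instance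

instance : SFinite (laguerreLaw β m (d + 1)) := by unfold laguerreLaw; infer_instance

instance : SFinite (densityMeasure F) := by unfold densityMeasure; infer_instance

theorem charCoeffs_gram (l : ℝ) (x : Fin (d + 1) → ℝ) (y : Fin d → ℝ) :
    charCoeffs (gram x y, l) =
      perturbedCoeffs l (stieltjesPair d (fun i => x i ^ 2) fun i => y i ^ 2) :=
  monicOf_injective (by rw [monicOf_charCoeffs, charpoly_perturbed])

/-- The law of the characteristic polynomial of the perturbed matrix. -/
theorem lintegral_map_charCoeffs (hβ : 0 < β) (hm : d + 1 ≤ m) (hF : Measurable F)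
    (hF0 : ∀ l ≤ 0, F l = 0) {f : (Fin (d + 1) → ℂ) → ENNReal} (hf : Measurable f) :
    ∫⁻ c, f c ∂(((laguerreLaw β m (d + 1)).prod (densityMeasure F)).map charCoeffs) =
      ∫⁻ l in Set.Ioi (0 : ℝ), ∫⁻ u, ∫⁻ v, ENNReal.ofReal (squaredDensity β m d u v * F l) *
        f (perturbedCoeffs l (stieltjesPair d u v))
          ∂(orthantMeasure d) ∂(orthantMeasure (d + 1)) := by
  have mc : Measurable fun a : Matrix (Fin (d + 1)) (Fin (d + 1)) ℝ × ℝ => f (charCoeffs a) :=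
    hf.comp (measurable_charCoeffs d)
  have e1 : ∀ l : ℝ, ∫⁻ J, f (charCoeffs (J, l)) ∂(laguerreLaw β m (d + 1)) =
      ∫⁻ u, ∫⁻ v, ENNReal.ofReal (squaredDensity β m d u v) *
        f (perturbedCoeffs l (stieltjesPair d u v))
          ∂(orthantMeasure d) ∂(orthantMeasure (d + 1)) := by
    intro l
    have hg : Measurable fun x : (Fin (d + 1) → ℝ) × (Fin d → ℝ) =>
        f (perturbedCoeffs l (stieltjesPair d x.1 x.2)) :=
      hf.comp (measurable_perturbedCoeffs.comp
        (measurable_prodMk_left.comp (measurable_stieltjesPair d)))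
    rw [← lintegral_coefficientLaw hβ hm hg]
    have h1 : laguerreLaw β m (d + 1) = (coefficientLaw β m (d + 1)).map
      (fun p : (Fin (d + 1) → ℝ) × (Fin d → ℝ) => gram p.1 p.2) := rfl
    have m1 : Measurable fun J : Matrix (Fin (d + 1)) (Fin (d + 1)) ℝ => f (charCoeffs (J, l)) :=
      mc.comp measurable_prodMk_right
    rw [h1, lintegral_map m1 measurable_gram]
    simp only [charCoeffs_gram]
  have m1 : Measurable fun l => ∫⁻ J, f (charCoeffs (J, l)) ∂(laguerreLaw β m (d + 1)) :=
    mc.lintegral_prod_left'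
  rw [lintegral_map hf (measurable_charCoeffs d), lintegral_prod_symm _ mc.aemeasurable,
    densityMeasure, lintegral_withDensity_eq_lintegral_mul _ hF.ennreal_ofReal m1,
    ← lintegral_indicator measurableSet_Ioi]
  refine lintegral_congr fun l => ?_
  by_cases hl : 0 < l
  · rw [Set.indicator_of_mem (Set.mem_Ioi.2 hl), Pi.mul_apply, e1,
      ← lintegral_const_mul' _ _ ENNReal.ofReal_ne_top]
    refine lintegral_congr_ae ?_
    filter_upwards [ae_orthantMeasure_pos (d + 1)] with u hu
    rw [← lintegral_const_mul' _ _ ENNReal.ofReal_ne_top]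
    refine lintegral_congr_ae ?_
    filter_upwards [ae_orthantMeasure_pos d] with v hv
    have hs : 0 ≤ squaredDensity β m d u v := mul_nonneg
      (Finset.prod_nonneg fun i _ => chiSqDensity_nonneg (degrees_pos hβ hm i) (hu i))
      (Finset.prod_nonneg fun i _ => chiSqDensity_nonneg (degrees_pos' hβ i) (hv i))
    rw [ENNReal.ofReal_mul hs]
    ring
  · rw [Set.indicator_of_notMem (by simpa using hl), Pi.mul_apply, hF0 l (not_lt.1 hl),
      ENNReal.ofReal_zero, zero_mul]

/-- The joint density, extended by zero outside of the acute configurations. -/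
noncomputable def acuteDensity (β : ℝ) (m d : ℕ) (F : ℝ → ℝ) : (Fin (d + 1) → ℂ) → ENNReal :=
  (acuteConfigurations (d + 1)).indicator fun z => ENNReal.ofReal (jointDensity β m (d + 1) F z)

theorem measurable_acuteDensity (hF : Measurable F) : Measurable (acuteDensity β m d F) := by
  refine Measurable.indicator ?_ measurableSet_acuteConfigurations
  simp only [jointDensity_eq]
  exact (measurable_vandermondeSq.mul (measurable_reducedDensity hF)).ennreal_ofReal

theorem acuteDensity_comp_perm (z : Fin (d + 1) → ℂ) (σ : Equiv.Perm (Fin (d + 1))) :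
    acuteDensity β m d F (fun j => z (σ j)) = acuteDensity β m d F z := by
  have h : (fun j => z (σ j)) ∈ acuteConfigurations (d + 1) ↔ z ∈ acuteConfigurations (d + 1) := by
    simp only [acuteConfigurations, Set.mem_ofPred_eq]
    rw [Equiv.sum_comp σ fun j => (z j).arg, σ.surjective.forall (p := fun j => 0 < (z j).im)]
  by_cases hz : z ∈ acuteConfigurations (d + 1)
  · rw [acuteDensity, Set.indicator_of_mem (h.2 hz), Set.indicator_of_mem hz, jointDensity_eq,
      jointDensity_eq, vandermondeSq_comp_perm, reducedDensity_comp_perm]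
  · rw [acuteDensity, Set.indicator_of_notMem (fun h' => hz (h.1 h')), Set.indicator_of_notMem hz]

/-- Both sides become integrals over (l, u, v), and the integrands agree pointwise by
`squaredDensity_mul`. -/
theorem map_charCoeffs_eq (hβ : 0 < β) (hm : d + 1 ≤ m) (hF : Measurable F)
    (hF0 : ∀ l ≤ 0, F l = 0) :
    ((laguerreLaw β m (d + 1)).prod (densityMeasure F)).map charCoeffs =
      (volume.withDensity (acuteDensity β m d F)).map rootCoeffs := by
  obtain ⟨r, hr, hr2⟩ := exists_measurable_rightInverse_rootCoeffs (d + 1)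
  refine Measure.ext_of_lintegral _ fun f hf => ?_
  -- The reduced density is symmetric in the points, hence a function of the polynomial; composition
  -- with the sorted-root map exhibits it as a measurable one, as the change of variables requires.
  set k := fun c => ENNReal.ofReal (reducedDensity β m (d + 1) F (r c)) with hk
  have mk : Measurable k := ((measurable_reducedDensity hF).comp hr).ennreal_ofReal
  have hkr : ∀ z : Fin (d + 1) → ℂ, (Function.Injective fun j => (z j).re) →
      k (rootCoeffs z) = ENNReal.ofReal (reducedDensity β m (d + 1) F z) := by
    intro z hz
    obtain ⟨τ, hτ, -⟩ := existsUnique_perm_sorted hz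
    have h1 := hr2 _ hτ
    rw [rootCoeffs_comp_perm] at h1
    rw [hk]
    dsimp only
    rw [h1, reducedDensity_comp_perm]
  have e1 : ∫⁻ c, f c ∂((volume.withDensity (acuteDensity β m d F)).map rootCoeffs) =
      ∫⁻ z in acuteConfigurations (d + 1), ENNReal.ofReal (vandermondeSq z) *
        (k (rootCoeffs z) * f (rootCoeffs z)) := by
    have m1 : Measurable fun z : Fin (d + 1) → ℂ => f (rootCoeffs z) :=
      hf.comp measurable_rootCoeffs
    rw [lintegral_map hf measurable_rootCoeffs, lintegral_withDensity_eq_lintegral_mul _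
      (measurable_acuteDensity hF) m1,
      ← lintegral_indicator measurableSet_acuteConfigurations]
    refine lintegral_congr_ae ?_
    filter_upwards [ae_injective_re] with z hz
    by_cases hza : z ∈ acuteConfigurations (d + 1)
    · rw [Set.indicator_of_mem hza, Pi.mul_apply, acuteDensity, Set.indicator_of_mem hza,
        jointDensity_eq, ENNReal.ofReal_mul (vandermondeSq_pos hz).le, hkr z hz, mul_assoc]
    · rw [Set.indicator_of_notMem hza, Pi.mul_apply, acuteDensity, Set.indicator_of_notMem hza,
        zero_mul]
  have m2 : Measurable fun c => k c * f c := mk.mul hf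
  rw [e1, setLIntegral_acuteConfigurations m2, lintegral_map_charCoeffs hβ hm hF hF0 hf,
    ← lintegral_const_mul' _ _ (ENNReal.natCast_ne_top _)]
  refine lintegral_congr_ae ?_
  filter_upwards [ae_perturbedCoeffs_notMem (d := d) volume_image_degenerateConfigurations,
    ae_restrict_mem measurableSet_Ioi] with l hl hl0
  rw [← lintegral_const_mul' _ _ (ENNReal.natCast_ne_top _)]
  refine lintegral_congr_ae ?_
  filter_upwards [hl, ae_orthantMeasure_pos (d + 1)] with u hu hu0
  rw [← lintegral_const_mul' _ _ (ENNReal.natCast_ne_top _)]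
  refine lintegral_congr_ae ?_
  filter_upwards [hu, ae_orthantMeasure_pos d] with v hv hv0
  have hl1 : 0 < l := hl0
  obtain ⟨z, hzs, hz⟩ := exists_sorted_rootCoeffs_eq hv
  have hmem := stieltjesPair_mem hu0 hv0
  have him : ∀ j, 0 < (z j).im := (mem_acuteConfigurations_of_mem_coeffsRegion (by
    rw [hz, perturbedCoeffs_mem (fst_zero_ne_zero hmem) hl1.ne']
    exact ⟨hl1, hmem⟩)).1
  rw [squaredDensity_mul hβ hm F hu0 hv0 hl1 him hz, ← hz, hkr z hzs.injective,
    ENNReal.ofReal_mul (by positivity), ENNReal.ofReal_natCast,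
    ENNReal.ofReal_mul (stieltjesJacobian_pos hu0 hv0).le, ENNReal.ofReal_mul (by positivity)]
  ring

/-- A density of a law on the positive half-line may be chosen measurable, and to vanish outside
of the positive elements of the support. -/
theorem exists_measurable_density (hF : AEMeasurable F volume) (hF_nonneg : ∀ t, 0 ≤ F t)
    (h0 : densityMeasure F (Set.Iic 0) = 0) :
    ∃ G : ℝ → ℝ, Measurable G ∧ (∀ l ≤ 0, G l = 0) ∧ (∀ l ∉ (densityMeasure F).support, G l = 0) ∧
      F =ᵐ[volume] G := by
  set s := (densityMeasure F).support ∩ Set.Ioi 0 with hs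
  have ms : MeasurableSet s := Measure.isClosed_support.measurableSet.inter measurableSet_Ioi
  have hsc : densityMeasure F sᶜ = 0 := by
    rw [hs, Set.compl_inter, Set.compl_Ioi]
    exact measure_union_null Measure.measure_compl_support h0
  refine ⟨s.indicator (hF.mk F), hF.measurable_mk.indicator ms, fun l hl =>
    Set.indicator_of_notMem (fun h => (not_lt.2 hl) h.2) _, fun l hl =>
    Set.indicator_of_notMem (fun h => hl h.1) _, ?_⟩
  rw [densityMeasure, withDensity_apply _ ms.compl, lintegral_eq_zero_iff'
    hF.ennreal_ofReal.restrict, Filter.EventuallyEq, ae_restrict_iff' ms.compl] at hsc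
  filter_upwards [hsc, hF.ae_eq_mk] with t ht hmk
  by_cases hts : t ∈ s
  · rw [Set.indicator_of_mem hts, hmk]
  · have := ht hts
    rw [Pi.zero_apply, ENNReal.ofReal_eq_zero] at this
    rw [Set.indicator_of_notMem hts]
    exact le_antisymm this (hF_nonneg t)

theorem configurations_eq_inter (ν : Measure ℝ) :
    configurations (d + 1) ν = acuteConfigurations (d + 1) ∩
      {z | Real.tan (∑ j, (z j).arg) ∈ ν.support} := by
  ext z; simp [configurations, acuteConfigurations, and_assoc]

theorem measurableSet_configurations (ν : Measure ℝ) :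
    MeasurableSet (configurations (d + 1) ν) :=
  configurations_eq_inter ν ▸ measurableSet_acuteConfigurations.inter
    (measurable_tan_sum_arg Measure.isClosed_support.measurableSet)

/-- The density sees F only at the tangent of the total argument, a map that pulls null sets back to
null sets on acute configurations; so F may be replaced by G. The vanishing of G off the support
accounts for the smaller domain. -/
theorem restrict_configurations_withDensity {G : ℝ → ℝ}
    (hG : ∀ l ∉ (densityMeasure F).support, G l = 0) (hFG : F =ᵐ[volume] G) :
    (volume.restrict (configurations (d + 1) (densityMeasure F))).withDensity
        (fun w => ENNReal.ofReal (jointDensity β m (d + 1) F w)) =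
      volume.withDensity (acuteDensity β m d G) := by
  have hS := configurations_eq_inter (d := d) (densityMeasure F)
  rw [← withDensity_indicator (measurableSet_configurations _)]
  refine withDensity_congr_ae ?_
  filter_upwards [ae_tan_sum_arg_notMem (d := d) hFG] with z hz
  by_cases hza : z ∈ acuteConfigurations (d + 1)
  · have hz' : F _ = G _ := not_not.1 (hz hza)
    rw [acuteDensity, Set.indicator_of_mem hza]
    by_cases ht : Real.tan (∑ j, (z j).arg) ∈ (densityMeasure F).support
    · rw [Set.indicator_of_mem (hS ▸ ⟨hza, ht⟩), jointDensity, jointDensity]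
      simp only [hz']
    · rw [Set.indicator_of_notMem fun h => ht (hS ▸ h).2, jointDensity]
      simp only [hG _ ht, zero_div, mul_zero, ENNReal.ofReal_zero]
  · rw [acuteDensity, Set.indicator_of_notMem hza,
      Set.indicator_of_notMem fun h => hza (hS ▸ h).1]

end law

/-! ### From the law of the polynomial to the law of the eigenvalues -/

theorem ae_withDensity_rootCoeffs_notMem {n : ℕ} (Φ : (Fin n → ℂ) → ENNReal) :
    ∀ᵐ c ∂((volume.withDensity Φ).map rootCoeffs), c ∉ rootCoeffs '' degenerateConfigurations n := by
  have hT : volume (toMeasurable volume (rootCoeffs '' degenerateConfigurations n)) = 0 := by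
    rw [measure_toMeasurable, volume_image_degenerateConfigurations]
  have h := (withDensity_absolutelyContinuous volume Φ).ae_le (ae_rootCoeffs_notMem hT)
  have h' := (ae_map_iff (p := fun c =>
    c ∉ toMeasurable volume (rootCoeffs '' degenerateConfigurations n))
    measurable_rootCoeffs.aemeasurable (measurableSet_toMeasurable _ _).compl).2 h
  filter_upwards [h'] with c hc hc'
  exact hc (subset_toMeasurable _ _ hc')

theorem map_apply_eq_zero_of_unorderedLaw {Ω : Type*} [MeasurableSpace Ω] (P : Measure Ω) {n : ℕ}
    (z : Ω → Fin n → ℂ) {A : Set (Fin n → ℂ)} (hA : unorderedLaw P z A = 0) : P.map z A = 0 := by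
  rw [unorderedLaw, Measure.smul_apply, smul_eq_mul, mul_eq_zero, or_iff_right
    (ENNReal.inv_ne_zero.2 (ENNReal.natCast_ne_top _)), Measure.finsetSum_apply,
    Finset.sum_eq_zero_iff] at hA
  -- A null sum of measures has null terms; the identity permutation gives the law of z itself.
  exact hA 1 (Finset.mem_univ _)

theorem eigenvalue_law {β : ℝ} (hβ : 0 < β) {m d : ℕ} (hm : d + 1 ≤ m)
    {Ω : Type*} [MeasurableSpace Ω] {P : Measure Ω} [IsProbabilityMeasure P]
    {J : Ω → Matrix (Fin (d + 1)) (Fin (d + 1)) ℝ} (hJ : HasLaw J (laguerreLaw β m (d + 1)) P)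
    {F : ℝ → ℝ} (hF : AEMeasurable F volume) (hF_nonneg : ∀ t, 0 ≤ F t)
    {l : Ω → ℝ} (hl : HasLaw l (densityMeasure F) P) (hl_pos : ∀ᵐ ω ∂P, 0 < l ω)
    (hindep : IndepFun J l P) :
    (∃ z : Ω → Fin (d + 1) → ℂ, AEMeasurable z P ∧
      ∀ᵐ ω ∂P, ListsEigenvalues (perturbed (l ω) (J ω)) (z ω)) ∧
    ∀ z : Ω → Fin (d + 1) → ℂ, AEMeasurable z P →
      (∀ᵐ ω ∂P, ListsEigenvalues (perturbed (l ω) (J ω)) (z ω)) →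
      (∀ᵐ ω ∂P, z ω ∈ configurations (d + 1) (densityMeasure F)) ∧
      unorderedLaw P z =
        (volume.restrict (configurations (d + 1) (densityMeasure F))).withDensity
          (fun w => ENNReal.ofReal (jointDensity β m (d + 1) F w)) := by
  have h0 : densityMeasure F (Set.Iic 0) = 0 := by
    rw [← hl.map_eq, Measure.map_apply_of_aemeasurable hl.aemeasurable measurableSet_Iic]
    exact measure_eq_zero_iff_ae_notMem.2 (hl_pos.mono fun ω hω h => not_lt.2 h hω)
  obtain ⟨G, mG, hG0, hGs, hFG⟩ := exists_measurable_density hF hF_nonneg h0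
  have hGF : densityMeasure F = densityMeasure G :=
    withDensity_congr_ae (hFG.mono fun _ ht => congrArg ENNReal.ofReal ht)
  have mJl : AEMeasurable (fun ω => (J ω, l ω)) P := hJ.aemeasurable.prodMk hl.aemeasurable
  have mC : AEMeasurable (fun ω => charCoeffs (J ω, l ω)) P :=
    (measurable_charCoeffs d).comp_aemeasurable mJl
  have hC : P.map (fun ω => charCoeffs (J ω, l ω)) =
      (volume.withDensity (acuteDensity β m d G)).map rootCoeffs := by
    rw [← map_charCoeffs_eq hβ hm mG hG0, ← hGF, ← hJ.map_eq, ← hl.map_eq,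
      ← (indepFun_iff_map_prod_eq_prod_map_map hJ.aemeasurable hl.aemeasurable).1 hindep,
      AEMeasurable.map_map_of_aemeasurable (measurable_charCoeffs d).aemeasurable mJl]
    rfl
  have hns : ∀ᵐ ω ∂P, charCoeffs (J ω, l ω) ∉ rootCoeffs '' degenerateConfigurations (d + 1) := by
    refine ae_of_ae_map mC
      (p := fun c => c ∉ rootCoeffs '' degenerateConfigurations (d + 1)) ?_
    rw [hC]
    exact ae_withDensity_rootCoeffs_notMem _
  refine ⟨?_, fun z hz hze => ?_⟩
  -- The sorted roots are a measurable listing of the eigenvalues, defined almost surely.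
  · obtain ⟨r, hr, hr2⟩ := exists_measurable_rightInverse_rootCoeffs (d + 1)
    refine ⟨fun ω => r (charCoeffs (J ω, l ω)), hr.comp_aemeasurable mC, ?_⟩
    filter_upwards [hns] with ω hω
    obtain ⟨w, hw, hwc⟩ := exists_sorted_rootCoeffs_eq hω
    refine (listsEigenvalues_iff (J ω, l ω) _).2 ?_
    rw [← hwc, hr2 w hw]
  · have hze' : ∀ᵐ ω ∂P, rootCoeffs (z ω) = charCoeffs (J ω, l ω) :=
      hze.mono fun ω hω => (listsEigenvalues_iff (J ω, l ω) _).1 hω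
    have hmap : (P.map z).map rootCoeffs =
        (volume.withDensity (acuteDensity β m d G)).map rootCoeffs := by
      rw [AEMeasurable.map_map_of_aemeasurable measurable_rootCoeffs.aemeasurable hz, ← hC]
      exact Measure.map_congr hze'
    have hinj : ∀ᵐ w ∂(P.map z), Function.Injective fun j => (w j).re := by
      rw [ae_map_iff hz measurableSet_injective_re]
      filter_upwards [hze', hns] with ω h1 h2
      by_contra h3
      exact h2 ⟨z ω, h3, h1⟩
    have hU : unorderedLaw P z =
        (volume.restrict (configurations (d + 1) (densityMeasure F))).withDensity
          (fun w => ENNReal.ofReal (jointDensity β m (d + 1) F w)) := by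
      rw [unorderedLaw_eq_symmetrization hz, symmetrization_congr hinj
        ((withDensity_absolutelyContinuous _ _).ae_le ae_injective_re) hmap,
        symmetrization_withDensity (measurable_acuteDensity mG) acuteDensity_comp_perm,
        restrict_configurations_withDensity hGs hFG]
    refine ⟨?_, hU⟩
    -- The almost sure location follows from the law just found: the complement of the configuration
    -- set is null for the average over labellings, hence for z.
    refine ae_of_ae_map hz (p := fun w => w ∈ configurations (d + 1) (densityMeasure F)) ?_
    refine map_apply_eq_zero_of_unorderedLaw P z ?_
    rw [hU]
    exact (withDensity_absolutelyContinuous _ _).ae_le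
      (ae_restrict_mem (measurableSet_configurations _))

end LaguerrePerturbation

theorem theorem3p1 (β : ℝ) (hβ : 0 < β) (m n : ℕ) [NeZero n] (hmn : n ≤ m)
    {Ω : Type*} [MeasurableSpace Ω] (P : Measure Ω) [IsProbabilityMeasure P]
    (J : Ω → Matrix (Fin n) (Fin n) ℝ)
    (hJ : HasLaw J (LaguerrePerturbation.laguerreLaw β m n) P)
    (F : ℝ → ℝ) (hF : AEMeasurable F volume) (hF_nonneg : ∀ t, 0 ≤ F t)
    (l : Ω → ℝ) (hl : HasLaw l (LaguerrePerturbation.densityMeasure F) P)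
    (hl_pos : ∀ᵐ ω ∂P, 0 < l ω) (hindep : IndepFun J l P) :
    (∃ z : Ω → Fin n → ℂ, AEMeasurable z P ∧
      ∀ᵐ ω ∂P, LaguerrePerturbation.ListsEigenvalues
        (LaguerrePerturbation.perturbed (l ω) (J ω)) (z ω)) ∧
    ∀ z : Ω → Fin n → ℂ, AEMeasurable z P →
      (∀ᵐ ω ∂P, LaguerrePerturbation.ListsEigenvalues
        (LaguerrePerturbation.perturbed (l ω) (J ω)) (z ω)) →
      (∀ᵐ ω ∂P, z ω ∈ LaguerrePerturbation.configurations n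
        (LaguerrePerturbation.densityMeasure F)) ∧
      LaguerrePerturbation.unorderedLaw P z =
        (volume.restrict (LaguerrePerturbation.configurations n
          (LaguerrePerturbation.densityMeasure F))).withDensity
            (fun w => ENNReal.ofReal (LaguerrePerturbation.jointDensity β m n F w)) := by
  cases n with
  | zero => exact absurd rfl (NeZero.ne 0)
  | succ d => exact LaguerrePerturbation.eigenvalue_law hβ hmn hJ hF hF_nonneg hl hl_pos hindep
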